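/- Let $(M,g)$ and $(N,h)$ be compact smooth Riemannian manifolds, each possibly with boundary, of dimensions $m=\dim M$ and $n=\dim N$, let $\mu$ and $\nu$ be their Riemannian volume measures, and let $1\le p<\infty$ with $p>m$ and $p>n$. Equip $M\times N$ with the product metric $g\oplus h$ and the product measure $\mu\otimes\nu$, and let $W^{1,p}(M\times N)$ be the space of all real functions $u\in L^p(M\times N)$ that have (in the interior of $M\times N$) a weak differential $du$ with $|du|_{g\oplus h}\in L^p(M\times N)$, with the norm $\|u\|_{W^{1,p}}=\|u\|_{L^p}+\|du\|_{L^p}$. Let $L^\infty(M,L^p(N))$ be the space of (classes of) essentially bounded strongly measurable functions from $M$ to the Banach space $L^p(N)$. Then $$ W^{1,p}(M\times N)\hookrightarrow L^\infty(M,L^p(N)),\qquad u\mapsto \bigl(x\mapsto u(x,\cdot)\bigr), $$ is a well defined, injective, continuous linear map, and it is a compact operator. -/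

import Mathlib

open Set Filter Topology MeasureTheory
open scoped ENNReal Manifold ContDiff

noncomputable section

/-- Models for manifolds with (possibly empty) boundary: the model embeds its space of coordinates
onto the whole vector space `E` or onto a closed half-space of `E`. This covers `𝓡 n` and `𝓡∂ n`,
and excludes corners. -/
def IsBoundaryModel {E : Type*} [NormedAddCommGroup E] [NormedSpace ℝ E]
    {H : Type*} [TopologicalSpace H] (I : ModelWithCorners ℝ E H) : Prop :=
  range I = univ ∨ ∃ l : E →L[ℝ] ℝ, l ≠ 0 ∧ range I = {v | 0 ≤ l v}

section Charts

variable {E : Type*} [NormedAddCommGroup E] [NormedSpace ℝ E]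
  {H : Type*} [TopologicalSpace H] (I : ModelWithCorners ℝ E H)
  {X : Type*} [TopologicalSpace X] [ChartedSpace H X]

/-- The differential at `z ∈ E` of the inverse of the chart around `x₀`; it sends a coordinate
vector `v` to the tangent vector at `φ⁻¹(z)` whose coordinates in the chart `φ` are `v`. -/
def chartFrame (x₀ : X) (z : E) : E →L[ℝ] TangentSpace I ((extChartAt I x₀).symm z) :=
  mfderivWithin 𝓘(ℝ, E) I (extChartAt I x₀).symm (range I) z

/-- The coordinate representation, in the chart around `x₀`, of a (not necessarily continuous)
1-form `η`: at `z ∈ E` it is the pullback of `η` under the inverse of the chart. -/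
def chartForm (η : ∀ x : X, TangentSpace I x →L[ℝ] ℝ) (x₀ : X) (z : E) : E →L[ℝ] ℝ :=
  (η ((extChartAt I x₀).symm z)).comp (chartFrame I x₀ z)

end Charts

section Volume

variable {n : ℕ} {H : Type*} [TopologicalSpace H]
  {I : ModelWithCorners ℝ (EuclideanSpace ℝ (Fin n)) H}
  {X : Type*} [TopologicalSpace X] [ChartedSpace H X]

/-- The matrix `(g_ij)` of a Riemannian metric in the coordinates of the chart around `x₀`. -/
def chartGram (g : Bundle.RiemannianMetric (fun x : X ↦ TangentSpace I x))
    (x₀ : X) (z : EuclideanSpace ℝ (Fin n)) : Matrix (Fin n) (Fin n) ℝ :=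
  Matrix.of fun i j ↦ g.inner ((extChartAt I x₀).symm z)
    (chartFrame I x₀ z (EuclideanSpace.basisFun (Fin n) ℝ i))
    (chartFrame I x₀ z (EuclideanSpace.basisFun (Fin n) ℝ j))

/-- The Riemannian volume measure on the domain of the chart around `x₀` (and zero outside of it):
the image of `√(det (g_ij)) dz` under the inverse of the chart. -/
def chartVolume [MeasurableSpace X] (g : Bundle.RiemannianMetric (fun x : X ↦ TangentSpace I x))
    (x₀ : X) : Measure X :=
  ((volume.restrict (extChartAt I x₀).target).withDensity
    (fun z ↦ ENNReal.ofReal (Real.sqrt (chartGram g x₀ z).det))).map (extChartAt I x₀).symm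

/-- The Riemannian volume measure of `g`. The measures `chartVolume g x₀` agree on the overlaps of
the chart domains, and their supremum (in the lattice of measures) is the measure on `X` that
restricts to `chartVolume g x₀` on every chart domain. -/
def riemannianVolume [MeasurableSpace X]
    (g : Bundle.RiemannianMetric (fun x : X ↦ TangentSpace I x)) : Measure X :=
  ⨆ x₀ : X, chartVolume g x₀

end Volume

section ProductMetric

variable {E F : Type*} [NormedAddCommGroup E] [NormedSpace ℝ E]
  [NormedAddCommGroup F] [NormedSpace ℝ F]
  {H K : Type*} [TopologicalSpace H] [TopologicalSpace K]
  {I : ModelWithCorners ℝ E H} {J : ModelWithCorners ℝ F K}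
  {M N : Type*} [TopologicalSpace M] [ChartedSpace H M] [TopologicalSpace N] [ChartedSpace K N]

/-- The projection of `T_(x,y) (M × N) = T_x M × T_y N` to its first factor. -/
def tangentFst (q : M × N) : TangentSpace (I.prod J) q →L[ℝ] TangentSpace I q.1 :=
  ContinuousLinearMap.fst ℝ E F

/-- The projection of `T_(x,y) (M × N) = T_x M × T_y N` to its second factor. -/
def tangentSnd (q : M × N) : TangentSpace (I.prod J) q →L[ℝ] TangentSpace J q.2 :=
  ContinuousLinearMap.snd ℝ E F

/-- The bilinear form `g ⊕ h` on `T_(x,y) (M × N) = T_x M × T_y N`. -/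
def prodForm (g : Bundle.RiemannianMetric (fun x : M ↦ TangentSpace I x))
    (h : Bundle.RiemannianMetric (fun y : N ↦ TangentSpace J y)) (q : M × N) :
    TangentSpace (I.prod J) q →L[ℝ] TangentSpace (I.prod J) q →L[ℝ] ℝ :=
  let B : E →L[ℝ] E →L[ℝ] ℝ := g.inner q.1
  let C : F →L[ℝ] F →L[ℝ] ℝ := h.inner q.2
  let D : (E × F) →L[ℝ] (E × F) →L[ℝ] ℝ :=
    B.bilinearComp (ContinuousLinearMap.fst ℝ E F) (ContinuousLinearMap.fst ℝ E F) +
      C.bilinearComp (ContinuousLinearMap.snd ℝ E F) (ContinuousLinearMap.snd ℝ E F)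
  D

theorem prodForm_apply (g : Bundle.RiemannianMetric (fun x : M ↦ TangentSpace I x))
    (h : Bundle.RiemannianMetric (fun y : N ↦ TangentSpace J y)) (q : M × N)
    (v w : TangentSpace (I.prod J) q) :
    prodForm g h q v w = g.inner q.1 (tangentFst q v) (tangentFst q w) +
      h.inner q.2 (tangentSnd q v) (tangentSnd q w) := rfl

/-- The product metric `g ⊕ h` on `M × N`. -/
def prodMetric (g : Bundle.RiemannianMetric (fun x : M ↦ TangentSpace I x))
    (h : Bundle.RiemannianMetric (fun y : N ↦ TangentSpace J y)) :
    Bundle.RiemannianMetric (fun q : M × N ↦ TangentSpace (I.prod J) q) where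
  inner q := prodForm g h q
  symm q v w := by
    rw [prodForm_apply, prodForm_apply, g.symm q.1 (tangentFst q v), h.symm q.2 (tangentSnd q v)]
  pos q v hv := by
    have hg : ∀ w : TangentSpace I q.1, 0 ≤ g.inner q.1 w w := fun w ↦ by
      by_cases hw : w = 0
      · simp [hw]
      · exact (g.pos q.1 w hw).le
    have hh : ∀ w : TangentSpace J q.2, 0 ≤ h.inner q.2 w w := fun w ↦ by
      by_cases hw : w = 0
      · simp [hw]
      · exact (h.pos q.2 w hw).le
    by_cases h1 : tangentFst q v = 0
    · have h2 : tangentSnd q v ≠ 0 := fun h2 ↦ hv (Prod.ext h1 h2)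
      exact add_pos_of_nonneg_of_pos (hg _) (h.pos q.2 _ h2)
    · exact add_pos_of_pos_of_nonneg (g.pos q.1 _ h1) (hh _)
  continuousAt q := by
    have h1 : ContinuousAt (fun v ↦ g.inner q.1 (tangentFst (I := I) (J := J) q v)
        (tangentFst q v)) 0 := by
      refine ContinuousAt.comp (f := fun v ↦ tangentFst (I := I) (J := J) q v)
        (g := fun v ↦ g.inner q.1 v v) ?_ (tangentFst q).continuous.continuousAt
      simpa using g.continuousAt q.1
    have h2 : ContinuousAt (fun v ↦ h.inner q.2 (tangentSnd (I := I) (J := J) q v)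
        (tangentSnd q v)) 0 := by
      refine ContinuousAt.comp (f := fun v ↦ tangentSnd (I := I) (J := J) q v)
        (g := fun v ↦ h.inner q.2 v v) ?_ (tangentSnd q).continuous.continuousAt
      simpa using h.continuousAt q.2
    exact h1.add h2
  isVonNBounded q := by
    have hg : ∀ w : TangentSpace I q.1, 0 ≤ g.inner q.1 w w := fun w ↦ by
      by_cases hw : w = 0
      · simp [hw]
      · exact (g.pos q.1 w hw).le
    have hh : ∀ w : TangentSpace J q.2, 0 ≤ h.inner q.2 w w := fun w ↦ by
      by_cases hw : w = 0
      · simp [hw]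
      · exact (h.pos q.2 w hw).le
    have h1 : Bornology.IsBounded {v : E | g.inner q.1 v v < 1} :=
      (NormedSpace.isVonNBounded_iff ℝ).1 (g.isVonNBounded q.1)
    have h2 : Bornology.IsBounded {w : F | h.inner q.2 w w < 1} :=
      (NormedSpace.isVonNBounded_iff ℝ).1 (h.isVonNBounded q.2)
    refine (NormedSpace.isVonNBounded_iff (E := E × F) ℝ).2 ((h1.prod h2).subset ?_)
    intro (v : TangentSpace (I.prod J) q) hv
    have hv' : g.inner q.1 (tangentFst q v) (tangentFst q v) +
      h.inner q.2 (tangentSnd q v) (tangentSnd q v) < 1 := hv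
    exact ⟨lt_of_le_of_lt (le_add_of_nonneg_right (hh _)) hv',
      lt_of_le_of_lt (le_add_of_nonneg_left (hg _)) hv'⟩

end ProductMetric

/-- The `L^p` norm of `f : X → [0, ∞]`, defined by measurable majorants so that it makes sense
(and is subadditive) without measurability; see `upperLpNorm_eq` for measurable functions. -/
def upperLpNorm {X : Type*} [MeasurableSpace X] (f : X → ℝ≥0∞) (p : ℝ≥0∞) (μ : Measure X) :
    ℝ≥0∞ :=
  ⨅ (F : X → ℝ≥0∞) (_ : Measurable F ∧ ∀ᵐ x ∂μ, f x ≤ F x), eLpNorm F p μ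

theorem upperLpNorm_eq {X : Type*} [MeasurableSpace X] {f : X → ℝ≥0∞} {p : ℝ≥0∞} {μ : Measure X}
    (hf : AEMeasurable f μ) : upperLpNorm f p μ = eLpNorm f p μ := by
  refine le_antisymm ?_ (le_iInf₂ fun F hF ↦ ?_)
  · refine iInf₂_le_of_le (hf.mk f) ⟨hf.measurable_mk, hf.ae_eq_mk.le⟩ ?_
    exact (eLpNorm_congr_ae hf.ae_eq_mk).ge
  · exact eLpNorm_mono_enorm_ae (by simpa using hF.2)

section Sobolev

variable {E : Type*} [NormedAddCommGroup E] [NormedSpace ℝ E] [MeasureSpace E]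
  {H : Type*} [TopologicalSpace H] {I : ModelWithCorners ℝ E H}
  {X : Type*} [TopologicalSpace X] [ChartedSpace H X]

/-- The norm of a covector at `x` that is dual to the norm defined by the metric on `T_x X`. -/
def covectorNorm (g : Bundle.RiemannianMetric (fun x : X ↦ TangentSpace I x)) (x : X)
    (η : TangentSpace I x →L[ℝ] ℝ) : ℝ≥0∞ :=
  ⨆ (v : TangentSpace I x) (_ : g.inner x v v ≤ 1), ‖η v‖ₑ

/-- On the open set `U` of the vector space `E` the function `f` has the weak derivative `f'`:
both are locally integrable on `U`, and
`∫_U f ∂_v ψ = - ∫_U (f' v) ψ` for all `v` and all test functions `ψ ∈ C_c^∞(U)`. -/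
structure HasWeakFDerivOn (f : E → ℝ) (f' : E → E →L[ℝ] ℝ) (U : Set E) : Prop where
  locallyIntegrableOn : LocallyIntegrableOn f U
  locallyIntegrableOn_deriv : LocallyIntegrableOn f' U
  integral_eq : ∀ ψ : E → ℝ, ContDiff ℝ ∞ ψ → HasCompactSupport ψ → tsupport ψ ⊆ U → ∀ v : E,
    ∫ z in U, f z * fderiv ℝ ψ z v = - ∫ z in U, f' z v * ψ z

/-- The 1-form `η` is the weak differential of the function `u` on the interior of `X`: in each
chart, the coordinate representation of `η` is the weak derivative of that of `u`. -/
def HasWeakDifferential (u : X → ℝ) (η : ∀ x : X, TangentSpace I x →L[ℝ] ℝ) : Prop :=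
  ∀ x₀ : X, HasWeakFDerivOn (u ∘ (extChartAt I x₀).symm) (chartForm I η x₀)
    (interior (extChartAt I x₀).target)

variable [MeasurableSpace X]

/-- `‖du‖_{L^p}` for the weak differential `du` of (a representative of) `u ∈ L^p`, and `∞` if `u`
has no weak differential. The weak differential is unique almost everywhere. -/
def differentialNorm (g : Bundle.RiemannianMetric (fun x : X ↦ TangentSpace I x))
    (μ : Measure X) (p : ℝ≥0∞) (u : Lp ℝ p μ) : ℝ≥0∞ :=
  ⨅ (w : X → ℝ) (η : ∀ x : X, TangentSpace I x →L[ℝ] ℝ)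
    (_ : w =ᵐ[μ] u ∧ HasWeakDifferential w η),
    upperLpNorm (fun x ↦ covectorNorm g x (η x)) p μ

end Sobolev

section Lemmas

theorem upperLpNorm_add_le {X : Type*} [MeasurableSpace X] {f f₁ f₂ : X → ℝ≥0∞} {p : ℝ≥0∞}
    {μ : Measure X} (hp : 1 ≤ p) (h : ∀ x, f x ≤ f₁ x + f₂ x) :
    upperLpNorm f p μ ≤ upperLpNorm f₁ p μ + upperLpNorm f₂ p μ := by
  unfold upperLpNorm
  simp only [ENNReal.iInf_add, ENNReal.add_iInf]
  refine le_iInf₂ fun F₁ h₁ ↦ le_iInf₂ fun F₂ h₂ ↦ ?_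
  refine iInf₂_le_of_le (F₂ + F₁) ⟨h₂.1.add h₁.1, ?_⟩ ?_
  · filter_upwards [h₁.2, h₂.2] with x hx₁ hx₂
    exact (h x).trans (add_le_add ‹_› ‹_›)
  · exact eLpNorm_add_le h₂.1.aestronglyMeasurable h₁.1.aestronglyMeasurable hp

theorem upperLpNorm_mul_le {X : Type*} [MeasurableSpace X] {f f₁ : X → ℝ≥0∞} {p : ℝ≥0∞}
    {μ : Measure X} {c : ℝ} (hc : c ≠ 0) (h : ∀ x, f x ≤ ‖c‖ₑ * f₁ x) :
    upperLpNorm f p μ ≤ ‖c‖ₑ * upperLpNorm f₁ p μ := by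
  have hc' : ‖c‖ₑ ≠ 0 := by simpa using hc
  unfold upperLpNorm
  simp only [ENNReal.mul_iInf_of_ne hc' enorm_ne_top]
  refine le_iInf₂ fun F hF ↦ ?_
  refine iInf₂_le_of_le (fun x ↦ ‖c‖ₑ * F x) ⟨hF.1.const_mul _, ?_⟩ ?_
  · filter_upwards [hF.2] with x hx
    exact (h x).trans (by gcongr)
  · exact eLpNorm_le_nnreal_smul_eLpNorm_of_ae_le_mul' (c := ‖c‖₊)
      (Eventually.of_forall fun x ↦ le_rfl) p

theorem HasWeakFDerivOn.add {E : Type*} [NormedAddCommGroup E] [NormedSpace ℝ E] [MeasureSpace E]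
    [OpensMeasurableSpace E]
    {f₁ f₂ : E → ℝ} {d₁ d₂ : E → E →L[ℝ] ℝ} {U : Set E} (h₁ : HasWeakFDerivOn f₁ d₁ U)
    (h₂ : HasWeakFDerivOn f₂ d₂ U) :
    HasWeakFDerivOn (f₁ + f₂) (d₁ + d₂) U := by
  have hadd : LocallyIntegrableOn (d₁ + d₂) U := by simpa using h₁.2.sub h₂.2.neg
  refine ⟨h₁.1.add h₂.1, hadd, fun ψ hψ hc hs v ↦ ?_⟩
  have key : ∀ {k : E → ℝ}, LocallyIntegrableOn k U → ∀ {χ : E → ℝ}, Continuous χ →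
      (∀ z ∉ tsupport ψ, χ z = 0) → IntegrableOn (fun z ↦ k z * χ z) U := by
    intro k hk χ hχ h0
    have h1 : IntegrableOn (fun z ↦ k z * χ z) (tsupport ψ) :=
      (hk.integrableOn_compact_subset hs hc).mul_continuousOn hχ.continuousOn hc
    have h2 : Integrable (fun z ↦ k z * χ z) := by
      refine (integrableOn_iff_integrable_of_support_subset ?_).1 h1
      intro z hz
      by_contra hz'
      exact hz (by simp [h0 z hz'])
    exact h2.integrableOn
  have hd : Continuous fun z ↦ fderiv ℝ ψ z v :=
    (hψ.continuous_fderiv (by simp)).clm_apply continuous_const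
  have hd0 : ∀ z ∉ tsupport ψ, fderiv ℝ ψ z v = 0 := fun z hz ↦ by
    have : fderiv ℝ ψ z = 0 := by
      by_contra hne
      exact hz (support_fderiv_subset ℝ hne)
    simp [this]
  have hψ0 : ∀ z ∉ tsupport ψ, ψ z = 0 := fun z hz ↦ image_eq_zero_of_notMem_tsupport hz
  have hev : ∀ {d : E → E →L[ℝ] ℝ}, LocallyIntegrableOn d U →
      LocallyIntegrableOn (fun z ↦ d z v) U := fun hd ↦
    (ContinuousLinearMap.apply ℝ ℝ v).locallyIntegrableOn_comp hd
  simp only [Pi.add_apply, add_mul, add_apply]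
  rw [integral_add (key h₁.1 hd hd0) (key h₂.1 hd hd0),
    integral_add (key (hev h₁.2) hψ.continuous hψ0) (key (hev h₂.2) hψ.continuous hψ0),
    h₁.3 ψ hψ hc hs v, h₂.3 ψ hψ hc hs v]
  ring

theorem HasWeakFDerivOn.const_smul {E : Type*} [NormedAddCommGroup E] [NormedSpace ℝ E]
    [MeasureSpace E] {f : E → ℝ} {d : E → E →L[ℝ] ℝ} {U : Set E} (h : HasWeakFDerivOn f d U)
    (c : ℝ) : HasWeakFDerivOn (c • f) (c • d) U := by
  refine ⟨h.1.smul c, h.2.smul c, fun ψ hψ hc hs v ↦ ?_⟩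
  simp only [Pi.smul_apply, smul_apply, smul_eq_mul, mul_assoc,
    integral_const_mul, h.3 ψ hψ hc hs v, mul_neg]

variable {E : Type*} [NormedAddCommGroup E] [NormedSpace ℝ E]
  {H : Type*} [TopologicalSpace H] {I : ModelWithCorners ℝ E H}
  {X : Type*} [TopologicalSpace X] [ChartedSpace H X]
  {g : Bundle.RiemannianMetric (fun x : X ↦ TangentSpace I x)}

theorem covectorNorm_add_le (x : X) (α β : TangentSpace I x →L[ℝ] ℝ) :
    covectorNorm g x (α + β) ≤ covectorNorm g x α + covectorNorm g x β :=
  iSup₂_le fun v hv ↦ (enorm_add_le (α v) (β v)).trans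
    (add_le_add (le_iSup₂_of_le v hv le_rfl) (le_iSup₂_of_le v hv le_rfl))

theorem covectorNorm_smul_le (x : X) (c : ℝ) (α : TangentSpace I x →L[ℝ] ℝ) :
    covectorNorm g x (c • α) ≤ ‖c‖ₑ * covectorNorm g x α :=
  iSup₂_le fun v hv ↦ (enorm_smul c (α v)).le.trans
    (by gcongr; exact le_iSup₂_of_le v hv le_rfl)

variable [MeasureSpace E] [MeasurableSpace X] {μ : Measure X} {p : ℝ≥0∞}

theorem differentialNorm_zero : differentialNorm g μ p 0 = 0 := by
  refine le_antisymm ?_ bot_le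
  refine iInf_le_of_le 0 (iInf_le_of_le 0 (iInf_le_of_le ⟨(Lp.coeFn_zero ..).symm, ?_⟩ ?_))
  · intro x₀
    have h0 : chartForm I (0 : ∀ x : X, TangentSpace I x →L[ℝ] ℝ) x₀ = 0 := by
      funext z
      exact ContinuousLinearMap.zero_comp _
    rw [h0]
    have hz : LocallyIntegrableOn (fun _ : E ↦ (0 : ℝ)) (interior (extChartAt I x₀).target) :=
      locallyIntegrable_zero.locallyIntegrableOn _
    have hz' : LocallyIntegrableOn (fun _ : E ↦ (0 : E →L[ℝ] ℝ))
        (interior (extChartAt I x₀).target) :=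
      fun _ _ ↦ ⟨univ, univ_mem, (integrable_zero E (E →L[ℝ] ℝ) _).integrableOn⟩
    exact ⟨hz, hz', fun ψ _ _ _ v ↦ by simp⟩
  · refine iInf₂_le_of_le 0 ⟨measurable_zero, Eventually.of_forall fun x ↦ ?_⟩ (by simp)
    exact iSup₂_le fun v _ ↦ by simp

theorem differentialNorm_smul_le (c : ℝ) (u : Lp ℝ p μ) :
    differentialNorm g μ p (c • u) ≤ ‖c‖ₑ * differentialNorm g μ p u := by
  rcases eq_or_ne c 0 with rfl | hc
  · simp [differentialNorm_zero]
  have hc' : ‖c‖ₑ ≠ 0 := by simpa using hc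
  conv_rhs => unfold differentialNorm
  simp only [ENNReal.mul_iInf_of_ne hc' enorm_ne_top]
  refine le_iInf fun w ↦ le_iInf fun α ↦ le_iInf fun hw ↦ ?_
  refine iInf_le_of_le (c • w) (iInf_le_of_le (c • α) (iInf_le_of_le ⟨?_, ?_⟩ ?_))
  · filter_upwards [hw.1, Lp.coeFn_smul c u] with x h1 h2
    simp [h1, h2]
  · exact fun x₀ ↦ (hw.2 x₀).const_smul c
  · exact upperLpNorm_mul_le hc fun x ↦ covectorNorm_smul_le x c (α x)

theorem differentialNorm_add_le [OpensMeasurableSpace E] (hp : 1 ≤ p) (u v : Lp ℝ p μ) :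
    differentialNorm g μ p (u + v) ≤ differentialNorm g μ p u + differentialNorm g μ p v := by
  conv_rhs => unfold differentialNorm
  simp only [ENNReal.iInf_add, ENNReal.add_iInf]
  refine le_iInf fun w₁ ↦ le_iInf fun α₁ ↦ le_iInf fun h₁ ↦ le_iInf fun w₂ ↦ le_iInf fun α₂ ↦
    le_iInf fun h₂ ↦ ?_
  refine iInf_le_of_le (w₂ + w₁) (iInf_le_of_le (α₂ + α₁) (iInf_le_of_le ⟨?_, ?_⟩ ?_))
  · filter_upwards [h₁.1, h₂.1, Lp.coeFn_add u v] with x h1 h2 h3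
    rw [h3, Pi.add_apply, Pi.add_apply, h1, h2]
  · intro x₀
    have h0 : chartForm I (α₂ + α₁) x₀ = chartForm I α₂ x₀ + chartForm I α₁ x₀ := by
      funext z
      exact ContinuousLinearMap.add_comp _ _ _
    rw [h0]
    exact (h₂.2 x₀).add (h₁.2 x₀)
  · exact upperLpNorm_add_le hp fun x ↦ covectorNorm_add_le x (α₂ x) (α₁ x)

end Lemmas

section SobolevSpace

variable {E : Type*} [NormedAddCommGroup E] [NormedSpace ℝ E] [MeasureSpace E]
  [OpensMeasurableSpace E]
  {H : Type*} [TopologicalSpace H] {I : ModelWithCorners ℝ E H}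
  {X : Type*} [TopologicalSpace X] [ChartedSpace H X] [MeasurableSpace X]
  (g : Bundle.RiemannianMetric (fun x : X ↦ TangentSpace I x)) (μ : Measure X) (p : ℝ≥0∞)
  [Fact (1 ≤ p)]

/-- The functions in `L^p` whose weak differential exists and is in `L^p`. -/
def sobolevSubmodule : Submodule ℝ (Lp ℝ p μ) where
  carrier := {u | differentialNorm g μ p u < ⊤}
  zero_mem' := by simp [differentialNorm_zero]
  add_mem' {u v} hu hv :=
    (differentialNorm_add_le Fact.out u v).trans_lt (ENNReal.add_lt_top.2 ⟨hu, hv⟩)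
  smul_mem' c u hu :=
    (differentialNorm_smul_le c u).trans_lt (ENNReal.mul_lt_top enorm_lt_top hu)

/-- The Sobolev space `W^{1,p}(X)` of a Riemannian manifold `X` with metric `g` and volume measure
`μ`. It is normed by `‖u‖_{L^p} + ‖du‖_{L^p}`. -/
def SobolevSpace : Type _ := sobolevSubmodule g μ p

instance : AddCommGroup (SobolevSpace g μ p) :=
  inferInstanceAs (AddCommGroup (sobolevSubmodule g μ p))

instance : Module ℝ (SobolevSpace g μ p) := inferInstanceAs (Module ℝ (sobolevSubmodule g μ p))

variable {g μ p}

/-- The function in `L^p` underlying an element of `W^{1,p}`. -/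
def SobolevSpace.toLp (u : SobolevSpace g μ p) : Lp ℝ p μ := Subtype.val u

instance : Norm (SobolevSpace g μ p) where
  norm u := ‖u.toLp‖ + (differentialNorm g μ p u.toLp).toReal

theorem SobolevSpace.norm_def (u : SobolevSpace g μ p) :
    ‖u‖ = ‖u.toLp‖ + (differentialNorm g μ p u.toLp).toReal := rfl

theorem SobolevSpace.normedSpaceCore : NormedSpace.Core ℝ (SobolevSpace g μ p) where
  norm_nonneg u := add_nonneg (norm_nonneg _) ENNReal.toReal_nonneg
  norm_smul c u := by
    have key : ∀ (c : ℝ) (u : SobolevSpace g μ p), ‖c • u‖ ≤ ‖c‖ * ‖u‖ := fun c u ↦ by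
      rw [norm_def, norm_def, mul_add]
      have h1 : (c • u).toLp = c • u.toLp := rfl
      have hu : differentialNorm g μ p u.toLp < ⊤ := u.2
      rw [h1, norm_smul]
      refine add_le_add_right ?_ _
      have h2 := ENNReal.toReal_mono (ENNReal.mul_lt_top enorm_lt_top hu).ne
        (differentialNorm_smul_le (g := g) c u.toLp)
      simpa [ENNReal.toReal_mul] using h2
    refine le_antisymm (key c u) ?_
    rcases eq_or_ne c 0 with rfl | hc
    · have h0 : 0 ≤ ‖(0 : SobolevSpace g μ p)‖ :=
        add_nonneg (norm_nonneg _) ENNReal.toReal_nonneg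
      simpa using h0
    · have h := key c⁻¹ (c • u)
      rw [smul_smul, inv_mul_cancel₀ hc, one_smul, norm_inv] at h
      rwa [← le_inv_mul_iff₀ (norm_pos_iff.2 hc)]
  norm_triangle u v := by
    rw [norm_def, norm_def, norm_def]
    have h1 : (u + v).toLp = u.toLp + v.toLp := rfl
    have hu : differentialNorm g μ p u.toLp < ⊤ := u.2
    have hv : differentialNorm g μ p v.toLp < ⊤ := v.2
    have h2 := ENNReal.toReal_mono (ENNReal.add_lt_top.2 ⟨hu, hv⟩).ne
        (differentialNorm_add_le (g := g) Fact.out u.toLp v.toLp)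
    rw [ENNReal.toReal_add hu.ne hv.ne] at h2
    rw [h1]
    linarith [norm_add_le u.toLp v.toLp]
  norm_eq_zero_iff u := by
    constructor
    · intro h
      rw [norm_def] at h
      have h1 : ‖u.toLp‖ = 0 := le_antisymm
        (by linarith [ENNReal.toReal_nonneg (a := differentialNorm g μ p u.toLp)]) (norm_nonneg _)
      exact Subtype.ext (norm_eq_zero.1 h1)
    · rintro rfl
      have h1 : (0 : SobolevSpace g μ p).toLp = 0 := rfl
      simp [norm_def, h1, differentialNorm_zero]

instance : NormedAddCommGroup (SobolevSpace g μ p) :=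
  NormedAddCommGroup.ofCore SobolevSpace.normedSpaceCore

instance : NormedSpace ℝ (SobolevSpace g μ p) := NormedSpace.ofCore SobolevSpace.normedSpaceCore

end SobolevSpace

end

/-!
# Slices of Sobolev functions on a product of compact Riemannian manifolds

Compactness of `u ↦ (x ↦ u (x, ·))` follows from an inequality of Ehrling type
(`exists_forall_ae_eLpNorm_slice_le`): for every `ε > 0` there are finitely many bounded linear
functionals `Λ = (Λ_1, …, Λ_r)` on `W^{1,p}(M × N)` such that, for almost every `x`,
`‖u (x, ·)‖_{L^p(N)} ≤ ε ‖u‖_{W^{1,p}} + |Λ u|`. With `ε = 1` it says that the slices are bounded,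
and with arbitrary `ε` that the image of the unit ball is totally bounded
(`isCompactOperator_of_forall_norm_le`). The slices form a strongly measurable function because
`L^p(N)` is separable (`exists_Lp_top_of_slice`), and they determine `u` by Fubini's theorem.

For the inequality, `M` and `N` are covered, up to null sets, by images of small parallelepipeds `A`
and `B` of size `1 / k` in the coordinates of finitely many charts (`exists_chartCells`). At the
boundary the parallelepipeds are chosen with a face on the boundary, so that all of them, and the
products `A × B`, are convex and the corners of `M × N` play no role. The functionals are the
integrals of `u` over the products `A × B`. The deviation of a slice from these mean values is
estimated by a one-sided Morrey argument (`HasWeakFDerivOn.ae_lintegral_slice_sub_le`):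
`u (x, y) - u z`, for `y` in `B` and `z` in `A × B`, is the integral of `du` along the segment from
`(x, y)` to `z`.

* In the direction of `A` all segments start at the fixed point `x`. Contracting `A` to `x` by the
  factor `t` costs `t ^ (-m)`. If the segments are parametrized by `t = τ ^ b` with a large number
  `b`, this factor is absorbed by the `p`-th power of the weight `b * τ ^ (b - 1)`, because `m < p`.
* In the direction of `B` one integrates over both endpoints, and one of them is contracted by a
  factor in `[1/2, 1]` only (`Convex.lintegral_lintegral_segment_le`).

The result is the bound `C k ^ (-p) k ^ m ∫_{A × B} |du| ^ p` for the `p`-th power of the deviation,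
integrated over `B`. Summing over all `B`, and using `m < p` once more, one gets a small multiple of
`‖du‖_{L^p} ^ p` if `k` is large (`exists_ae_lintegral_slice_le`).
-/

/-! ### Weak derivatives and the fundamental theorem of calculus on segments -/

section WeakDerivative

variable {E : Type*} [NormedAddCommGroup E] [NormedSpace ℝ E] [MeasureSpace E]

theorem HasWeakFDerivOn.mono {f : E → ℝ} {f' : E → E →L[ℝ] ℝ} {U V : Set E}
    [OpensMeasurableSpace E] (h : HasWeakFDerivOn f f' U) (hVU : V ⊆ U)
    (hU : MeasurableSet U) : HasWeakFDerivOn f f' V := by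
  refine ⟨h.1.mono_set hVU, h.2.mono_set hVU, fun ψ hψ hc hs v ↦ ?_⟩
  have h0 : ∀ z ∉ V, ψ z = 0 := fun z hz ↦ image_eq_zero_of_notMem_tsupport fun h ↦ hz (hs h)
  have h1 : ∀ z ∉ V, fderiv ℝ ψ z v = 0 := fun z hz ↦ by
    have : fderiv ℝ ψ z = 0 := by
      by_contra hne
      exact hz (hs (support_fderiv_subset ℝ hne))
    simp [this]
  rw [setIntegral_eq_of_subset_of_forall_sdiff_eq_zero (s := V) hU hVU
      (fun z hz ↦ by simp [h1 z hz.2]) |>.symm,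
    setIntegral_eq_of_subset_of_forall_sdiff_eq_zero (s := V) hU hVU
      (fun z hz ↦ by simp [h0 z hz.2]) |>.symm]
  exact h.3 ψ hψ hc (hs.trans hVU) v

theorem HasWeakFDerivOn.congr_ae {f g : E → ℝ} {f' g' : E → E →L[ℝ] ℝ} {U : Set E}
    (h : HasWeakFDerivOn f f' U) (hf : f =ᵐ[volume.restrict U] g)
    (hf' : f' =ᵐ[volume.restrict U] g') (hg : LocallyIntegrableOn g U)
    (hg' : LocallyIntegrableOn g' U) : HasWeakFDerivOn g g' U := by
  refine ⟨hg, hg', fun ψ hψ hc hs v ↦ ?_⟩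
  have h1 : ∫ z in U, g z * fderiv ℝ ψ z v = ∫ z in U, f z * fderiv ℝ ψ z v :=
    integral_congr_ae (by filter_upwards [hf] with z hz; rw [hz])
  have h2 : ∫ z in U, g' z v * ψ z = ∫ z in U, f' z v * ψ z :=
    integral_congr_ae (by filter_upwards [hf'] with z hz; rw [hz])
  rw [h1, h2, h.3 ψ hψ hc hs v]

variable [BorelSpace E] [FiniteDimensional ℝ E] [(volume : Measure E).IsAddHaarMeasure]

/-- The fundamental theorem of calculus along the segments `τ ↦ z + τ ^ k • v`, for functions that
are only weakly differentiable. The parametrization by `τ ^ k` instead of `τ` is what later makes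
the weights bounded when the segments are contracted to their starting point. -/
theorem HasWeakFDerivOn.ae_sub_eq_integral {f : E → ℝ} {f' : E → E →L[ℝ] ℝ} {U : Set E}
    (h : HasWeakFDerivOn f f' U) (hU : IsOpen U) (hUc : Convex ℝ U) (hf : IntegrableOn f U)
    (hf' : IntegrableOn f' U) (hfm : StronglyMeasurable f') {k : ℕ} (hk : k ≠ 0) (v : E) :
    ∀ᵐ z : E, z ∈ U → z + v ∈ U →
      f (z + v) - f z = ∫ τ in Ioc (0 : ℝ) 1, (k * τ ^ (k - 1)) * f' (z + τ ^ k • v) v := by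
  set F : E → ℝ := U.indicator f with hF
  set F' : E → ℝ := U.indicator (fun z ↦ f' z v) with hF'
  set μI : Measure ℝ := volume.restrict (Ioc (0 : ℝ) 1)
  set D : E → ℝ := fun z ↦ ∫ τ, (k * τ ^ (k - 1)) * F' (z + τ ^ k • v) ∂μI with hD
  have hFi : Integrable F := (integrable_indicator_iff hU.measurableSet).2 hf
  have hF'i : Integrable F' := (integrable_indicator_iff hU.measurableSet).2
    ((ContinuousLinearMap.apply ℝ ℝ v).integrable_comp hf')
  have hF'm : StronglyMeasurable F' :=
    ((ContinuousLinearMap.apply ℝ ℝ v).continuous.comp_stronglyMeasurable hfm).indicator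
      hU.measurableSet
  have hkb : ∀ τ ∈ Ioc (0 : ℝ) 1, ‖(k : ℝ) * τ ^ (k - 1)‖ ≤ k := fun τ hτ ↦ by
    rw [Real.norm_of_nonneg (by have := hτ.1; positivity)]
    exact mul_le_of_le_one_right (by positivity) (pow_le_one₀ hτ.1.le hτ.2)
  have hshift : Integrable (fun q : ℝ × E ↦ F' (q.2 + q.1 ^ k • v)) (μI.prod volume) := by
    have hm : StronglyMeasurable fun q : ℝ × E ↦ F' (q.2 + q.1 ^ k • v) :=
      hF'm.comp_measurable (by fun_prop)
    refine (integrable_prod_iff hm.aestronglyMeasurable).2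
      ⟨Eventually.of_forall fun τ ↦ hF'i.comp_add_right (τ ^ k • v), ?_⟩
    have : (fun τ : ℝ ↦ ∫ z, ‖F' (z + τ ^ k • v)‖) = fun _ ↦ ∫ z, ‖F' z‖ := by
      funext τ
      exact integral_add_right_eq_self (fun z ↦ ‖F' z‖) _
    rw [this]
    exact integrable_const _
  have hkprod : ∀ᵐ q : ℝ × E ∂(μI.prod volume), ‖(k : ℝ) * q.1 ^ (k - 1)‖ ≤ k := by
    have : ∀ᵐ τ ∂μI, ‖(k : ℝ) * τ ^ (k - 1)‖ ≤ k := by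
      filter_upwards [ae_restrict_mem measurableSet_Ioc] with τ hτ using hkb τ hτ
    exact Measure.quasiMeasurePreserving_fst.ae this
  have hDprod : Integrable (fun q : ℝ × E ↦ ((k : ℝ) * q.1 ^ (k - 1)) * F' (q.2 + q.1 ^ k • v))
      (μI.prod volume) :=
    hshift.bdd_mul (Continuous.aestronglyMeasurable (by fun_prop)) hkprod
  have hDi : Integrable D := hDprod.integral_prod_right
  have hW : IsOpen (U ∩ (fun z ↦ z + v) ⁻¹' U) := hU.inter (hU.preimage (by fun_prop))
  have key : ∀ᵐ z : E, z ∈ U ∩ (fun z ↦ z + v) ⁻¹' U → F (z + v) - F z - D z = 0 := by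
    have hint : Integrable fun z ↦ F (z + v) - F z - D z :=
      ((hFi.comp_add_right v).sub hFi).sub hDi
    refine hW.ae_eq_zero_of_integral_contDiff_smul_eq_zero
      (hint.locallyIntegrable.locallyIntegrableOn _) ?_
    intro ψ hψ hψc hψs
    obtain ⟨C, hC⟩ := hψc.exists_bound_of_continuous hψ.continuous
    have hdψ : Continuous fun z ↦ fderiv ℝ ψ z v :=
      (hψ.continuous_fderiv (by simp)).clm_apply continuous_const
    have hdψc : HasCompactSupport fun z ↦ fderiv ℝ ψ z v := by
      refine (hψc.fderiv (𝕜 := ℝ)).mono fun z hz ↦ ?_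
      contrapose! hz
      simp [Function.notMem_support.1 hz]
    obtain ⟨C', hC'⟩ := hdψc.exists_bound_of_continuous hdψ
    -- the test functions translated along the segment stay supported in `U`, by convexity
    have hweak : ∀ τ ∈ Ioc (0 : ℝ) 1, ∫ w, F w * fderiv ℝ ψ (w - τ ^ k • v) v =
        - ∫ z, F' (z + τ ^ k • v) * ψ z := by
      intro τ hτ
      have ht : τ ^ k ∈ Icc (0 : ℝ) 1 := ⟨by have := hτ.1; positivity, pow_le_one₀ hτ.1.le hτ.2⟩
      have hs : tsupport (fun w ↦ ψ (w - τ ^ k • v)) ⊆ U := by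
        have h1 : tsupport (fun w ↦ ψ (w - τ ^ k • v)) ⊆
            (fun w ↦ w - τ ^ k • v) ⁻¹' tsupport ψ :=
          tsupport_comp_subset_preimage ψ (f := fun w ↦ w - τ ^ k • v) (by fun_prop)
        refine h1.trans fun w hw ↦ ?_
        obtain ⟨h2, h3⟩ := hψs hw
        have := hUc.add_smul_sub_mem h2 h3 ht
        simpa using this
      have hcs : HasCompactSupport fun w ↦ ψ (w - τ ^ k • v) :=
        hψc.comp_homeomorph (Homeomorph.subRight (τ ^ k • v))
      have h2 := h.3 (fun w ↦ ψ (w - τ ^ k • v)) (hψ.comp (contDiff_id.sub contDiff_const))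
        hcs hs v
      simp only [fderiv_comp_sub] at h2
      rw [← integral_indicator hU.measurableSet, ← integral_indicator hU.measurableSet,
        ← integral_add_right_eq_self (U.indicator fun z ↦ f' z v * ψ (z - τ ^ k • v))
          (τ ^ k • v)] at h2
      convert h2 using 3
      · rw [indicator_mul_left]
      · funext z
        rw [indicator_mul_left, add_sub_cancel_right]
    have hFTC : ∀ w, ψ (w - v) - ψ w =
        - ∫ τ, (k * τ ^ (k - 1)) * fderiv ℝ ψ (w - τ ^ k • v) v ∂μI := by
      intro w
      have h1 : ∀ τ : ℝ, HasDerivAt (fun τ : ℝ ↦ ψ (w - τ ^ k • v))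
          (- ((k * τ ^ (k - 1)) * fderiv ℝ ψ (w - τ ^ k • v) v)) τ := by
        intro τ
        have h2 : HasDerivAt (fun τ : ℝ ↦ w - τ ^ k • v) (-((k * τ ^ (k - 1)) • v)) τ :=
          ((hasDerivAt_pow k τ).smul_const v).const_sub w
        have h3 := ((hψ.differentiable (by simp)) (w - τ ^ k • v)).hasFDerivAt.comp_hasDerivAt τ h2
        convert! h3 using 1
        simp
      have h4 := intervalIntegral.integral_eq_sub_of_hasDerivAt (a := 0) (b := 1)
        (fun τ _ ↦ h1 τ) (Continuous.intervalIntegrable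
          (((by fun_prop : Continuous fun τ : ℝ ↦ (k : ℝ) * τ ^ (k - 1)).mul
            (hdψ.comp (by fun_prop : Continuous fun τ : ℝ ↦ w - τ ^ k • v))).neg) _ _)
      rw [intervalIntegral.integral_neg, intervalIntegral.integral_of_le zero_le_one] at h4
      simpa [hk] using h4.symm
    have hF1 : Integrable fun z ↦ ψ z * F (z + v) :=
      (hFi.comp_add_right v).bdd_mul hψ.continuous.aestronglyMeasurable (Eventually.of_forall hC)
    have hF0 : Integrable fun z ↦ ψ z * F z :=
      hFi.bdd_mul hψ.continuous.aestronglyMeasurable (Eventually.of_forall hC)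
    have hFs : Integrable fun z ↦ ψ (z - v) * F z := by
      simpa using hF1.comp_sub_right v
    have hD0 : Integrable fun z ↦ ψ z * D z :=
      hDi.bdd_mul hψ.continuous.aestronglyMeasurable (Eventually.of_forall hC)
    have hswap₁ : ∫ w, F w * ∫ τ, (k * τ ^ (k - 1)) * fderiv ℝ ψ (w - τ ^ k • v) v ∂μI =
        ∫ τ, (k * τ ^ (k - 1)) * (∫ w, F w * fderiv ℝ ψ (w - τ ^ k • v) v) ∂μI := by
      simp only [← integral_const_mul]
      rw [integral_integral_swap]
      · refine integral_congr_ae (Eventually.of_forall fun τ ↦ integral_congr_ae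
          (Eventually.of_forall fun w ↦ ?_))
        simp only
        ring
      · have h1 : Integrable (fun q : E × ℝ ↦ F q.1) (volume.prod μI) := hFi.comp_fst μI
        have h2 : Integrable (fun q : E × ℝ ↦ fderiv ℝ ψ (q.1 - q.2 ^ k • v) v * F q.1)
            (volume.prod μI) := h1.bdd_mul (c := C')
          (hdψ.comp (by fun_prop :
            Continuous fun q : E × ℝ ↦ q.1 - q.2 ^ k • v)).aestronglyMeasurable
          (Eventually.of_forall fun q ↦ hC' _)
        have h3 : ∀ᵐ q : E × ℝ ∂(volume.prod μI), ‖(k : ℝ) * q.2 ^ (k - 1)‖ ≤ k := by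
          have : ∀ᵐ τ ∂μI, ‖(k : ℝ) * τ ^ (k - 1)‖ ≤ k := by
            filter_upwards [ae_restrict_mem measurableSet_Ioc] with τ hτ using hkb τ hτ
          exact Measure.quasiMeasurePreserving_snd.ae this
        refine (h2.bdd_mul (Continuous.aestronglyMeasurable (by fun_prop)) h3).congr
          (Eventually.of_forall fun q ↦ ?_)
        simp only [Function.uncurry]
        ring
    have hswap₂ : ∫ z, ψ z * D z =
        ∫ τ, (k * τ ^ (k - 1)) * (∫ z, F' (z + τ ^ k • v) * ψ z) ∂μI := by
      simp only [hD, ← integral_const_mul]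
      rw [integral_integral_swap]
      · refine integral_congr_ae (Eventually.of_forall fun τ ↦ integral_congr_ae
          (Eventually.of_forall fun w ↦ ?_))
        simp only
        ring
      · refine (hDprod.swap.bdd_mul (c := C) (f := fun q : E × ℝ ↦ ψ q.1)
          (hψ.continuous.comp continuous_fst).aestronglyMeasurable
          (Eventually.of_forall fun q ↦ hC _))
    have hF1F0 : ∫ z, ψ z * (F (z + v) - F z) = ∫ z, ψ z * D z := by
      calc ∫ z, ψ z * (F (z + v) - F z) = ∫ w, F w * (ψ (w - v) - ψ w) := by
            simp only [mul_sub]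
            rw [integral_sub hF1 hF0, integral_sub (by simpa only [mul_comm] using hFs)
                (by simpa only [mul_comm] using hF0),
              ← integral_add_right_eq_self (fun w ↦ F w * ψ (w - v)) v]
            simp [mul_comm]
        _ = - ∫ τ, (k * τ ^ (k - 1)) * (∫ w, F w * fderiv ℝ ψ (w - τ ^ k • v) v) ∂μI := by
            simp only [hFTC, mul_neg, integral_neg, hswap₁]
        _ = ∫ τ, (k * τ ^ (k - 1)) * (∫ z, F' (z + τ ^ k • v) * ψ z) ∂μI := by
            rw [← integral_neg]
            refine setIntegral_congr_fun measurableSet_Ioc fun τ hτ ↦ ?_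
            simp only [hweak τ hτ, mul_neg, neg_neg]
        _ = ∫ z, ψ z * D z := hswap₂.symm
    have hsub : Integrable fun z ↦ ψ z * (F (z + v) - F z) :=
      (hF1.sub hF0).congr (Eventually.of_forall fun z ↦ (mul_sub _ _ _).symm)
    have hsplit : (fun z ↦ ψ z • (F (z + v) - F z - D z)) =
        fun z ↦ ψ z * (F (z + v) - F z) - ψ z * D z := by
      funext z
      rw [smul_eq_mul, mul_sub]
    rw [hsplit, integral_sub hsub hD0, hF1F0, sub_self]
  filter_upwards [key] with z hz h1 h2
  have h3 := hz ⟨h1, h2⟩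
  have h4 : D z = ∫ τ in Ioc (0 : ℝ) 1, (k * τ ^ (k - 1)) * f' (z + τ ^ k • v) v := by
    refine setIntegral_congr_fun measurableSet_Ioc fun τ hτ ↦ ?_
    have ht : τ ^ k ∈ Icc (0 : ℝ) 1 := ⟨by have := hτ.1; positivity, pow_le_one₀ hτ.1.le hτ.2⟩
    have := hUc.add_smul_sub_mem h1 h2 ht
    rw [add_sub_cancel_left] at this
    simp only [hF', indicator_of_mem this]
  rw [← h4]
  simp only [hF, indicator_of_mem h1, indicator_of_mem h2] at h3
  linarith

end WeakDerivative

/-! ### The Morrey estimate on a convex product domain -/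

/-- Jensen's inequality for `x ↦ x ^ q`, in the form of Hölder's inequality. -/
theorem rpow_lintegral_le {X : Type*} [MeasurableSpace X] {μ : Measure X} {q : ℝ} (hq : 1 ≤ q)
    {a : X → ℝ≥0∞} (ha : AEMeasurable a μ) :
    (∫⁻ x, a x ∂μ) ^ q ≤ (∫⁻ x, a x ^ q ∂μ) * μ univ ^ (q - 1) := by
  have hq0 : 0 < q := by linarith
  have h := eLpNorm_le_eLpNorm_mul_rpow_measure_univ (p := 1) (q := ENNReal.ofReal q)
    (by simpa using hq) ha.aestronglyMeasurable
  rw [eLpNorm_one_eq_lintegral_enorm, eLpNorm_eq_lintegral_rpow_enorm_toReal (by simpa using hq0)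
    (by simp)] at h
  simp only [enorm_eq_self, ENNReal.toReal_ofReal hq0.le, ENNReal.toReal_one] at h
  calc (∫⁻ x, a x ∂μ) ^ q ≤ _ := ENNReal.rpow_le_rpow h hq0.le
    _ = _ := by
      rw [ENNReal.mul_rpow_of_nonneg _ _ hq0.le, ← ENNReal.rpow_mul, ← ENNReal.rpow_mul]
      congr 2
      · rw [one_div_mul_cancel hq0.ne', ENNReal.rpow_one]
      · field_simp

section Contraction

variable {E : Type*} [NormedAddCommGroup E] [NormedSpace ℝ E] [MeasureSpace E]
  [BorelSpace E] [FiniteDimensional ℝ E] [(volume : Measure E).IsAddHaarMeasure]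

/-- Contracting a convex set `A` to one of its points by the factor `t` multiplies integrals of
nonnegative functions by at most `t⁻ᵈ`. -/
theorem Convex.pow_mul_lintegral_contract_le {A : Set E} (hA : Convex ℝ A) (hAm : MeasurableSet A)
    {φ : E → ℝ≥0∞} (hφ : Measurable φ) {a : E} (ha : a ∈ A) {t : ℝ} (ht : t ∈ Ioc (0 : ℝ) 1) :
    ENNReal.ofReal t ^ Module.finrank ℝ E * ∫⁻ x in A, φ (a + t • (x - a)) ≤
      ∫⁻ x in A, φ x := by
  set ψ := A.indicator φ with hψ
  have hψm : Measurable ψ := hφ.indicator hAm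
  have h1 : ∫⁻ x in A, φ (a + t • (x - a)) ≤ ∫⁻ x, ψ (t • x + (a - t • a)) := by
    refine (setLIntegral_mono_ae' hAm (Eventually.of_forall fun x hx ↦ ?_)).trans
      (setLIntegral_le_lintegral A _)
    have h2 : t • x + (a - t • a) = a + t • (x - a) := by rw [smul_sub]; abel
    have h3 := hA.add_smul_sub_mem ha hx ⟨ht.1.le, ht.2⟩
    rw [hψ, h2, indicator_of_mem h3]
  have h2 : ∫⁻ x, ψ (t • x + (a - t • a)) =
      ENNReal.ofReal |(t ^ Module.finrank ℝ E)⁻¹| * ∫⁻ x, ψ x := by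
    have h3 : Measurable fun w ↦ ψ (w + (a - t • a)) := hψm.comp (measurable_add_const _)
    have := lintegral_map (μ := (volume : Measure E)) h3 (measurable_const_smul t)
    rw [← this, Measure.map_addHaar_smul _ ht.1.ne', lintegral_smul_measure,
      lintegral_add_right_eq_self ψ, smul_eq_mul]
  calc _ ≤ ENNReal.ofReal t ^ Module.finrank ℝ E *
        (ENNReal.ofReal |(t ^ Module.finrank ℝ E)⁻¹| * ∫⁻ x, ψ x) := by
        gcongr
        exact h1.trans h2.le
    _ = ∫⁻ x, ψ x := by
        have h5 : 0 < t ^ Module.finrank ℝ E := pow_pos ht.1 _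
        rw [← mul_assoc, ← ENNReal.ofReal_pow ht.1.le, ← ENNReal.ofReal_mul h5.le,
          abs_of_pos (inv_pos.2 h5), mul_inv_cancel₀ h5.ne', ENNReal.ofReal_one, one_mul]
    _ = _ := lintegral_indicator hAm _

theorem Convex.lintegral_contract_le_of_half_le {A : Set E} (hA : Convex ℝ A)
    (hAm : MeasurableSet A)
    {φ : E → ℝ≥0∞} (hφ : Measurable φ) {a : E} (ha : a ∈ A) {t : ℝ} (ht : t ∈ Icc (1 / 2 : ℝ) 1) :
    ∫⁻ x in A, φ (a + t • (x - a)) ≤ 2 ^ Module.finrank ℝ E * ∫⁻ x in A, φ x := by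
  have h := hA.pow_mul_lintegral_contract_le hAm hφ ha ⟨by linarith [ht.1], ht.2⟩
  have h2 : 1 ≤ 2 * ENNReal.ofReal t := by
    rw [← ENNReal.ofReal_ofNat, ← ENNReal.ofReal_mul (by norm_num), ← ENNReal.ofReal_one]
    exact ENNReal.ofReal_le_ofReal (by linarith [ht.1])
  calc ∫⁻ x in A, φ (a + t • (x - a))
      ≤ (2 * ENNReal.ofReal t) ^ Module.finrank ℝ E * ∫⁻ x in A, φ (a + t • (x - a)) :=
        le_mul_of_one_le_left zero_le (one_le_pow₀ h2)
    _ ≤ _ := by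
        rw [mul_pow, mul_assoc]
        gcongr

/-- Of the two endpoints of a segment, at least one is moved along by a factor of at least `1 / 2`
when the point at time `t` is considered, so the contraction costs a factor `2ᵈ` at most. -/
theorem Convex.lintegral_lintegral_segment_le {A : Set E} (hA : Convex ℝ A) (hAm : MeasurableSet A)
    {φ : E → ℝ≥0∞} (hφ : Measurable φ) {t : ℝ} (ht : t ∈ Icc (0 : ℝ) 1) :
    ∫⁻ y in A, ∫⁻ y' in A, φ (y + t • (y' - y)) ≤
      2 ^ Module.finrank ℝ E * volume A * ∫⁻ x in A, φ x := by
  have key : ∀ s ∈ Icc (1 / 2 : ℝ) 1, ∫⁻ y in A, ∫⁻ y' in A, φ (y + s • (y' - y)) ≤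
      2 ^ Module.finrank ℝ E * volume A * ∫⁻ x in A, φ x := by
    intro s hs
    calc ∫⁻ y in A, ∫⁻ y' in A, φ (y + s • (y' - y))
        ≤ ∫⁻ y in A, 2 ^ Module.finrank ℝ E * ∫⁻ x in A, φ x :=
          setLIntegral_mono_ae' hAm (Eventually.of_forall fun y hy ↦
            hA.lintegral_contract_le_of_half_le hAm hφ hy hs)
      _ = _ := by rw [setLIntegral_const]; ring
  rcases le_total (1 / 2) t with h | h
  · exact key t ⟨h, ht.2⟩
  · have h1 := key (1 - t) ⟨by linarith, by linarith [ht.1]⟩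
    rw [lintegral_lintegral_swap]
    · convert h1 using 6 with y y'
      rw [sub_smul, one_smul, smul_sub, smul_sub]
      abel
    · exact (hφ.comp (by fun_prop)).aemeasurable

end Contraction

section Segments

variable {E : Type*} [NormedAddCommGroup E] [NormedSpace ℝ E] [MeasureSpace E]
  [BorelSpace E] [FiniteDimensional ℝ E] [(volume : Measure E).IsAddHaarMeasure]

/-- The fundamental theorem of calculus for almost all pairs of points of `U`. It follows from the
version with a fixed increment `v` by Fubini's theorem in the variables `(z, v)`. -/
theorem HasWeakFDerivOn.ae_prod_enorm_sub_le {f : E → ℝ} {f' : E → E →L[ℝ] ℝ} {U : Set E}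
    (h : HasWeakFDerivOn f f' U) (hU : IsOpen U) (hUc : Convex ℝ U) (hf : IntegrableOn f U)
    (hf' : IntegrableOn f' U) (hfm : StronglyMeasurable f) (hfm' : StronglyMeasurable f')
    {k : ℕ} (hk : k ≠ 0) :
    ∀ᵐ q : E × E ∂((volume.restrict U).prod (volume.restrict U)), ‖f q.1 - f q.2‖ₑ ≤
      ∫⁻ τ in Ioc (0 : ℝ) 1, ENNReal.ofReal (k * τ ^ (k - 1)) *
        (‖f' (q.1 + τ ^ k • (q.2 - q.1))‖ₑ * ‖q.2 - q.1‖ₑ) := by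
  set R : E × E → ℝ≥0∞ := fun q ↦ ∫⁻ τ in Ioc (0 : ℝ) 1, ENNReal.ofReal (k * τ ^ (k - 1)) *
        (‖f' (q.1 + τ ^ k • q.2)‖ₑ * ‖q.2‖ₑ) with hR
  have hRm : Measurable R := by
    refine Measurable.lintegral_prod_right' (f := fun r : (E × E) × ℝ ↦
      ENNReal.ofReal (k * r.2 ^ (k - 1)) * (‖f' (r.1.1 + r.2 ^ k • r.1.2)‖ₑ * ‖r.1.2‖ₑ)) ?_
    refine Measurable.mul (f := fun r : (E × E) × ℝ ↦ ENNReal.ofReal (k * r.2 ^ (k - 1)))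
      (by fun_prop) (Measurable.mul ?_ (measurable_snd.comp measurable_fst).enorm)
    exact hfm'.enorm.comp (by fun_prop :
      Measurable fun r : (E × E) × ℝ ↦ r.1.1 + r.2 ^ k • r.1.2)
  have hm : MeasurableSet {q : E × E | q.1 ∈ U → q.1 + q.2 ∈ U →
      ‖f q.1 - f (q.1 + q.2)‖ₑ ≤ R q} := by
    have h1 : Measurable fun q : E × E ↦ ‖f q.1 - f (q.1 + q.2)‖ₑ :=
      ((hfm.measurable.comp measurable_fst).sub
        (hfm.measurable.comp (measurable_fst.add measurable_snd))).enorm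
    have h2 : MeasurableSet {q : E × E | q.1 ∈ U} := measurable_fst hU.measurableSet
    have h3 : MeasurableSet {q : E × E | q.1 + q.2 ∈ U} :=
      (measurable_fst.add measurable_snd) hU.measurableSet
    exact h2.imp (h3.imp (measurableSet_le h1 hRm))
  have h1 : ∀ᵐ q : E × E ∂(volume.prod volume), q ∈ {q : E × E | q.1 ∈ U → q.1 + q.2 ∈ U →
      ‖f q.1 - f (q.1 + q.2)‖ₑ ≤ R q} := by
    rw [← Measure.prod_swap]
    refine (ae_map_iff measurable_swap.aemeasurable hm).2 ?_
    refine (Measure.ae_prod_iff_ae_ae (measurable_swap hm)).2 ?_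
    refine Eventually.of_forall fun v ↦ ?_
    filter_upwards [h.ae_sub_eq_integral hU hUc hf hf' hfm' hk v] with z hz h1 h2
    simp only [Prod.swap] at h1 h2 ⊢
    rw [← enorm_neg, neg_sub, hz h1 h2]
    refine (enorm_integral_le_lintegral_enorm _).trans
      (setLIntegral_mono_ae' measurableSet_Ioc (Eventually.of_forall fun τ hτ ↦ ?_))
    rw [enorm_mul, Real.enorm_of_nonneg (by have := hτ.1; positivity)]
    gcongr
    exact (f' _).le_opENorm v
  rw [Measure.prod_restrict, ae_restrict_iff' (hU.measurableSet.prod hU.measurableSet)]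
  have h2 := (measurePreserving_prod_neg_add (volume : Measure E)
    (volume : Measure E)).quasiMeasurePreserving.ae h1
  filter_upwards [h2] with q hq hqU
  simp only [neg_add_eq_sub, add_sub_cancel, hR] at hq
  exact hq hqU.1 hqU.2

end Segments

section Product

theorem setLIntegral_prod_symm' {E F : Type*} [MeasureSpace E] [MeasureSpace F]
    [SFinite (volume : Measure E)] [SFinite (volume : Measure F)] {A : Set E} {B : Set F}
    {g : E × F → ℝ≥0∞} (hg : Measurable g) :
    ∫⁻ z in A ×ˢ B, g z = ∫⁻ y in B, ∫⁻ x in A, g (x, y) := by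
  rw [Measure.volume_eq_prod, ← Measure.prod_restrict, lintegral_prod_symm' _ hg]

variable {E F : Type*} [NormedAddCommGroup E] [NormedSpace ℝ E] [MeasureSpace E]
  [BorelSpace E] [FiniteDimensional ℝ E] [(volume : Measure E).IsAddHaarMeasure]
  [NormedAddCommGroup F] [NormedSpace ℝ F] [MeasureSpace F]
  [BorelSpace F] [FiniteDimensional ℝ F] [(volume : Measure F).IsAddHaarMeasure]

/-- The integral over all segments that start on the slice `{x} × B` and end in `A × B`. Under the
assumption on `k`, the weight `(k τ ^ (k - 1)) ^ q` absorbs the factor `(τ ^ k) ^ (-dim E)` that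
comes from contracting `A` to the point `x`. -/
theorem lintegral_segments_from_slice_le {A : Set E} {B : Set F} (hA : Convex ℝ A)
    (hAm : MeasurableSet A) (hB : Convex ℝ B) (hBm : MeasurableSet B) {x : E} (hx : x ∈ A)
    {g : E × F → ℝ≥0∞} (hg : Measurable g) {k : ℕ} {q : ℝ} (hq : 0 ≤ q)
    (hkq : (k * Module.finrank ℝ E : ℕ) ≤ ((k - 1 : ℕ) : ℝ) * q) :
    ∫⁻ y in B, ∫⁻ z in A ×ˢ B, ∫⁻ τ in Ioc (0 : ℝ) 1,
        ENNReal.ofReal (k * τ ^ (k - 1)) ^ q * g ((x, y) + τ ^ k • (z - (x, y))) ≤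
      (k : ℝ≥0∞) ^ q * (2 ^ Module.finrank ℝ F * volume B * ∫⁻ z in A ×ˢ B, g z) := by
  set c : ℝ → ℝ≥0∞ := fun τ ↦ ENNReal.ofReal (k * τ ^ (k - 1)) ^ q with hc
  have hcm : Measurable c := by
    have : Measurable fun τ : ℝ ↦ ENNReal.ofReal (k * τ ^ (k - 1)) := by fun_prop
    exact this.pow_const q
  have hgm : Measurable fun r : (F × (E × F)) × ℝ ↦
      g ((x, r.1.1) + r.2 ^ k • (r.1.2 - (x, r.1.1))) := hg.comp (by fun_prop)
  have hm : Measurable fun r : (F × (E × F)) × ℝ ↦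
      c r.2 * g ((x, r.1.1) + r.2 ^ k • (r.1.2 - (x, r.1.1))) :=
    (hcm.comp measurable_snd).mul hgm
  have hcb : ∀ τ ∈ Ioc (0 : ℝ) 1,
      c τ ≤ (k : ℝ≥0∞) ^ q * ENNReal.ofReal (τ ^ k) ^ Module.finrank ℝ E := by
    intro τ hτ
    have h0 := hτ.1
    simp only [hc]
    rw [ENNReal.ofReal_mul (by positivity), ENNReal.ofReal_natCast,
      ENNReal.mul_rpow_of_nonneg _ _ hq, ← ENNReal.ofReal_pow (by positivity),
      ENNReal.ofReal_rpow_of_pos (by positivity)]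
    gcongr
    rw [← pow_mul, ← Real.rpow_natCast, ← Real.rpow_natCast, ← Real.rpow_mul h0.le]
    exact Real.rpow_le_rpow_of_exponent_ge h0 hτ.2 hkq
  set h : F → ℝ≥0∞ := fun η ↦ ∫⁻ x' in A, g (x', η)
  have hhm : Measurable h := hg.lintegral_prod_left'
  have hτ : ∀ τ ∈ Ioc (0 : ℝ) 1, ∫⁻ y in B,
      ∫⁻ z in A ×ˢ B, c τ * g ((x, y) + τ ^ k • (z - (x, y))) ≤
      (k : ℝ≥0∞) ^ q * (2 ^ Module.finrank ℝ F * volume B * ∫⁻ z in A ×ˢ B, g z) := by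
    intro τ hτ
    have ht : τ ^ k ∈ Ioc (0 : ℝ) 1 := ⟨by have := hτ.1; positivity, pow_le_one₀ hτ.1.le hτ.2⟩
    calc ∫⁻ y in B, ∫⁻ z in A ×ˢ B, c τ * g ((x, y) + τ ^ k • (z - (x, y)))
        = ∫⁻ y in B, ∫⁻ y' in B, ∫⁻ x' in A,
            c τ * g (x + τ ^ k • (x' - x), y + τ ^ k • (y' - y)) := by
          refine lintegral_congr fun y ↦ ?_
          rw [setLIntegral_prod_symm']
          · rfl
          · exact (hg.comp (by fun_prop)).const_mul _
      _ ≤ ∫⁻ y in B, ∫⁻ y' in B, (k : ℝ≥0∞) ^ q * h (y + τ ^ k • (y' - y)) := by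
          refine lintegral_mono fun y ↦ lintegral_mono fun y' ↦ ?_
          have h1 : Measurable fun x' ↦ g (x + τ ^ k • (x' - x), y + τ ^ k • (y' - y)) :=
            hg.comp (by fun_prop)
          simp only
          rw [lintegral_const_mul _ h1]
          calc c τ * _ ≤ ((k : ℝ≥0∞) ^ q * ENNReal.ofReal (τ ^ k) ^ Module.finrank ℝ E) * _ := by
                gcongr
                exact hcb τ hτ
            _ ≤ _ := by
                rw [mul_assoc]
                gcongr
                exact hA.pow_mul_lintegral_contract_le hAm
                  (φ := fun x' ↦ g (x', y + τ ^ k • (y' - y)))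
                  (hg.comp (by fun_prop)) hx ht
      _ = (k : ℝ≥0∞) ^ q * ∫⁻ y in B, ∫⁻ y' in B, h (y + τ ^ k • (y' - y)) := by
          rw [← lintegral_const_mul]
          · refine lintegral_congr fun y ↦ ?_
            rw [lintegral_const_mul]
            exact hhm.comp (by fun_prop)
          · refine Measurable.lintegral_prod_right' (f := fun r : F × F ↦
              h (r.1 + τ ^ k • (r.2 - r.1))) ?_
            exact hhm.comp (by fun_prop)
      _ ≤ _ := by
          gcongr
          rw [setLIntegral_prod_symm' hg]
          exact hB.lintegral_lintegral_segment_le hBm hhm ⟨ht.1.le, ht.2⟩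
  calc _ = ∫⁻ y in B, ∫⁻ τ in Ioc (0 : ℝ) 1, ∫⁻ z in A ×ˢ B,
          c τ * g ((x, y) + τ ^ k • (z - (x, y))) := by
        refine lintegral_congr fun y ↦ ?_
        rw [lintegral_lintegral_swap]
        exact (hm.comp (by fun_prop : Measurable fun r : (E × F) × ℝ ↦
          ((y, r.1), r.2))).aemeasurable
    _ = ∫⁻ τ in Ioc (0 : ℝ) 1, ∫⁻ y in B, ∫⁻ z in A ×ˢ B,
          c τ * g ((x, y) + τ ^ k • (z - (x, y))) := by
        rw [lintegral_lintegral_swap]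
        refine Measurable.aemeasurable (Measurable.lintegral_prod_right' (f := fun r :
          (F × ℝ) × (E × F) ↦ c r.1.2 * g ((x, r.1.1) + r.1.2 ^ k • (r.2 - (x, r.1.1)))) ?_)
        exact hm.comp (by fun_prop : Measurable fun r : (F × ℝ) × (E × F) ↦
          ((r.1.1, r.2), r.1.2))
    _ ≤ ∫⁻ τ in Ioc (0 : ℝ) 1,
          (k : ℝ≥0∞) ^ q * (2 ^ Module.finrank ℝ F * volume B * ∫⁻ z in A ×ˢ B, g z) :=
        setLIntegral_mono_ae' measurableSet_Ioc (Eventually.of_forall hτ)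
    _ = _ := by simp

/-- The Morrey estimate for a weakly differentiable function on a convex product domain: on almost
every slice `{x} × B` the function is close, in `L^q(B)`, to its values on `A × B`. -/
theorem HasWeakFDerivOn.ae_lintegral_slice_sub_le {A : Set E} {B : Set F} (hA : Convex ℝ A)
    (hAo : IsOpen A) (hB : Convex ℝ B) (hBo : IsOpen B) {f : E × F → ℝ}
    {f' : E × F → E × F →L[ℝ] ℝ} (h : HasWeakFDerivOn f f' (A ×ˢ B)) (hf : IntegrableOn f (A ×ˢ B))
    (hf' : IntegrableOn f' (A ×ˢ B)) {d : ℝ≥0∞} (hd : d ≠ ⊤)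
    (hdA : ∀ x ∈ A, ∀ x' ∈ A, ‖x' - x‖ₑ ≤ d)
    (hdB : ∀ y ∈ B, ∀ y' ∈ B, ‖y' - y‖ₑ ≤ d) {k : ℕ} (hk : k ≠ 0) {q : ℝ} (hq : 1 ≤ q)
    (hkq : (k * Module.finrank ℝ E : ℕ) ≤ ((k - 1 : ℕ) : ℝ) * q) :
    ∀ᵐ x ∂(volume.restrict A), ∫⁻ y in B, ∫⁻ z in A ×ˢ B, ‖f (x, y) - f z‖ₑ ^ q ≤
      d ^ q * ((k : ℝ≥0∞) ^ q *
        (2 ^ Module.finrank ℝ F * volume B * ∫⁻ z in A ×ˢ B, ‖f' z‖ₑ ^ q)) := by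
  have hq0 : 0 ≤ q := by linarith
  have hU : IsOpen (A ×ˢ B) := hAo.prod hBo
  have : (volume : Measure (E × F)).IsAddHaarMeasure :=
    Measure.prod.instIsAddHaarMeasure volume volume
  set V : Measure (E × F) := volume.restrict (A ×ˢ B)
  have hVp : V = (volume.restrict A).prod (volume.restrict B) := (Measure.prod_restrict A B).symm
  set f₀ := hf.1.mk f
  set f₀' := hf'.1.mk f'
  have e : f =ᵐ[V] f₀ := hf.1.ae_eq_mk
  have e' : f' =ᵐ[V] f₀' := hf'.1.ae_eq_mk
  have i₀ : IntegrableOn f₀ (A ×ˢ B) := Integrable.congr hf e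
  have i₀' : IntegrableOn f₀' (A ×ˢ B) := Integrable.congr hf' e'
  have h₀ : HasWeakFDerivOn f₀ f₀' (A ×ˢ B) :=
    h.congr_ae e e' i₀.locallyIntegrableOn i₀'.locallyIntegrableOn
  have hm₀' : StronglyMeasurable f₀' := hf'.1.stronglyMeasurable_mk
  have key : ∀ᵐ r : (E × F) × (E × F) ∂(V.prod V), ‖f r.1 - f r.2‖ₑ ^ q ≤
      d ^ q * ∫⁻ τ in Ioc (0 : ℝ) 1,
        ENNReal.ofReal (k * τ ^ (k - 1)) ^ q * ‖f₀' (r.1 + τ ^ k • (r.2 - r.1))‖ₑ ^ q := by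
    have hmem : ∀ᵐ z ∂V, z ∈ A ×ˢ B := ae_restrict_mem hU.measurableSet
    filter_upwards [h₀.ae_prod_enorm_sub_le hU (hA.prod hB) i₀ i₀' hf.1.stronglyMeasurable_mk
      hm₀' hk, Measure.quasiMeasurePreserving_fst.ae (e.and hmem),
      Measure.quasiMeasurePreserving_snd.ae (e.and hmem)] with r h1 h2 h3
    rw [h2.1, h3.1]
    have h4 : ‖r.2 - r.1‖ₑ ≤ d := by
      have h5 := hdA _ h2.2.1 _ h3.2.1
      have h6 := hdB _ h2.2.2 _ h3.2.2
      exact max_le h5 h6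
    calc ‖f₀ r.1 - f₀ r.2‖ₑ ^ q
        ≤ (d * ∫⁻ τ in Ioc (0 : ℝ) 1, ENNReal.ofReal (k * τ ^ (k - 1)) *
            ‖f₀' (r.1 + τ ^ k • (r.2 - r.1))‖ₑ) ^ q := by
          gcongr
          rw [← lintegral_const_mul' _ _ hd]
          refine h1.trans (lintegral_mono fun τ ↦ ?_)
          calc _ ≤ ENNReal.ofReal (k * τ ^ (k - 1)) *
                (‖f₀' (r.1 + τ ^ k • (r.2 - r.1))‖ₑ * d) := by gcongr
            _ = _ := by ring
      _ ≤ _ := by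
          rw [ENNReal.mul_rpow_of_nonneg _ _ hq0]
          gcongr
          have hm : Measurable fun τ : ℝ ↦ ENNReal.ofReal (k * τ ^ (k - 1)) *
              ‖f₀' (r.1 + τ ^ k • (r.2 - r.1))‖ₑ := by
            have h7 : Measurable fun τ : ℝ ↦ r.1 + τ ^ k • (r.2 - r.1) := by fun_prop
            exact Measurable.mul (by fun_prop) (hm₀'.enorm.comp h7)
          refine (rpow_lintegral_le hq hm.aemeasurable).trans ?_
          simp [ENNReal.mul_rpow_of_nonneg _ _ hq0]
  have key' : ∀ᵐ x ∂(volume.restrict A), ∀ᵐ y ∂(volume.restrict B), ∀ᵐ z ∂V,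
      ‖f (x, y) - f z‖ₑ ^ q ≤ d ^ q * ∫⁻ τ in Ioc (0 : ℝ) 1,
        ENNReal.ofReal (k * τ ^ (k - 1)) ^ q * ‖f₀' ((x, y) + τ ^ k • (z - (x, y)))‖ₑ ^ q := by
    have := Measure.ae_ae_of_ae_prod key
    rw [hVp] at this
    rw [hVp]
    exact Measure.ae_ae_of_ae_prod this
  have hdq : d ^ q ≠ ⊤ := ENNReal.rpow_ne_top_of_nonneg hq0 hd
  filter_upwards [key', ae_restrict_mem hAo.measurableSet] with x hx hxA
  calc ∫⁻ y in B, ∫⁻ z, ‖f (x, y) - f z‖ₑ ^ q ∂V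
      ≤ ∫⁻ y in B, ∫⁻ z, d ^ q * (∫⁻ τ in Ioc (0 : ℝ) 1,
        ENNReal.ofReal (k * τ ^ (k - 1)) ^ q *
          ‖f₀' ((x, y) + τ ^ k • (z - (x, y)))‖ₑ ^ q) ∂V := by
        refine lintegral_mono_ae ?_
        filter_upwards [hx] with y hy using lintegral_mono_ae hy
    _ = d ^ q * ∫⁻ y in B, ∫⁻ z, (∫⁻ τ in Ioc (0 : ℝ) 1,
        ENNReal.ofReal (k * τ ^ (k - 1)) ^ q *
          ‖f₀' ((x, y) + τ ^ k • (z - (x, y)))‖ₑ ^ q) ∂V := by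
        simp only [lintegral_const_mul' _ _ hdq]
    _ ≤ d ^ q * ((k : ℝ≥0∞) ^ q *
        (2 ^ Module.finrank ℝ F * volume B * ∫⁻ z in A ×ˢ B, ‖f₀' z‖ₑ ^ q)) := by
        gcongr
        exact lintegral_segments_from_slice_le hA hAo.measurableSet hB hBo.measurableSet hxA
          (hm₀'.enorm.pow_const q) hq0 hkq
    _ = _ := by
        congr 3
        refine lintegral_congr_ae ?_
        filter_upwards [e'] with z hz
        rw [hz]

end Product

/-! ### Coordinate frames and the change of charts -/

section ChartFrame

variable {E : Type*} [NormedAddCommGroup E] [NormedSpace ℝ E]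
  {H : Type*} [TopologicalSpace H] {I : ModelWithCorners ℝ E H}
  {X : Type*} [TopologicalSpace X] [ChartedSpace H X] [IsManifold I ∞ X]

theorem chartFrame_injective {x₀ : X} {z : E} (hz : z ∈ (extChartAt I x₀).target) :
    Function.Injective (chartFrame I x₀ z) :=
  (isInvertible_mfderivWithin_extChartAt_symm hz).injective

theorem continuousOn_chartFrame (x₀ : X) :
    ContinuousOn (fun q : E × E ↦ (⟨(extChartAt I x₀).symm q.1, chartFrame I x₀ q.1 q.2⟩ :
      TangentBundle I X)) ((extChartAt I x₀).target ×ˢ univ) := by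
  have h1 : ContinuousOn (tangentMapWithin 𝓘(ℝ, E) I (extChartAt I x₀).symm
      (extChartAt I x₀).target) _ :=
    (contMDiffOn_extChartAt_symm (n := ∞) x₀).continuousOn_tangentMapWithin (by simp)
      (uniqueDiffOn_extChartAt_target x₀).uniqueMDiffOn
  have h2 : Continuous fun q : E × E ↦ (⟨q.1, q.2⟩ : TangentBundle 𝓘(ℝ, E) E) :=
    (tangentBundleModelSpaceHomeomorph 𝓘(ℝ, E)).symm.continuous
  refine (h1.comp h2.continuousOn (t := _) fun q hq ↦ hq.1).congr fun q hq ↦ ?_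
  have h3 : mfderivWithin 𝓘(ℝ, E) I (extChartAt I x₀).symm (range I) q.1 =
      mfderivWithin 𝓘(ℝ, E) I (extChartAt I x₀).symm (extChartAt I x₀).target q.1 :=
    mfderivWithin_congr_set (extChartAt_target_eventuallyEq_of_mem hq.1).symm
  simp only [Function.comp, tangentMapWithin, chartFrame, h3]
  rfl

theorem continuousOn_inner_chartFrame
    (g : Bundle.ContMDiffRiemannianMetric I ∞ E (fun x : X ↦ TangentSpace I x)) (x₀ : X) :
    ContinuousOn (fun q : E × E × E ↦ g.inner ((extChartAt I x₀).symm q.1)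
      (chartFrame I x₀ q.1 q.2.1) (chartFrame I x₀ q.1 q.2.2))
      ((extChartAt I x₀).target ×ˢ univ) := by
  have hb : ContinuousOn (fun q : E × E × E ↦ (extChartAt I x₀).symm q.1)
      ((extChartAt I x₀).target ×ˢ univ) :=
    (continuousOn_extChartAt_symm x₀).comp continuousOn_fst fun q hq ↦ hq.1
  have hg := g.contMDiff.continuous.comp_continuousOn hb
  have hv := (continuousOn_chartFrame (I := I) x₀).comp
    (by fun_prop : ContinuousOn (fun q : E × E × E ↦ (q.1, q.2.1))
      ((extChartAt I x₀).target ×ˢ univ)) fun q hq ↦ ⟨hq.1, mem_univ _⟩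
  have hw := (continuousOn_chartFrame (I := I) x₀).comp
    (by fun_prop : ContinuousOn (fun q : E × E × E ↦ (q.1, q.2.2))
      ((extChartAt I x₀).target ×ˢ univ)) fun q hq ↦ ⟨hq.1, mem_univ _⟩
  have h := ContinuousOn.clm_bundle_apply₂ (F₁ := E) (F₂ := E) (F₃ := ℝ)
    (E₃ := fun _ : X ↦ ℝ) hg hv hw
  intro q hq
  have := h q hq
  simp only [FiberBundle.continuousWithinAt_totalSpace] at this
  exact this.2

/-- The change of the chart at `z`. -/
theorem hasFDerivWithinAt_extChartAt_comp_symm {x x' : X} {z : E}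
    (hz : z ∈ (extChartAt I x).target) (hz' : (extChartAt I x).symm z ∈ (extChartAt I x').source) :
    HasFDerivWithinAt (extChartAt I x' ∘ (extChartAt I x).symm)
      (fderivWithin ℝ (extChartAt I x' ∘ (extChartAt I x).symm) (range I) z) (range I) z :=
  ((contDiffWithinAt_ext_coord_change (n := ∞) x' x
    ⟨hz, hz'⟩).differentiableWithinAt
      (by simp)).hasFDerivWithinAt

/-- The coordinate representations of a metric in two charts are related by the derivative of the
change of charts. -/
theorem inner_chartFrame_eq (g : Bundle.RiemannianMetric (fun x : X ↦ TangentSpace I x))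
    {x x' : X} {z : E} (hz : z ∈ (extChartAt I x).target)
    (hz' : (extChartAt I x).symm z ∈ (extChartAt I x').source) (v w : E) :
    g.inner ((extChartAt I x).symm z) (chartFrame I x z v) (chartFrame I x z w) =
      g.inner ((extChartAt I x').symm (extChartAt I x' ((extChartAt I x).symm z)))
        (chartFrame I x' (extChartAt I x' ((extChartAt I x).symm z))
          (fderivWithin ℝ (extChartAt I x' ∘ (extChartAt I x).symm) (range I) z v))
        (chartFrame I x' (extChartAt I x' ((extChartAt I x).symm z))
          (fderivWithin ℝ (extChartAt I x' ∘ (extChartAt I x).symm) (range I) z w)) := by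
  set T := extChartAt I x' ∘ (extChartAt I x).symm
  have hzr : z ∈ range I := extChartAt_target_subset_range x hz
  have hTz : T z ∈ (extChartAt I x').target := (extChartAt I x').map_source hz'
  have hy : (extChartAt I x').symm (T z) = (extChartAt I x).symm z :=
    (extChartAt I x').left_inv hz'
  have hd := hasFDerivWithinAt_extChartAt_comp_symm hz hz'
  have hu : UniqueMDiffWithinAt 𝓘(ℝ, E) (range I) z :=
    (I.uniqueDiffOn z hzr).uniqueMDiffWithinAt
  have hev : (extChartAt I x).symm =ᶠ[𝓝[range I] z] (extChartAt I x').symm ∘ T := by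
    have h1 : ∀ᶠ y in 𝓝[range I] z, (extChartAt I x).symm y ∈ (extChartAt I x').source := by
      have := (continuousOn_extChartAt_symm x z hz).mono_of_mem_nhdsWithin
        (extChartAt_target_mem_nhdsWithin_of_mem hz)
      exact this ((isOpen_extChartAt_source x').mem_nhds hz')
    filter_upwards [h1] with y hy
    exact ((extChartAt I x').left_inv hy).symm
  have hcomp : mfderivWithin 𝓘(ℝ, E) I ((extChartAt I x').symm ∘ T) (range I) z =
      (mfderivWithin 𝓘(ℝ, E) I (extChartAt I x').symm (range I) (T z)).comp
        (mfderivWithin 𝓘(ℝ, E) 𝓘(ℝ, E) T (range I) z) :=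
    mfderivWithin_comp z (mdifferentiableWithinAt_extChartAt_symm hTz)
      hd.differentiableWithinAt.mdifferentiableWithinAt
      (fun y _ ↦ by simp [T, extChartAt, OpenPartialHomeomorph.extend]) hu
  have hchain : (chartFrame I x z : E →L[ℝ] E) =
      (chartFrame I x' (T z) : E →L[ℝ] E).comp (fderivWithin ℝ T (range I) z) :=
    (hev.mfderivWithin_eq hy.symm).trans (hcomp.trans
      (congrArg (fun L : E →L[ℝ] E ↦ (chartFrame I x' (T z) : E →L[ℝ] E).comp L)
        mfderivWithin_eq_fderivWithin))
  have hcongr : ∀ y y' : X, y = y' → ∀ a b : E, (g.inner y : E →L[ℝ] E →L[ℝ] ℝ) a b =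
      (g.inner y' : E →L[ℝ] E →L[ℝ] ℝ) a b := by
    rintro y _ rfl a b
    rfl
  have happ : ∀ u : E, (chartFrame I x z u : E) =
      (chartFrame I x' (T z) (fderivWithin ℝ T (range I) z u) : E) := fun u ↦
    congrArg (fun L : E →L[ℝ] E ↦ L u) hchain
  refine (hcongr _ _ hy.symm _ _).trans ?_
  have h1 := happ v
  have h2 := happ w
  exact congrArg₂ (fun a b : E ↦ (g.inner ((extChartAt I x').symm (T z)) : E →L[ℝ] E →L[ℝ] ℝ) a b)
    h1 h2

end ChartFrame

/-! ### The volume measure in charts -/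

section Gram

variable {n : ℕ} {H : Type*} [TopologicalSpace H]
  {I : ModelWithCorners ℝ (EuclideanSpace ℝ (Fin n)) H}
  {X : Type*} [TopologicalSpace X] [ChartedSpace H X]

local notation "E" => EuclideanSpace ℝ (Fin n)

/-- The pullback of the metric under the inverse of a chart, as a bilinear form on the space of
coordinates. -/
noncomputable def chartMetric (g : Bundle.RiemannianMetric (fun x : X ↦ TangentSpace I x))
    (x₀ : X) (z : E) : LinearMap.BilinForm ℝ E :=
  let B : E →L[ℝ] E →L[ℝ] ℝ := g.inner ((extChartAt I x₀).symm z)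
  let L : E →L[ℝ] E := chartFrame I x₀ z
  LinearMap.mk₂ ℝ (fun v w ↦ B (L v) (L w))
    (fun v v' w ↦ by simp) (fun c v w ↦ by simp) (fun v w w' ↦ by simp) (fun c v w ↦ by simp)

theorem chartMetric_apply (g : Bundle.RiemannianMetric (fun x : X ↦ TangentSpace I x))
    (x₀ : X) (z v w : E) : chartMetric g x₀ z v w =
      g.inner ((extChartAt I x₀).symm z) (chartFrame I x₀ z v) (chartFrame I x₀ z w) := rfl

theorem chartGram_eq_toMatrix (g : Bundle.RiemannianMetric (fun x : X ↦ TangentSpace I x))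
    (x₀ : X) (z : E) : chartGram g x₀ z =
      LinearMap.BilinForm.toMatrix (EuclideanSpace.basisFun (Fin n) ℝ).toBasis
        (chartMetric g x₀ z) := by
  ext i j
  simp [chartGram, LinearMap.BilinForm.toMatrix_apply, chartMetric_apply]

variable [IsManifold I ∞ X]

theorem chartMetric_pos (g : Bundle.RiemannianMetric (fun x : X ↦ TangentSpace I x))
    {x₀ : X} {z : E} (hz : z ∈ (extChartAt I x₀).target) {v : E} (hv : v ≠ 0) :
    0 < chartMetric g x₀ z v v :=
  g.pos _ _ fun h0 ↦ hv (chartFrame_injective hz (h0.trans (map_zero _).symm))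

theorem chartGram_det_pos (g : Bundle.RiemannianMetric (fun x : X ↦ TangentSpace I x))
    {x₀ : X} {z : E} (hz : z ∈ (extChartAt I x₀).target) : 0 < (chartGram g x₀ z).det := by
  refine (Matrix.PosDef.of_dotProduct_mulVec_pos (R := ℝ) ?_ fun v hv ↦ ?_).det_pos
  · ext i j
    exact g.symm _ _ _
  · rw [chartGram_eq_toMatrix, star_trivial, LinearMap.BilinForm.dotProduct_toMatrix_mulVec]
    exact chartMetric_pos g hz (by simpa using hv)

theorem continuousOn_chartGram_det
    (g : Bundle.ContMDiffRiemannianMetric I ∞ E (fun x : X ↦ TangentSpace I x)) (x₀ : X) :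
    ContinuousOn (fun z ↦ (chartGram g.toRiemannianMetric x₀ z).det) (extChartAt I x₀).target := by
  have h : ContinuousOn (fun z ↦ chartGram g.toRiemannianMetric x₀ z)
      (extChartAt I x₀).target := by
    refine continuousOn_pi.2 fun i ↦ continuousOn_pi.2 fun j ↦ ?_
    exact (continuousOn_inner_chartFrame g x₀).comp (f := fun z : E ↦
      (z, EuclideanSpace.basisFun (Fin n) ℝ i, EuclideanSpace.basisFun (Fin n) ℝ j))
      (by fun_prop) fun z hz ↦ ⟨hz, mem_univ _⟩
  exact (Continuous.matrix_det continuous_id).comp_continuousOn h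

theorem sqrt_chartGram_det_eq (g : Bundle.RiemannianMetric (fun x : X ↦ TangentSpace I x))
    {x x' : X} {z : E} (hz : z ∈ (extChartAt I x).target)
    (hz' : (extChartAt I x).symm z ∈ (extChartAt I x').source) :
    √(chartGram g x z).det =
      |(fderivWithin ℝ (extChartAt I x' ∘ (extChartAt I x).symm) (range I) z).det| *
        √(chartGram g x' (extChartAt I x' ((extChartAt I x).symm z))).det := by
  set T' := fderivWithin ℝ (extChartAt I x' ∘ (extChartAt I x).symm) (range I) z
  have h : chartMetric g x z =
      (chartMetric g x' (extChartAt I x' ((extChartAt I x).symm z))).comp T' T' := by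
    ext v w
    exact inner_chartFrame_eq g hz hz' v w
  rw [chartGram_eq_toMatrix, h, LinearMap.BilinForm.toMatrix_comp
    (EuclideanSpace.basisFun (Fin n) ℝ).toBasis, Matrix.det_mul, Matrix.det_mul,
    Matrix.det_transpose, LinearMap.det_toMatrix, ← chartGram_eq_toMatrix,
    mul_right_comm, Real.sqrt_mul (mul_self_nonneg _), Real.sqrt_mul_self_eq_abs]

end Gram

section Volume

variable {n : ℕ} {H : Type*} [TopologicalSpace H]
  {I : ModelWithCorners ℝ (EuclideanSpace ℝ (Fin n)) H}
  {X : Type*} [TopologicalSpace X] [ChartedSpace H X]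

local notation "E" => EuclideanSpace ℝ (Fin n)

theorem measurableSet_extChartAt_target {E' : Type*} [NormedAddCommGroup E'] [NormedSpace ℝ E']
    [MeasurableSpace E'] [OpensMeasurableSpace E'] {I : ModelWithCorners ℝ E' H} (x₀ : X) :
    MeasurableSet (extChartAt I x₀).target := by
  rw [extChartAt_target]
  exact (((chartAt H x₀).open_target.preimage I.continuous_symm).measurableSet).inter
    I.isClosed_range.measurableSet

theorem measurableSet_extChartAt_target_inter_preimage {E' : Type*} [NormedAddCommGroup E']
    [NormedSpace ℝ E'] [MeasurableSpace E'] [OpensMeasurableSpace E'] {I : ModelWithCorners ℝ E' H}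
    [MeasurableSpace X] [BorelSpace X] (x₀ : X) {s : Set X} (hs : MeasurableSet s) :
    MeasurableSet ((extChartAt I x₀).target ∩ (extChartAt I x₀).symm ⁻¹' s) := by
  have h1 := (continuousOn_extChartAt_symm (I := I) x₀).domRestrict.measurable hs
  have h2 := (measurableSet_extChartAt_target (I := I) x₀).subtype_image h1
  rwa [show (Subtype.val '' ((extChartAt I x₀).target.domRestrict (extChartAt I x₀).symm ⁻¹' s)) =
    (extChartAt I x₀).target ∩ (extChartAt I x₀).symm ⁻¹' s by
      ext; simp [and_comm]] at h2

variable [MeasurableSpace X] [BorelSpace X]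

theorem chartVolume_apply (g : Bundle.RiemannianMetric (fun x : X ↦ TangentSpace I x))
    (x₀ : X) {s : Set X} (hs : MeasurableSet s) :
    chartVolume g x₀ s = ∫⁻ z in (extChartAt I x₀).target ∩ (extChartAt I x₀).symm ⁻¹' s,
      ENNReal.ofReal √(chartGram g x₀ z).det := by
  have hm := ((continuousOn_extChartAt_symm (I := I) x₀).aemeasurable (μ := volume)
    (measurableSet_extChartAt_target x₀)).mono_ac (withDensity_absolutelyContinuous _
      (fun z ↦ ENNReal.ofReal √(chartGram g x₀ z).det))
  rw [chartVolume, Measure.map_apply_of_aemeasurable hm hs, withDensity_apply',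
    Measure.restrict_restrict' (measurableSet_extChartAt_target x₀), inter_comm]

variable [IsManifold I ∞ X]

/-- The densities `√(det (g_ij)) dz` of two charts agree on the overlap, by the change of variables
formula. -/
theorem chartVolume_restrict_source_le
    (g : Bundle.RiemannianMetric (fun x : X ↦ TangentSpace I x)) (x x' : X) :
    (chartVolume g x).restrict (extChartAt I x').source ≤ chartVolume g x' := by
  refine Measure.le_iff.2 fun s hs ↦ ?_
  have ho : MeasurableSet (extChartAt I x').source := (isOpen_extChartAt_source x').measurableSet
  rw [Measure.restrict_apply hs, chartVolume_apply g x (hs.inter ho), chartVolume_apply g x' hs]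
  set Z := (extChartAt I x).target ∩ (extChartAt I x).symm ⁻¹' (s ∩ (extChartAt I x').source)
  have hZm : MeasurableSet Z := measurableSet_extChartAt_target_inter_preimage x (hs.inter ho)
  set T := extChartAt I x' ∘ (extChartAt I x).symm
  have hd : ∀ z ∈ Z, HasFDerivWithinAt T (fderivWithin ℝ T (range I) z) Z z := fun z hz ↦
    (hasFDerivWithinAt_extChartAt_comp_symm hz.1 hz.2.2).mono
      (inter_subset_left.trans (extChartAt_target_subset_range x))
  have hinj : InjOn T Z := fun z hz z' hz' h ↦
    (extChartAt I x).symm.injOn hz.1 hz'.1 ((extChartAt I x').injOn hz.2.2 hz'.2.2 h)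
  calc ∫⁻ z in Z, ENNReal.ofReal √(chartGram g x z).det
      = ∫⁻ z in Z, ENNReal.ofReal |(fderivWithin ℝ T (range I) z).det| *
          ENNReal.ofReal √(chartGram g x' (T z)).det := by
        refine setLIntegral_congr_fun hZm fun z hz ↦ ?_
        rw [← ENNReal.ofReal_mul (abs_nonneg _), sqrt_chartGram_det_eq g hz.1 hz.2.2]
        rfl
    _ = ∫⁻ z in T '' Z, ENNReal.ofReal √(chartGram g x' z).det :=
        (lintegral_image_eq_lintegral_abs_det_fderiv_mul volume hZm hd hinj
          fun z ↦ ENNReal.ofReal √(chartGram g x' z).det).symm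
    _ ≤ _ := by
        refine lintegral_mono_set ?_
        rintro _ ⟨z, hz, rfl⟩
        refine ⟨(extChartAt I x').map_source hz.2.2, ?_⟩
        have : (extChartAt I x').symm (T z) = (extChartAt I x).symm z :=
          (extChartAt I x').left_inv hz.2.2
        rw [mem_preimage, this]
        exact hz.2.1

end Volume

/-! ### Parallelepipeds in a half-space and their subdivision -/

section Boxes

variable {n : ℕ}

local notation "E" => EuclideanSpace ℝ (Fin n)

/-- Coordinates adapted to a half-space `{0 ≤ l}`: one of the standard coordinates is replaced
by `l`. -/
theorem exists_equiv_apply_eq {l : E →L[ℝ] ℝ} (hl : l ≠ 0) :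
    ∃ (S : E ≃L[ℝ] (Fin n → ℝ)) (i : Fin n), ∀ z, S z i = l z := by
  classical
  obtain ⟨i, hi⟩ : ∃ i, l (EuclideanSpace.single i 1) ≠ 0 := by
    by_contra! h
    refine hl (ContinuousLinearMap.coe_injective
      ((EuclideanSpace.basisFun (Fin n) ℝ).toBasis.ext fun i ↦ ?_))
    simpa using h i
  let S₀ : E →ₗ[ℝ] (Fin n → ℝ) := LinearMap.pi fun j ↦
    if j = i then (l : E →ₗ[ℝ] ℝ) else (EuclideanSpace.proj j : E →L[ℝ] ℝ)
  have hS₀ : ∀ z, S₀ z i = l z := fun z ↦ by simp [S₀]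
  have hS₁ : ∀ z j, j ≠ i → S₀ z j = z j := fun z j hj ↦ by simp [S₀, hj]
  have hinj : Function.Injective S₀ := by
    refine (injective_iff_map_eq_zero S₀).2 fun z hz ↦ ?_
    have h1 : ∀ j, j ≠ i → z j = 0 := fun j hj ↦ by rw [← hS₁ z j hj, hz]; rfl
    have h2 : z = z i • EuclideanSpace.single i 1 := by
      ext j
      by_cases hj : j = i
      · subst hj; simp
      · simp [h1 j hj, hj]
    have h3 : l z = 0 := by rw [← hS₀ z, hz]; rfl
    rw [h2, map_smul, smul_eq_mul] at h3
    rw [h2, (mul_eq_zero.1 h3).resolve_right hi, zero_smul]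
  let S : E ≃ₗ[ℝ] (Fin n → ℝ) := LinearEquiv.ofInjectiveOfFinrankEq S₀ hinj (by simp)
  exact ⟨S.toContinuousLinearEquiv, i, fun z ↦ hS₀ z⟩

/-- Every point of the whole space or of a closed half-space has arbitrarily small neighborhoods
which are parallelepipeds. At a boundary point one face of the parallelepiped lies on the
boundary. -/
theorem IsBoundaryModel.exists_parallelepiped {H : Type*} [TopologicalSpace H]
    {I : ModelWithCorners ℝ E H} (hI : IsBoundaryModel I) {z₀ : E} (hz₀ : z₀ ∈ range I)
    {V : Set E} (hV : V ∈ 𝓝[range I] z₀) :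
    ∃ (L : (Fin n → ℝ) ≃L[ℝ] E) (b : E), (fun t ↦ b + L t) '' Icc 0 1 ⊆ V ∩ range I ∧
      (fun t ↦ b + L t) '' (univ.pi fun _ ↦ Ico 0 1) ∈ 𝓝[range I] z₀ := by
  classical
  obtain ⟨S, c, hc, hnhds, W, hW, hsub⟩ : ∃ (S : E ≃L[ℝ] (Fin n → ℝ)) (c : Fin n → ℝ),
      (∀ j, c j ∈ Icc (0 : ℝ) 1) ∧
      (∀ r > 0, {z | ∀ j, S z j ∈ Ico (S z₀ j - r * c j) (S z₀ j + r * (1 - c j))} ∈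
        𝓝[range I] z₀) ∧
      ∃ W ∈ 𝓝 z₀, ∀ r > 0,
        {z | ∀ j, S z j ∈ Icc (S z₀ j - r * c j) (S z₀ j + r * (1 - c j))} ∩ W ⊆ range I := by
    by_cases hint : range I ∈ 𝓝 z₀
    · refine ⟨EuclideanSpace.equiv (Fin n) ℝ, fun _ ↦ 1 / 2, fun j ↦ by norm_num,
        fun r hr ↦ mem_nhdsWithin_of_mem_nhds ?_, range I, hint, fun r hr ↦ inter_subset_right⟩
      refine eventually_all.2 fun j ↦ ?_
      have : ContinuousAt (fun z ↦ EuclideanSpace.equiv (Fin n) ℝ z j) z₀ := by fun_prop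
      exact this (Ico_mem_nhds (by linarith) (by linarith))
    · rcases hI with hI | ⟨l, hl, hI⟩
      · simp [hI] at hint
      · have hl0 : l z₀ = 0 := by
          refine le_antisymm ?_ (by simpa [hI] using hz₀)
          by_contra! h
          refine hint ?_
          rw [hI]
          filter_upwards [l.continuous.continuousAt.eventually (lt_mem_nhds h)] with z hz
            using le_of_lt hz
        obtain ⟨S, i, hS⟩ := exists_equiv_apply_eq hl
        refine ⟨S, fun j ↦ if j = i then 0 else 1 / 2, fun j ↦ ?_, fun r hr ↦ ?_, univ, univ_mem,
          fun r hr z hz ↦ ?_⟩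
        · by_cases hj : j = i <;> simp only [hj, if_true, if_false] <;> norm_num
        · refine eventually_all.2 fun j ↦ ?_
          have h1 : ContinuousAt (fun z ↦ S z j) z₀ := by fun_prop
          by_cases hj : j = i
          · subst hj
            filter_upwards [self_mem_nhdsWithin, mem_nhdsWithin_of_mem_nhds
              (h1.eventually (gt_mem_nhds (show S z₀ j < S z₀ j + r by linarith)))] with z hz hz'
            rw [hI] at hz
            simp only [if_true, mul_zero, sub_zero, mul_one]
            refine ⟨?_, hz'⟩
            rw [hS, hS, hl0]
            exact hz
          · simp only [hj, if_false]
            exact mem_nhdsWithin_of_mem_nhds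
              (h1 (Ico_mem_nhds (by linarith) (by linarith)))
        · have := (hz.1 i).1
          rw [hS, hS, hl0] at this
          rw [hI]
          simpa using this
  obtain ⟨W', hW', hz₀W', hW'V⟩ := mem_nhdsWithin.1 hV
  obtain ⟨ε, hε, hball⟩ := Metric.mem_nhds_iff.1 (inter_mem hW (hW'.mem_nhds hz₀W'))
  set κ := ‖(S.symm : (Fin n → ℝ) →L[ℝ] E)‖
  have hκ0 : 0 ≤ κ := norm_nonneg _
  set r := ε / (κ + 1) with hr
  have hr0 : 0 < r := by positivity
  let L : (Fin n → ℝ) ≃L[ℝ] E :=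
    (LinearEquiv.smulOfNeZero ℝ (Fin n → ℝ) r hr0.ne').toContinuousLinearEquiv.trans S.symm
  have hL : ∀ t, L t = S.symm (r • t) := fun t ↦ rfl
  have hSL : ∀ t j, S (z₀ - S.symm (r • c) + L t) j = S z₀ j + r * (t j - c j) := fun t j ↦ by
    rw [hL]
    simp
    ring
  refine ⟨L, z₀ - S.symm (r • c), ?_, ?_⟩
  · rintro _ ⟨t, ht, rfl⟩
    have h1 : z₀ - S.symm (r • c) + L t ∈ Metric.ball z₀ ε := by
      have h2 : z₀ - S.symm (r • c) + L t - z₀ = S.symm (r • (t - c)) := by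
        rw [hL, smul_sub, map_sub]
        abel
      have h3 : ‖t - c‖ ≤ 1 := by
        refine (pi_norm_le_iff_of_nonneg zero_le_one).2 fun j ↦ ?_
        rw [Pi.sub_apply, Real.norm_eq_abs, abs_le]
        have h4 := hc j
        have h5 := ht.1 j
        have h6 := ht.2 j
        simp only [Pi.zero_apply, Pi.one_apply] at h5 h6
        constructor <;> linarith [h4.1, h4.2]
      rw [Metric.mem_ball, dist_eq_norm, h2]
      calc ‖S.symm (r • (t - c))‖ ≤ κ * ‖r • (t - c)‖ :=
            (S.symm : (Fin n → ℝ) →L[ℝ] E).le_opNorm _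
        _ ≤ κ * r := by
            rw [norm_smul, Real.norm_of_nonneg hr0.le]
            gcongr
            exact mul_le_of_le_one_right hr0.le h3
        _ < (κ + 1) * r := by linarith
        _ = ε := by rw [hr]; field_simp
    have h7 := hball h1
    have h8 : z₀ - S.symm (r • c) + L t ∈ range I := by
      refine hsub r hr0 ⟨fun j ↦ ?_, h7.1⟩
      have h5 := ht.1 j
      have h6 := ht.2 j
      simp only [Pi.zero_apply, Pi.one_apply] at h5 h6
      rw [hSL]
      constructor <;> nlinarith
    exact ⟨hW'V ⟨h7.2, h8⟩, h8⟩
  · refine mem_of_superset (hnhds r hr0) fun z hz ↦ ?_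
    refine ⟨fun j ↦ (S z j - S z₀ j) / r + c j, fun j _ ↦ ?_, ?_⟩
    · have h1 := (hz j).1
      have h2 := (hz j).2
      constructor
      · have : - c j ≤ (S z j - S z₀ j) / r := (le_div_iff₀ hr0).2 (by linarith)
        linarith
      · have : (S z j - S z₀ j) / r < 1 - c j := (div_lt_iff₀ hr0).2 (by linarith)
        linarith
    · refine S.injective (funext fun j ↦ ?_)
      rw [hSL]
      field_simp
      ring

open scoped Pointwise in
/-- A parallelepiped is divided into `k ^ n` small ones. They are replaced by their interiors, which
does not change integrals since the boundary of a convex set is a null set. -/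
theorem exists_subdivision (L : (Fin n → ℝ) ≃L[ℝ] E) (b : E) :
    ∃ C : NNReal, ∀ k : ℕ, k ≠ 0 → ∃ A : (Fin n → Fin k) → Set E,
      (∀ c, IsOpen (A c) ∧ Convex ℝ (A c) ∧ A c ⊆ (fun t ↦ b + L t) '' Icc 0 1 ∧
        (∀ z ∈ A c, ∀ z' ∈ A c, ‖z' - z‖ₑ ≤ C / k) ∧ 1 ≤ C * (k : ℝ≥0∞) ^ n * volume (A c)) ∧
      ∑ c, volume.restrict (A c) =
        volume.restrict ((fun t ↦ b + L t) '' (univ.pi fun _ ↦ Ico 0 1)) := by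
  set φ : (Fin n → ℝ) → E := fun t ↦ b + L t with hφ
  set U : Set (Fin n → ℝ) := univ.pi fun _ ↦ Ico 0 1
  have hφinj : Function.Injective φ := fun t t' h ↦ L.injective (add_left_cancel h)
  have hφm : ∀ s, MeasurableSet s → MeasurableSet (φ '' s) := fun s hs ↦
    (L.toHomeomorph.trans (Homeomorph.addLeft b)).measurableEmbedding.measurableSet_image.2 hs
  have hv0 : volume (L '' U) ≠ 0 := by
    have h1 : IsOpen (L '' (univ.pi fun _ ↦ Ioo 0 1)) :=
      L.toHomeomorph.isOpenMap _ (isOpen_set_pi finite_univ fun _ _ ↦ isOpen_Ioo)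
    have h2 : (L '' (univ.pi fun _ ↦ Ioo (0 : ℝ) 1)).Nonempty :=
      (univ_pi_nonempty_iff.2 fun _ ↦ nonempty_Ioo.2 one_pos).image _
    have h3 : 0 < volume (L '' (univ.pi fun _ ↦ Ioo (0 : ℝ) 1)) := h1.measure_pos _ h2
    exact (h3.trans_le (measure_mono (image_mono (pi_mono fun _ _ ↦ Ioo_subset_Ico_self)))).ne'
  have hvt : volume (L '' U) ≠ ⊤ := by
    have h1 : IsCompact (L '' Icc 0 1) := isCompact_Icc.image L.continuous
    refine ((measure_mono (image_mono ?_)).trans_lt h1.measure_lt_top).ne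
    rw [← pi_univ_Icc]
    exact pi_mono fun _ _ ↦ Ico_subset_Icc_self
  set C : NNReal := max ‖(L : (Fin n → ℝ) →L[ℝ] E)‖₊ (volume (L '' U))⁻¹.toNNReal
  refine ⟨C, fun k hk ↦ ?_⟩
  have hk0 : (0 : ℝ) < k := by positivity
  set Q : (Fin n → Fin k) → Set (Fin n → ℝ) := fun c ↦
    univ.pi fun j ↦ Ico ((c j : ℝ) / k) ((c j + 1) / k)
  have hQm : ∀ c, MeasurableSet (Q c) := fun c ↦ MeasurableSet.univ_pi fun j ↦ measurableSet_Ico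
  have hQU : ∀ c, Q c ⊆ U := by
    intro c
    refine pi_mono fun j _ ↦ Ico_subset_Ico (by positivity) ?_
    rw [div_le_one hk0]
    exact_mod_cast (c j).2
  have hUQ : U = ⋃ c, Q c := by
    refine subset_antisymm (fun t ht ↦ ?_) (iUnion_subset hQU)
    have h1 : ∀ j, ⌊t j * k⌋₊ < k := fun j ↦ by
      have := ht j (mem_univ j)
      rw [Nat.floor_lt (by have := this.1; positivity)]
      have h2 := mul_lt_mul_of_pos_right this.2 hk0
      simpa using h2
    refine mem_iUnion.2 ⟨fun j ↦ ⟨⌊t j * k⌋₊, h1 j⟩, fun j _ ↦ ⟨?_, ?_⟩⟩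
    · rw [div_le_iff₀ hk0]
      exact Nat.floor_le (by have := (ht j (mem_univ j)).1; positivity)
    · rw [lt_div_iff₀ hk0]
      exact Nat.lt_floor_add_one _
  have hdisj : Pairwise (Function.onFun Disjoint Q) := by
    intro c c' hcc'
    refine disjoint_left.2 fun t ht ht' ↦ hcc' (funext fun j ↦ ?_)
    have h1 := ht j (mem_univ j)
    have h2 := ht' j (mem_univ j)
    have h3 := lt_of_le_of_lt h1.1 h2.2
    have h4 := lt_of_le_of_lt h2.1 h1.2
    rw [div_lt_div_iff_of_pos_right hk0] at h3 h4
    have h5 : (c j : ℕ) < c' j + 1 := by exact_mod_cast h3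
    have h6 : (c' j : ℕ) < c j + 1 := by exact_mod_cast h4
    exact Fin.ext (by omega)
  have hconv : ∀ c, Convex ℝ (φ '' Q c) := by
    intro c
    have h1 : Convex ℝ (Q c) := convex_pi fun j _ ↦ convex_Ico _ _
    have h2 : φ '' Q c = (fun z ↦ b + z) '' (L.toLinearEquiv.toLinearMap '' Q c) := by
      rw [image_image]
      rfl
    rw [h2]
    exact (h1.linear_image _).translate b
  have hnull : ∀ c, interior (φ '' Q c) =ᵐ[volume] φ '' Q c := fun c ↦
    interior_ae_eq_of_null_frontier ((hconv c).addHaar_frontier volume)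
  have hvol : ∀ c, volume (φ '' Q c) = ENNReal.ofReal ((k : ℝ)⁻¹ ^ n) * volume (L '' U) := by
    intro c
    have h1 : φ '' Q c = (fun z ↦ (b + L fun j ↦ (c j : ℝ) / k) + z) ''
        ((k : ℝ)⁻¹ • (L '' U)) := by
      have h2 : ∀ u, (b + L fun j ↦ (c j : ℝ) / k) + (k : ℝ)⁻¹ • L u =
          φ fun j ↦ (c j + u j) / k := by
        intro u
        rw [← map_smul, add_assoc, ← map_add]
        congr 2
        ext j
        simp only [Pi.add_apply, Pi.smul_apply, smul_eq_mul]
        field_simp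
      rw [← image_smul, image_image, image_image]
      simp only [h2]
      ext z
      constructor
      · rintro ⟨t, ht, rfl⟩
        refine ⟨fun j ↦ k * t j - c j, fun j _ ↦ ?_, ?_⟩
        · have h3 := ht j (mem_univ j)
          rw [mem_Ico, div_le_iff₀ hk0, lt_div_iff₀ hk0] at h3
          constructor <;> linarith
        · simp only [add_sub_cancel]
          congr 1
          ext j
          field_simp
      · rintro ⟨u, hu, rfl⟩
        refine ⟨_, fun j _ ↦ ?_, rfl⟩
        have h3 := hu j (mem_univ j)
        exact ⟨by gcongr; linarith [h3.1], by gcongr; exact h3.2⟩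
    rw [h1, image_add_left, measure_preimage_add, Measure.addHaar_smul, finrank_euclideanSpace_fin,
      abs_of_nonneg (by positivity)]
  refine ⟨fun c ↦ interior (φ '' Q c),
    fun c ↦ ⟨isOpen_interior, (hconv c).interior, ?_, ?_, ?_⟩, ?_⟩
  · refine interior_subset.trans (image_mono ((hQU c).trans ?_))
    rw [← pi_univ_Icc]
    exact pi_mono fun _ _ ↦ Ico_subset_Icc_self
  · intro z hz z' hz'
    obtain ⟨t, ht, rfl⟩ := interior_subset hz
    obtain ⟨t', ht', rfl⟩ := interior_subset hz'
    have h1 : φ t' - φ t = L (t' - t) := by simp [hφ]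
    have h2 : ‖t' - t‖ ≤ 1 / k := by
      refine (pi_norm_le_iff_of_nonneg (by positivity)).2 fun j ↦ ?_
      have h3 := ht j (mem_univ j)
      have h4 := ht' j (mem_univ j)
      rw [mem_Ico, add_div] at h3 h4
      rw [Pi.sub_apply, Real.norm_eq_abs, abs_le]
      constructor <;> linarith [h3.1, h3.2, h4.1, h4.2]
    have h3 : ‖t' - t‖₊ ≤ 1 / (k : NNReal) := by
      rw [← NNReal.coe_le_coe]
      simpa using h2
    have h4 : ‖φ t' - φ t‖₊ ≤ C / k := by
      rw [h1]
      calc ‖L (t' - t)‖₊ ≤ ‖(L : (Fin n → ℝ) →L[ℝ] E)‖₊ * ‖t' - t‖₊ :=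
            (L : (Fin n → ℝ) →L[ℝ] E).le_opNNNorm _
        _ ≤ C * (1 / k) := by gcongr; exact le_max_left _ _
        _ = C / k := by rw [mul_one_div]
    have hk0' : (k : NNReal) ≠ 0 := by exact_mod_cast hk
    calc ‖φ t' - φ t‖ₑ = ((‖φ t' - φ t‖₊ : NNReal) : ℝ≥0∞) := rfl
      _ ≤ ((C / k : NNReal) : ℝ≥0∞) := by exact_mod_cast h4
      _ = C / k := by rw [ENNReal.coe_div hk0']; simp
  · rw [measure_congr (hnull c), hvol]
    have h1 : (k : ℝ≥0∞) ^ n * ENNReal.ofReal ((k : ℝ)⁻¹ ^ n) = 1 := by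
      rw [ENNReal.ofReal_pow (by positivity), ENNReal.ofReal_inv_of_pos hk0, ENNReal.ofReal_natCast,
        ← mul_pow, ENNReal.mul_inv_cancel (by exact_mod_cast hk) (by simp), one_pow]
    have h2 : (volume (L '' U))⁻¹ ≤ C := by
      rw [← ENNReal.coe_toNNReal (ENNReal.inv_ne_top.2 hv0)]
      exact_mod_cast le_max_right _ _
    calc (1 : ℝ≥0∞) = (volume (L '' U))⁻¹ * volume (L '' U) :=
          (ENNReal.inv_mul_cancel hv0 hvt).symm
      _ ≤ C * volume (L '' U) := by gcongr
      _ = C * ((k : ℝ≥0∞) ^ n * ENNReal.ofReal ((k : ℝ)⁻¹ ^ n)) * volume (L '' U) := by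
          rw [h1, mul_one]
      _ = _ := by ring
  · rw [hUQ, image_iUnion, Measure.restrict_iUnion (fun c c' hcc' ↦
      (disjoint_image_iff hφinj).2 (hdisj hcc')) fun c ↦ hφm _ (hQm c), Measure.sum_fintype]
    exact Finset.sum_congr rfl fun c _ ↦ Measure.restrict_congr_set (hnull c)

end Boxes

/-! ### Cells on a compact Riemannian manifold -/

section Cells

universe u

variable {n : ℕ} {H : Type*} [TopologicalSpace H]
  {I : ModelWithCorners ℝ (EuclideanSpace ℝ (Fin n)) H}
  {X : Type u} [TopologicalSpace X] [ChartedSpace H X]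

local notation "E" => EuclideanSpace ℝ (Fin n)

/-- A convex open set `A` of coordinates in the chart around `x₀`, of diameter at most `C / k`
and of volume at least `1 / (C k ^ n)`, on which the metric is at most `C ^ 2` times the Euclidean
one. -/
structure IsChartCell (g : Bundle.RiemannianMetric (fun x : X ↦ TangentSpace I x)) (C : NNReal)
    (k : ℕ) (x₀ : X) (A : Set E) : Prop where
  isOpen : IsOpen A
  convex : Convex ℝ A
  subset_target : A ⊆ (extChartAt I x₀).target
  enorm_sub_le : ∀ z ∈ A, ∀ z' ∈ A, ‖z' - z‖ₑ ≤ C / k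
  one_le_volume : 1 ≤ C * (k : ℝ≥0∞) ^ n * volume A
  metric_le : ∀ z ∈ A, ∀ v, chartMetric g x₀ z v v ≤ C ^ 2 * ‖v‖ ^ 2

theorem IsChartCell.mono {g : Bundle.RiemannianMetric (fun x : X ↦ TangentSpace I x)}
    {C C' : NNReal} {k : ℕ} {x₀ : X} {A : Set E} (h : IsChartCell g C k x₀ A) (hC : C ≤ C') :
    IsChartCell g C' k x₀ A where
  isOpen := h.isOpen
  convex := h.convex
  subset_target := h.subset_target
  enorm_sub_le z hz z' hz' := (h.enorm_sub_le z hz z' hz').trans (by gcongr)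
  one_le_volume := h.one_le_volume.trans (by gcongr)
  metric_le z hz v := (h.metric_le z hz v).trans (by gcongr)

theorem IsChartCell.volume_lt_top {g : Bundle.RiemannianMetric (fun x : X ↦ TangentSpace I x)}
    {C : NNReal} {k : ℕ} (hk : k ≠ 0) {x₀ : X}
    {A : Set E} (hA : IsChartCell g C k x₀ A) : volume A < ⊤ := by
  rcases A.eq_empty_or_nonempty with rfl | ⟨z, hz⟩
  · simp
  have h1 : A ⊆ Metric.closedEBall z (C / k) := fun z' hz' ↦ by
    rw [Metric.mem_closedEBall, edist_eq_enorm_sub]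
    exact hA.enorm_sub_le z hz z' hz'
  have h2 : (C / k : ℝ≥0∞) = ((C / k : NNReal) : ℝ≥0∞) := by
    rw [ENNReal.coe_div (by exact_mod_cast hk), ENNReal.coe_natCast]
  rw [h2, Metric.closedEBall_coe] at h1
  exact (measure_mono h1).trans_lt measure_closedBall_lt_top

variable (I) in
/-- The image on the manifold of the Lebesgue measure of a set `A` of coordinates. -/
noncomputable def cellMeasure [MeasurableSpace X] (x₀ : X) (A : Set E) : Measure X :=
  (volume.restrict A).map (extChartAt I x₀).symm

section

variable [MeasurableSpace X] [BorelSpace X]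

theorem aemeasurable_extChartAt_symm {x₀ : X} {A : Set E} (hA : A ⊆ (extChartAt I x₀).target) :
    AEMeasurable (extChartAt I x₀).symm (volume.restrict A) :=
  ((continuousOn_extChartAt_symm x₀).aemeasurable
    (measurableSet_extChartAt_target x₀)).mono_measure (Measure.restrict_mono hA le_rfl)

theorem cellMeasure_apply {x₀ : X} {A : Set E} (hA : A ⊆ (extChartAt I x₀).target)
    (hAm : MeasurableSet A) {s : Set X} (hs : MeasurableSet s) :
    cellMeasure I x₀ A s =
      volume ((extChartAt I x₀).target ∩ (extChartAt I x₀).symm ⁻¹' s ∩ A) := by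
  rw [cellMeasure, Measure.map_apply_of_aemeasurable (aemeasurable_extChartAt_symm hA) hs,
    Measure.restrict_apply' hAm]
  congr 1
  ext z
  simp only [mem_inter_iff]
  exact ⟨fun h ↦ ⟨⟨hA h.2, h.1⟩, h.2⟩, fun h ↦ ⟨h.1.2, h.2⟩⟩

theorem cellMeasure_univ {x₀ : X} {A : Set E}
    (hA : A ⊆ (extChartAt I x₀).target) : cellMeasure I x₀ A univ = volume A := by
  rw [cellMeasure, Measure.map_apply_of_aemeasurable (aemeasurable_extChartAt_symm hA)
    MeasurableSet.univ, preimage_univ, Measure.restrict_apply_univ]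

end

theorem exists_chartMetric_le [IsManifold I ∞ X]
    (g : Bundle.ContMDiffRiemannianMetric I ∞ E (fun x : X ↦ TangentSpace I x)) {x₀ : X} {K : Set E}
    (hK : IsCompact K) (hKt : K ⊆ (extChartAt I x₀).target) :
    ∃ C : NNReal, ∀ z ∈ K, ∀ v, chartMetric g.toRiemannianMetric x₀ z v v ≤ C ^ 2 * ‖v‖ ^ 2 := by
  have h1 : ContinuousOn (fun q : E × E ↦ chartMetric g.toRiemannianMetric x₀ q.1 q.2 q.2)
      (K ×ˢ Metric.sphere 0 1) :=
    (continuousOn_inner_chartFrame g x₀).comp (f := fun q : E × E ↦ (q.1, q.2, q.2))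
      (by fun_prop) fun q hq ↦ ⟨hKt hq.1, mem_univ _⟩
  obtain ⟨c, hc⟩ := (hK.prod (isCompact_sphere 0 1)).exists_bound_of_continuousOn h1
  refine ⟨NNReal.sqrt c.toNNReal, fun z hz v ↦ ?_⟩
  rcases eq_or_ne v 0 with rfl | hv
  · simp
  have hv' : ‖v‖ ≠ 0 := norm_ne_zero_iff.2 hv
  have h2 := hc (z, ‖v‖⁻¹ • v) ⟨hz, by simp [norm_smul, hv']⟩
  have h3 := (le_abs_self _).trans h2
  simp only [map_smul, LinearMap.smul_apply, smul_eq_mul] at h3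
  have h4 : ((NNReal.sqrt c.toNNReal : NNReal) : ℝ) ^ 2 = c.toNNReal := by
    exact_mod_cast NNReal.sq_sqrt _
  rw [h4]
  calc chartMetric g.toRiemannianMetric x₀ z v v
      = (‖v‖⁻¹ * (‖v‖⁻¹ * chartMetric g.toRiemannianMetric x₀ z v v)) * ‖v‖ ^ 2 := by
        field_simp
    _ ≤ c.toNNReal * ‖v‖ ^ 2 := by
        gcongr
        exact h3.trans (Real.le_coe_toNNReal c)

theorem exists_sqrt_chartGram_det_bounds [IsManifold I ∞ X]
    (g : Bundle.ContMDiffRiemannianMetric I ∞ E (fun x : X ↦ TangentSpace I x)) {x₀ : X} {K : Set E}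
    (hK : IsCompact K) (hKt : K ⊆ (extChartAt I x₀).target) :
    ∃ C : NNReal, ∀ z ∈ K,
      ENNReal.ofReal √(chartGram g.toRiemannianMetric x₀ z).det ≤ C ∧
      1 ≤ C * ENNReal.ofReal √(chartGram g.toRiemannianMetric x₀ z).det := by
  have h1 : ContinuousOn (fun z ↦ √(chartGram g.toRiemannianMetric x₀ z).det) K :=
    (Real.continuous_sqrt.comp_continuousOn (continuousOn_chartGram_det g x₀)).mono hKt
  have h0 : ∀ z ∈ K, 0 < √(chartGram g.toRiemannianMetric x₀ z).det := fun z hz ↦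
    Real.sqrt_pos.2 (chartGram_det_pos _ (hKt hz))
  obtain ⟨c, hc⟩ := hK.exists_bound_of_continuousOn h1
  obtain ⟨c', hc'⟩ := hK.exists_bound_of_continuousOn (h1.inv₀ fun z hz ↦ (h0 z hz).ne')
  refine ⟨max c.toNNReal c'.toNNReal, fun z hz ↦ ⟨?_, ?_⟩⟩
  · calc _ ≤ ENNReal.ofReal c := ENNReal.ofReal_le_ofReal ((le_abs_self _).trans (hc z hz))
      _ ≤ _ := by
        rw [ENNReal.ofReal]
        exact_mod_cast le_max_left _ _
  · calc 1 = ENNReal.ofReal (√(chartGram g.toRiemannianMetric x₀ z).det)⁻¹ *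
          ENNReal.ofReal √(chartGram g.toRiemannianMetric x₀ z).det := by
          rw [← ENNReal.ofReal_mul (inv_nonneg.2 (h0 z hz).le), inv_mul_cancel₀ (h0 z hz).ne',
            ENNReal.ofReal_one]
      _ ≤ ENNReal.ofReal c' * ENNReal.ofReal √(chartGram g.toRiemannianMetric x₀ z).det := by
          gcongr
          exact (le_abs_self _).trans (hc' z hz)
      _ ≤ _ := by
          gcongr
          rw [ENNReal.ofReal]
          exact_mod_cast le_max_right _ _

variable [MeasurableSpace X] [BorelSpace X] [IsManifold I ∞ X]

/-- The cells of size `1 / k` near one point `x₀`. They subdivide a fixed parallelepiped of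
coordinates, and on this compact set the metric and the density of the volume are bounded from above
and from below. -/
theorem exists_chartCells_at (hI : IsBoundaryModel I)
    (g : Bundle.ContMDiffRiemannianMetric I ∞ E (fun x : X ↦ TangentSpace I x)) (x₀ : X) :
    ∃ (C : NNReal) (S : Set X), MeasurableSet S ∧ S ∈ 𝓝 x₀ ∧ S ⊆ (extChartAt I x₀).source ∧
      ∀ k : ℕ, k ≠ 0 → ∃ A : (Fin n → Fin k) → Set E,
        (∀ c, IsChartCell g.toRiemannianMetric C k x₀ (A c)) ∧
        ∑ c, cellMeasure I x₀ (A c) ≤ (C : ℝ≥0∞) • chartVolume g.toRiemannianMetric x₀ ∧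
        (chartVolume g.toRiemannianMetric x₀).restrict S ≤
          (C : ℝ≥0∞) • ∑ c, cellMeasure I x₀ (A c) := by
  obtain ⟨L, b, hsub, hnhds⟩ := hI.exists_parallelepiped
    (extChartAt_target_subset_range x₀ (mem_extChartAt_target x₀))
    (extChartAt_target_mem_nhdsWithin (I := I) x₀)
  set K : Set E := (fun t ↦ b + L t) '' Icc 0 1
  set D : Set E := (fun t ↦ b + L t) '' (univ.pi fun _ ↦ Ico 0 1)
  have hKc : IsCompact K := isCompact_Icc.image (by fun_prop)
  have hKt : K ⊆ (extChartAt I x₀).target := hsub.trans inter_subset_left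
  have hDK : D ⊆ K := by
    refine image_mono ?_
    rw [← pi_univ_Icc]
    exact pi_mono fun _ _ ↦ Ico_subset_Icc_self
  have hDm : MeasurableSet D := (L.toHomeomorph.trans
    (Homeomorph.addLeft b)).measurableEmbedding.measurableSet_image.2
      (MeasurableSet.univ_pi fun _ ↦ measurableSet_Ico)
  obtain ⟨C₁, h₁⟩ := exists_chartMetric_le g hKc hKt
  obtain ⟨C₂, h₂⟩ := exists_sqrt_chartGram_det_bounds g hKc hKt
  obtain ⟨C₃, h₃⟩ := exists_subdivision L b
  set C := max C₁ (max C₂ C₃)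
  have hC₁ : C₁ ≤ C := le_max_left _ _
  have hC₂ : C₂ ≤ C := (le_max_left _ _).trans (le_max_right _ _)
  have hC₃ : C₃ ≤ C := (le_max_right _ _).trans (le_max_right _ _)
  have hSm : MeasurableSet ((extChartAt I x₀).source ∩ extChartAt I x₀ ⁻¹' D) := by
    have h4 := (continuousOn_extChartAt (I := I) x₀).domRestrict.measurable hDm
    have h5 := (isOpen_extChartAt_source (I := I) x₀).measurableSet.subtype_image h4
    convert h5 using 1
    ext
    simp [and_comm]
  refine ⟨C, (extChartAt I x₀).source ∩ extChartAt I x₀ ⁻¹' D, hSm, ?_, inter_subset_left,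
    fun k hk ↦ ?_⟩
  · exact inter_mem (extChartAt_source_mem_nhds x₀)
      ((tendsto_nhdsWithin_iff.2 ⟨continuousAt_extChartAt x₀, Eventually.of_forall fun y ↦ by
        simp [extChartAt, OpenPartialHomeomorph.extend]⟩) hnhds)
  · obtain ⟨A, hA, hsum⟩ := h₃ k hk
    have hcell : ∀ c, IsChartCell g.toRiemannianMetric C k x₀ (A c) := by
      intro c
      obtain ⟨a1, a2, a3, a4, a5⟩ := hA c
      refine ⟨a1, a2, a3.trans hKt, fun z hz z' hz' ↦ (a4 z hz z' hz').trans (by gcongr),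
        a5.trans (by gcongr), fun z hz v ↦ (h₁ z (a3 hz) v).trans (by gcongr)⟩
    have hcells : ∀ s, MeasurableSet s → (∑ c, cellMeasure I x₀ (A c)) s =
        volume (((extChartAt I x₀).target ∩ (extChartAt I x₀).symm ⁻¹' s) ∩ D) := by
      intro s hs
      have hm := measurableSet_extChartAt_target_inter_preimage (I := I) x₀ hs
      rw [← Measure.restrict_apply hm, ← hsum, Measure.finsetSum_apply, Measure.finsetSum_apply]
      refine Finset.sum_congr rfl fun c _ ↦ ?_
      rw [cellMeasure_apply (hcell c).subset_target (hcell c).isOpen.measurableSet hs,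
        Measure.restrict_apply hm]
    refine ⟨A, hcell, Measure.le_iff.2 fun s hs ↦ ?_, Measure.le_iff.2 fun s hs ↦ ?_⟩
    · have hm := measurableSet_extChartAt_target_inter_preimage (I := I) x₀ hs
      rw [hcells s hs, Measure.smul_apply, chartVolume_apply _ x₀ hs, smul_eq_mul]
      set Z := (extChartAt I x₀).target ∩ (extChartAt I x₀).symm ⁻¹' s
      calc volume (Z ∩ D) = ∫⁻ z in Z ∩ D, 1 := by simp
        _ ≤ ∫⁻ z in Z ∩ D, C * ENNReal.ofReal √(chartGram g.toRiemannianMetric x₀ z).det :=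
            setLIntegral_mono_ae' (hm.inter hDm) (Eventually.of_forall fun z hz ↦
              (h₂ z (hDK hz.2)).2.trans (by gcongr))
        _ ≤ ∫⁻ z in Z, C * ENNReal.ofReal √(chartGram g.toRiemannianMetric x₀ z).det :=
            lintegral_mono_set inter_subset_left
        _ = _ := lintegral_const_mul' _ _ (by simp)
    · rw [Measure.smul_apply, hcells s hs, Measure.restrict_apply hs,
        chartVolume_apply _ x₀ (hs.inter hSm), smul_eq_mul]
      set Z := (extChartAt I x₀).target ∩ (extChartAt I x₀).symm ⁻¹' s
      have hm : MeasurableSet Z := measurableSet_extChartAt_target_inter_preimage (I := I) x₀ hs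
      have hset : (extChartAt I x₀).target ∩ (extChartAt I x₀).symm ⁻¹'
          (s ∩ ((extChartAt I x₀).source ∩ extChartAt I x₀ ⁻¹' D)) ⊆ Z ∩ D := by
        rintro z ⟨hz1, hz2, hz3, hz4⟩
        refine ⟨⟨hz1, hz2⟩, ?_⟩
        rw [mem_preimage, (extChartAt I x₀).right_inv hz1] at hz4
        exact hz4
      calc _ ≤ ∫⁻ z in Z ∩ D, ENNReal.ofReal √(chartGram g.toRiemannianMetric x₀ z).det :=
            lintegral_mono_set hset
        _ ≤ ∫⁻ z in Z ∩ D, C := setLIntegral_mono_ae' (hm.inter hDm)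
            (Eventually.of_forall fun z hz ↦ (h₂ z (hDK hz.2)).1.trans (by gcongr))
        _ = _ := setLIntegral_const _ _

/-- A compact Riemannian manifold is covered, up to null sets, by images of cells of size `1 / k`,
with constants and multiplicities that do not depend on `k`. -/
theorem exists_chartCells [CompactSpace X] (hI : IsBoundaryModel I)
    (g : Bundle.ContMDiffRiemannianMetric I ∞ E (fun x : X ↦ TangentSpace I x)) :
    ∃ C : NNReal, ∀ k : ℕ, k ≠ 0 → ∃ (ι : Type u) (_ : Fintype ι) (x : ι → X) (A : ι → Set E),
      (∀ i, IsChartCell g.toRiemannianMetric C k (x i) (A i)) ∧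
      ∑ i, cellMeasure I (x i) (A i) ≤ (C : ℝ≥0∞) • riemannianVolume g.toRiemannianMetric ∧
      riemannianVolume g.toRiemannianMetric ≤
        (C : ℝ≥0∞) • ∑ i, cellMeasure I (x i) (A i) := by
  choose C S hSm hSn hSs hcells using exists_chartCells_at hI g
  obtain ⟨t, ht⟩ := CompactSpace.elim_nhds_subcover S hSn
  set C' : NNReal := ∑ x ∈ t, C x with hC'
  have hCC' : ∀ x ∈ t, C x ≤ C' := fun x hx ↦ Finset.single_le_sum (fun _ _ ↦ zero_le) hx
  refine ⟨C', fun k hk ↦ ?_⟩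
  choose A hA hle hge using fun x ↦ hcells x k hk
  have hsum : ∑ i : {x // x ∈ t} × (Fin n → Fin k), cellMeasure I (i.1 : X) (A i.1 i.2) =
      ∑ x ∈ t, ∑ c, cellMeasure I x (A x c) := by
    rw [Fintype.sum_prod_type]
    exact Finset.sum_coe_sort t fun x ↦ ∑ c, cellMeasure I x (A x c)
  refine ⟨{x // x ∈ t} × (Fin n → Fin k), inferInstance, fun i ↦ i.1, fun i ↦ A i.1 i.2,
    fun i ↦ (hA _ _).mono (hCC' _ i.1.2), ?_, ?_⟩
  · rw [hsum]
    calc ∑ x ∈ t, ∑ c, cellMeasure I x (A x c)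
        ≤ ∑ x ∈ t, (C x : ℝ≥0∞) • riemannianVolume g.toRiemannianMetric :=
          Finset.sum_le_sum fun x _ ↦ (hle x).trans
            (by gcongr; exact le_iSup (fun x ↦ chartVolume g.toRiemannianMetric x) x)
      _ = _ := by
          rw [← Finset.sum_smul, hC']
          push_cast
          rfl
  · rw [hsum]
    refine iSup_le fun x' ↦ Measure.le_iff.2 fun s hs ↦ ?_
    calc chartVolume g.toRiemannianMetric x' s
        ≤ ∑ x ∈ t, chartVolume g.toRiemannianMetric x' (s ∩ S x) := by
          refine (measure_mono ?_).trans (measure_biUnion_finset_le t _)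
          rw [← inter_iUnion₂, ht]
          simp
      _ ≤ ∑ x ∈ t, C' * (∑ c, cellMeasure I x (A x c)) s := by
          refine Finset.sum_le_sum fun x hx ↦ ?_
          have h1 := chartVolume_restrict_source_le g.toRiemannianMetric x' x (s ∩ S x)
          rw [Measure.restrict_apply (hs.inter (hSm x)), inter_assoc,
            inter_eq_left.2 (hSs x)] at h1
          have h2 := hge x s
          rw [Measure.restrict_apply hs, Measure.smul_apply, smul_eq_mul] at h2
          exact h1.trans (h2.trans (by gcongr; exact hCC' x hx))
      _ = _ := by
          rw [Measure.smul_apply, Measure.finsetSum_apply, smul_eq_mul, Finset.mul_sum]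

end Cells

/-! ### The Morrey estimate on a product of cells -/

section ProductChart

variable {E F : Type*} [NormedAddCommGroup E] [NormedSpace ℝ E]
  [NormedAddCommGroup F] [NormedSpace ℝ F]
  {H K : Type*} [TopologicalSpace H] [TopologicalSpace K]
  {I : ModelWithCorners ℝ E H} {J : ModelWithCorners ℝ F K}
  {M N : Type*} [TopologicalSpace M] [ChartedSpace H M] [TopologicalSpace N] [ChartedSpace K N]
  [IsManifold I ∞ M] [IsManifold J ∞ N]

/-- The product chart maps the first component `v.1` of a coordinate vector to the first component
of the tangent vector. The equation lives in `E`, since the two sides have tangent spaces at points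
that agree only propositionally as their types. -/
theorem tangentFst_chartFrame {x₀ : M} {y₀ : N} {q : E × F}
    (hq : q ∈ (extChartAt I x₀).target ×ˢ (extChartAt J y₀).target) (v : E × F) :
    (tangentFst (I := I) (J := J) ((extChartAt (I.prod J) (x₀, y₀)).symm q)
      (chartFrame (I.prod J) (x₀, y₀) q v) : E) = (chartFrame I x₀ q.1 v.1 : E) := by
  have hq' : q ∈ (extChartAt (I.prod J) (x₀, y₀)).target := by
    rw [extChartAt_prod]
    exact hq
  have hqr := extChartAt_target_subset_range _ hq'
  have hu : UniqueMDiffWithinAt 𝓘(ℝ, E × F) (range (I.prod J)) q :=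
    ((I.prod J).uniqueDiffOn q hqr).uniqueMDiffWithinAt
  have hΦ := mdifferentiableWithinAt_extChartAt_symm hq'
  have h1 : HasMFDerivWithinAt 𝓘(ℝ, E × F) I (Prod.fst ∘ (extChartAt (I.prod J) (x₀, y₀)).symm)
      (range (I.prod J)) q _ :=
    (hasMFDerivAt_fst (I := I) (I' := J)
      ((extChartAt (I.prod J) (x₀, y₀)).symm q)).comp_hasMFDerivWithinAt q hΦ.hasMFDerivWithinAt
  have h2 : HasMFDerivWithinAt 𝓘(ℝ, E × F) I ((extChartAt I x₀).symm ∘ Prod.fst)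
      (range (I.prod J)) q _ :=
    (mdifferentiableWithinAt_extChartAt_symm (I := I) hq.1).hasMFDerivWithinAt.comp q
      (hasFDerivAt_fst (𝕜 := ℝ) (p := q)).hasMFDerivAt.hasMFDerivWithinAt
      fun y hy ↦ by rw [ModelWithCorners.range_prod] at hy; exact hy.1
  have h3 := hu.eq h1 h2
  exact congrArg (fun L : (E × F) →L[ℝ] E ↦ L v) h3

theorem tangentSnd_chartFrame {x₀ : M} {y₀ : N} {q : E × F}
    (hq : q ∈ (extChartAt I x₀).target ×ˢ (extChartAt J y₀).target) (v : E × F) :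
    (tangentSnd (I := I) (J := J) ((extChartAt (I.prod J) (x₀, y₀)).symm q)
      (chartFrame (I.prod J) (x₀, y₀) q v) : F) = (chartFrame J y₀ q.2 v.2 : F) := by
  have hq' : q ∈ (extChartAt (I.prod J) (x₀, y₀)).target := by
    rw [extChartAt_prod]
    exact hq
  have hqr := extChartAt_target_subset_range _ hq'
  have hu : UniqueMDiffWithinAt 𝓘(ℝ, E × F) (range (I.prod J)) q :=
    ((I.prod J).uniqueDiffOn q hqr).uniqueMDiffWithinAt
  have hΦ := mdifferentiableWithinAt_extChartAt_symm hq'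
  have h1 : HasMFDerivWithinAt 𝓘(ℝ, E × F) J (Prod.snd ∘ (extChartAt (I.prod J) (x₀, y₀)).symm)
      (range (I.prod J)) q _ :=
    (hasMFDerivAt_snd (I := I) (I' := J)
      ((extChartAt (I.prod J) (x₀, y₀)).symm q)).comp_hasMFDerivWithinAt q hΦ.hasMFDerivWithinAt
  have h2 : HasMFDerivWithinAt 𝓘(ℝ, E × F) J ((extChartAt J y₀).symm ∘ Prod.snd)
      (range (I.prod J)) q _ :=
    (mdifferentiableWithinAt_extChartAt_symm (I := J) hq.2).hasMFDerivWithinAt.comp q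
      (hasFDerivAt_snd (𝕜 := ℝ) (p := q)).hasMFDerivAt.hasMFDerivWithinAt
      fun y hy ↦ by rw [ModelWithCorners.range_prod] at hy; exact hy.2
  have h3 := hu.eq h1 h2
  exact congrArg (fun L : (E × F) →L[ℝ] F ↦ L v) h3

theorem prodMetric_chartFrame (g : Bundle.RiemannianMetric (fun x : M ↦ TangentSpace I x))
    (h : Bundle.RiemannianMetric (fun y : N ↦ TangentSpace J y)) {x₀ : M} {y₀ : N} {q : E × F}
    (hq : q ∈ (extChartAt I x₀).target ×ˢ (extChartAt J y₀).target) (v : E × F) :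
    (prodMetric g h).inner ((extChartAt (I.prod J) (x₀, y₀)).symm q)
        (chartFrame (I.prod J) (x₀, y₀) q v) (chartFrame (I.prod J) (x₀, y₀) q v) =
      g.inner ((extChartAt I x₀).symm q.1) (chartFrame I x₀ q.1 v.1) (chartFrame I x₀ q.1 v.1) +
      h.inner ((extChartAt J y₀).symm q.2) (chartFrame J y₀ q.2 v.2)
        (chartFrame J y₀ q.2 v.2) := by
  have h1 := tangentFst_chartFrame hq v
  have h2 := tangentSnd_chartFrame hq v
  have h3 := congrArg (fun a : E ↦ (g.inner ((extChartAt I x₀).symm q.1) : E →L[ℝ] E →L[ℝ] ℝ) a a)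
    h1
  have h4 := congrArg (fun a : F ↦ (h.inner ((extChartAt J y₀).symm q.2) : F →L[ℝ] F →L[ℝ] ℝ) a a)
    h2
  exact congrArg₂ (· + ·) h3 h4

end ProductChart

theorem enorm_apply_le_covectorNorm {E : Type*} [NormedAddCommGroup E] [NormedSpace ℝ E]
    {H : Type*} [TopologicalSpace H] {I : ModelWithCorners ℝ E H}
    {X : Type*} [TopologicalSpace X] [ChartedSpace H X]
    (g : Bundle.RiemannianMetric (fun x : X ↦ TangentSpace I x)) {x : X}
    (η : TangentSpace I x →L[ℝ] ℝ) {v : TangentSpace I x} {r : ℝ} (hr : 0 < r)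
    (hv : g.inner x v v ≤ r ^ 2) : ‖η v‖ₑ ≤ ENNReal.ofReal r * covectorNorm g x η := by
  have h1 : g.inner x (r⁻¹ • v) (r⁻¹ • v) ≤ 1 := by
    simp only [map_smul, smul_apply, smul_eq_mul]
    rw [← mul_assoc, ← mul_inv, ← sq, inv_mul_le_iff₀ (by positivity), mul_one]
    exact hv
  have h2 : ‖η (r⁻¹ • v)‖ₑ ≤ covectorNorm g x η := le_iSup₂_of_le (r⁻¹ • v) h1 le_rfl
  calc ‖η v‖ₑ = ‖r • η (r⁻¹ • v)‖ₑ := by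
        rw [← map_smul, smul_smul, mul_inv_cancel₀ hr.ne', one_smul]
    _ = ENNReal.ofReal r * ‖η (r⁻¹ • v)‖ₑ := by
        rw [enorm_smul, Real.enorm_of_nonneg hr.le]
    _ ≤ _ := by gcongr

section CellEstimate

variable {m n : ℕ} {H K : Type*} [TopologicalSpace H] [TopologicalSpace K]
  {I : ModelWithCorners ℝ (EuclideanSpace ℝ (Fin m)) H}
  {J : ModelWithCorners ℝ (EuclideanSpace ℝ (Fin n)) K}
  {M N : Type*} [TopologicalSpace M] [ChartedSpace H M] [IsManifold I ∞ M]
  [TopologicalSpace N] [ChartedSpace K N] [IsManifold J ∞ N]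
  {g : Bundle.RiemannianMetric (fun x : M ↦ TangentSpace I x)}
  {h : Bundle.RiemannianMetric (fun y : N ↦ TangentSpace J y)}

/-- On a product of cells the operator norm of a covector, with respect to the coordinates, is
controlled by its norm with respect to the product metric. -/
theorem enorm_chartForm_le {C : NNReal} (hC : 0 < C) {k : ℕ} {x₀ : M} {y₀ : N}
    {A : Set (EuclideanSpace ℝ (Fin m))} {B : Set (EuclideanSpace ℝ (Fin n))}
    (hA : IsChartCell g C k x₀ A) (hB : IsChartCell h C k y₀ B)
    (η : ∀ q : M × N, TangentSpace (I.prod J) q →L[ℝ] ℝ)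
    {z : EuclideanSpace ℝ (Fin m) × EuclideanSpace ℝ (Fin n)} (hz : z ∈ A ×ˢ B) :
    ‖chartForm (I.prod J) η (x₀, y₀) z‖ₑ ≤ (2 * C : NNReal) *
      covectorNorm (prodMetric g h) ((extChartAt (I.prod J) (x₀, y₀)).symm z)
        (η ((extChartAt (I.prod J) (x₀, y₀)).symm z)) := by
  set c := covectorNorm (prodMetric g h) ((extChartAt (I.prod J) (x₀, y₀)).symm z)
        (η ((extChartAt (I.prod J) (x₀, y₀)).symm z))
  have hzt : z ∈ (extChartAt I x₀).target ×ˢ (extChartAt J y₀).target :=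
    ⟨hA.subset_target hz.1, hB.subset_target hz.2⟩
  have key : ∀ v, v ≠ 0 → ‖chartForm (I.prod J) η (x₀, y₀) z v‖ₑ ≤
      ENNReal.ofReal (2 * C * ‖v‖) * c := by
    intro v hv
    have hv0 : 0 < ‖v‖ := norm_pos_iff.2 hv
    refine enorm_apply_le_covectorNorm (prodMetric g h) _ (by positivity) ?_
    refine (prodMetric_chartFrame g h hzt v).le.trans ?_
    have h1 := hA.metric_le z.1 hz.1 v.1
    have h2 := hB.metric_le z.2 hz.2 v.2
    rw [chartMetric_apply] at h1 h2
    have h3 : ‖v.1‖ ≤ ‖v‖ := norm_fst_le v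
    have h4 : ‖v.2‖ ≤ ‖v‖ := norm_snd_le v
    calc _ ≤ (C : ℝ) ^ 2 * ‖v.1‖ ^ 2 + C ^ 2 * ‖v.2‖ ^ 2 := add_le_add h1 h2
      _ ≤ (C : ℝ) ^ 2 * ‖v‖ ^ 2 + C ^ 2 * ‖v‖ ^ 2 := by gcongr
      _ ≤ (2 * C * ‖v‖) ^ 2 := by nlinarith [sq_nonneg ((C : ℝ) * ‖v‖)]
  rcases eq_or_ne c ⊤ with hct | hct
  · rw [hct, ENNReal.mul_top (by simpa using hC.ne')]
    exact le_top
  · have h5 : ‖chartForm (I.prod J) η (x₀, y₀) z‖ ≤ 2 * C * c.toReal := by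
      refine ContinuousLinearMap.opNorm_le_bound _ (by positivity) fun v ↦ ?_
      rcases eq_or_ne v 0 with rfl | hv
      · simp
      have h6 := ENNReal.toReal_mono (ENNReal.mul_ne_top ENNReal.ofReal_ne_top hct) (key v hv)
      rw [ENNReal.toReal_mul, ENNReal.toReal_ofReal (by positivity), toReal_enorm] at h6
      linarith
    rw [← ofReal_norm, ← ENNReal.ofReal_toReal hct]
    refine (ENNReal.ofReal_le_ofReal h5).trans (le_of_eq ?_)
    rw [ENNReal.ofReal_mul (by positivity)]
    congr 1
    rw [← NNReal.coe_ofNat, ← NNReal.coe_mul, ENNReal.ofReal_coe_nnreal]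

theorem lintegral_lt_top_of_rpow {X : Type*} [MeasurableSpace X] {μ : Measure X}
    [IsFiniteMeasure μ] {q : ℝ} (hq : 1 ≤ q) {a : X → ℝ≥0∞} (ha : AEMeasurable a μ)
    (h : ∫⁻ x, a x ^ q ∂μ < ⊤) : ∫⁻ x, a x ∂μ < ⊤ := by
  have h1 := (rpow_lintegral_le hq ha).trans_lt (ENNReal.mul_lt_top h
    (ENNReal.rpow_lt_top_of_nonneg (by linarith : 0 ≤ q - 1) (measure_ne_top μ univ)))
  exact (ENNReal.rpow_lt_top_iff_of_pos (by linarith)).1 h1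

variable [MeasurableSpace M] [BorelSpace M] [MeasurableSpace N] [BorelSpace N]

/-- The Morrey estimate on the product of two cells, with respect to the images of the Lebesgue
measures. Here `b` is the exponent of the parametrization of the segments. -/
theorem ae_lintegral_cell_sub_le {C : NNReal} (hC : 0 < C) {k : ℕ} (hk : k ≠ 0) {x₀ : M} {y₀ : N}
    {A : Set (EuclideanSpace ℝ (Fin m))} {B : Set (EuclideanSpace ℝ (Fin n))}
    (hA : IsChartCell g C k x₀ A) (hB : IsChartCell h C k y₀ B)
    {q : ℝ} (hq : 1 ≤ q) {b : ℕ} (hb : b ≠ 0) (hbq : (b * m : ℕ) ≤ ((b - 1 : ℕ) : ℝ) * q)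
    {u w : M × N → ℝ} (hu : Measurable u)
    (hw : w =ᵐ[(cellMeasure I x₀ A).prod (cellMeasure J y₀ B)] u)
    {η : ∀ q : M × N, TangentSpace (I.prod J) q →L[ℝ] ℝ} (hη : HasWeakDifferential w η)
    {G : M × N → ℝ≥0∞} (hG : Measurable G)
    (hηG : ∀ᵐ q ∂((cellMeasure I x₀ A).prod (cellMeasure J y₀ B)),
      covectorNorm (prodMetric g h) q (η q) ≤ G q)
    (huq : ∫⁻ z, ‖u z‖ₑ ^ q ∂((cellMeasure I x₀ A).prod (cellMeasure J y₀ B)) < ⊤)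
    (hGq : ∫⁻ z, G z ^ q ∂((cellMeasure I x₀ A).prod (cellMeasure J y₀ B)) < ⊤) :
    ∀ᵐ x ∂(cellMeasure I x₀ A), ∫⁻ y, ∫⁻ z, ‖u (x, y) - u z‖ₑ ^ q
        ∂((cellMeasure I x₀ A).prod (cellMeasure J y₀ B)) ∂(cellMeasure J y₀ B) ≤
      (C / k : ℝ≥0∞) ^ q * ((b : ℝ≥0∞) ^ q * (2 ^ n * volume B * ((2 * C : NNReal) ^ q *
        ∫⁻ z, G z ^ q ∂((cellMeasure I x₀ A).prod (cellMeasure J y₀ B))))) := by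
  have hq0 : 0 ≤ q := by linarith
  have haΦ := aemeasurable_extChartAt_symm hA.subset_target
  have haΨ := aemeasurable_extChartAt_symm hB.subset_target
  set Φ := haΦ.mk
  set Ψ := haΨ.mk
  have hΦ : Measurable Φ := haΦ.measurable_mk
  have hΨ : Measurable Ψ := haΨ.measurable_mk
  have eΦ : (extChartAt I x₀).symm =ᵐ[volume.restrict A] Φ := haΦ.ae_eq_mk
  have eΨ : (extChartAt J y₀).symm =ᵐ[volume.restrict B] Ψ := haΨ.ae_eq_mk
  have hα : cellMeasure I x₀ A = (volume.restrict A).map Φ := Measure.map_congr eΦ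
  have hβ : cellMeasure J y₀ B = (volume.restrict B).map Ψ := Measure.map_congr eΨ
  have : IsFiniteMeasure (volume.restrict A) := isFiniteMeasure_restrict.2 (hA.volume_lt_top hk).ne
  have : IsFiniteMeasure (volume.restrict B) := isFiniteMeasure_restrict.2 (hB.volume_lt_top hk).ne
  have hU : IsOpen (A ×ˢ B) := hA.isOpen.prod hB.isOpen
  set V : Measure (EuclideanSpace ℝ (Fin m) × EuclideanSpace ℝ (Fin n)) :=
    volume.restrict (A ×ˢ B)
  have hVp : V = (volume.restrict A).prod (volume.restrict B) := (Measure.prod_restrict A B).symm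
  have : IsFiniteMeasure V := by rw [hVp]; infer_instance
  set P := Prod.map Φ Ψ
  have hPm : Measurable P := hΦ.prodMap hΨ
  have hπ : (cellMeasure I x₀ A).prod (cellMeasure J y₀ B) = V.map P := by
    rw [hα, hβ, hVp, Measure.map_prod_map _ _ hΦ hΨ]
  rw [hπ] at huq hGq hw hηG ⊢
  rw [lintegral_map (hu.enorm.pow_const q) hPm] at huq
  rw [lintegral_map (hG.pow_const q) hPm] at hGq ⊢
  have ePA : ∀ᵐ z ∂V, z ∈ A ×ˢ B ∧ (extChartAt (I.prod J) (x₀, y₀)).symm z = P z := by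
    have h1 : ∀ᵐ z ∂V, (extChartAt I x₀).symm z.1 = Φ z.1 := by
      rw [hVp]
      exact Measure.quasiMeasurePreserving_fst.ae eΦ
    have h2 : ∀ᵐ z ∂V, (extChartAt J y₀).symm z.2 = Ψ z.2 := by
      rw [hVp]
      exact Measure.quasiMeasurePreserving_snd.ae eΨ
    filter_upwards [ae_restrict_mem hU.measurableSet, h1, h2] with z hz h3 h4
    refine ⟨hz, ?_⟩
    rw [extChartAt_prod]
    exact Prod.ext h3 h4
  have hUt : A ×ˢ B ⊆ interior (extChartAt (I.prod J) (x₀, y₀)).target := by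
    refine interior_maximal ?_ hU
    rw [extChartAt_prod]
    exact prod_mono hA.subset_target hB.subset_target
  set f' := chartForm (I.prod J) η (x₀, y₀)
  have hweak := (hη (x₀, y₀)).mono hUt isOpen_interior.measurableSet
  have hf'm : AEStronglyMeasurable f' V := hweak.2.aestronglyMeasurable
  have hf'G : ∀ᵐ z ∂V, ‖f' z‖ₑ ≤ (2 * C : NNReal) * G (P z) := by
    filter_upwards [ePA, ae_of_ae_map hPm.aemeasurable hηG] with z hz hGz
    refine (enorm_chartForm_le hC hA hB η hz.1).trans ?_
    gcongr
    rw [hz.2]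
    exact hGz
  have hf'q : ∫⁻ z, ‖f' z‖ₑ ^ q ∂V ≤ (2 * C : NNReal) ^ q * ∫⁻ z, G (P z) ^ q ∂V := by
    have hm : Measurable fun z ↦ G (P z) ^ q := (hG.comp hPm).pow_const q
    rw [← lintegral_const_mul _ hm]
    refine lintegral_mono_ae ?_
    filter_upwards [hf'G] with z hz
    rw [← ENNReal.mul_rpow_of_nonneg _ _ hq0]
    exact ENNReal.rpow_le_rpow hz hq0
  have hf'i : Integrable f' V := ⟨hf'm, lintegral_lt_top_of_rpow hq hf'm.enorm
    (hf'q.trans_lt (ENNReal.mul_lt_top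
      (ENNReal.rpow_lt_top_of_nonneg hq0 ENNReal.coe_ne_top) hGq))⟩
  have hfi : Integrable (u ∘ P) V := ⟨(hu.comp hPm).aestronglyMeasurable,
    lintegral_lt_top_of_rpow hq (hu.comp hPm).enorm.aemeasurable huq⟩
  have hfw : w ∘ (extChartAt (I.prod J) (x₀, y₀)).symm =ᵐ[V] u ∘ P := by
    filter_upwards [ePA, ae_of_ae_map hPm.aemeasurable hw] with z hz hwz
    simp only [Function.comp, hz.2, hwz]
  have hfi' : IntegrableOn (u ∘ P) (A ×ˢ B) := hfi
  have hweak' : HasWeakFDerivOn (u ∘ P) f' (A ×ˢ B) :=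
    hweak.congr_ae hfw (ae_eq_refl _) hfi'.locallyIntegrableOn hweak.2
  have main := hweak'.ae_lintegral_slice_sub_le hA.convex hA.isOpen hB.convex hB.isOpen hfi hf'i
    (ENNReal.div_ne_top ENNReal.coe_ne_top (by exact_mod_cast hk)) hA.enorm_sub_le hB.enorm_sub_le
    hb hq (by rwa [finrank_euclideanSpace_fin])
  rw [finrank_euclideanSpace_fin] at main
  have hLm : Measurable fun x ↦ ∫⁻ y, ∫⁻ z, ‖u (x, y) - u z‖ₑ ^ q ∂(V.map P)
      ∂(cellMeasure J y₀ B) := by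
    have : IsFiniteMeasure (cellMeasure J y₀ B) := by rw [hβ]; infer_instance
    refine Measurable.lintegral_prod_right' (f := fun r : M × N ↦
      ∫⁻ z, ‖u r - u z‖ₑ ^ q ∂(V.map P)) ?_
    refine Measurable.lintegral_prod_right' (f := fun r : (M × N) × (M × N) ↦
      ‖u r.1 - u r.2‖ₑ ^ q) ?_
    exact ((hu.comp measurable_fst).sub (hu.comp measurable_snd)).enorm.pow_const q
  rw [hα, ae_map_iff hΦ.aemeasurable (measurableSet_le hLm measurable_const)]
  filter_upwards [main] with x hx
  have h1 : Measurable fun y ↦ ∫⁻ z, ‖u (Φ x, y) - u z‖ₑ ^ q ∂(V.map P) := by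
    refine Measurable.lintegral_prod_right' (f := fun r : N × (M × N) ↦
      ‖u (Φ x, r.1) - u r.2‖ₑ ^ q) ?_
    exact ((hu.comp (by fun_prop)).sub (hu.comp measurable_snd)).enorm.pow_const q
  rw [hβ, lintegral_map h1 hΨ]
  have h2 : ∀ y, ∫⁻ z, ‖u (Φ x, Ψ y) - u z‖ₑ ^ q ∂(V.map P) =
      ∫⁻ z, ‖(u ∘ P) (x, y) - (u ∘ P) z‖ₑ ^ q ∂V := fun y ↦
    lintegral_map ((measurable_const.sub hu).enorm.pow_const q) hPm
  simp only [h2]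
  refine hx.trans ?_
  gcongr

end CellEstimate

/-! ### The estimate of almost every slice -/

/-- If `v` is close to the values of `w` on average, then `v` is controlled by the distance and by
the mean value of `w`. -/
theorem lintegral_rpow_enorm_le_of_lintegral_sub_le {Y Z : Type*} [MeasurableSpace Y]
    [MeasurableSpace Z] {β : Measure Y} {π : Measure Z} [IsFiniteMeasure π] (hπ : π univ ≠ 0)
    {v : Y → ℝ} {w : Z → ℝ} (hw : Measurable w) (hwi : Integrable w π)
    {q : ℝ} (hq : 1 ≤ q) {R : ℝ≥0∞} (hR : ∫⁻ y, ∫⁻ z, ‖v y - w z‖ₑ ^ q ∂π ∂β ≤ R) :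
    ∫⁻ y, ‖v y‖ₑ ^ q ∂β ≤
      2 ^ (q - 1) * ((π univ)⁻¹ * R + ((π univ)⁻¹ * ‖∫ z, w z ∂π‖ₑ) ^ q * β univ) := by
  have hq0 : 0 ≤ q := by linarith
  have hπt : π univ ≠ ⊤ := measure_ne_top _ _
  have hmean : ∀ y, ‖v y‖ₑ ≤
      (π univ)⁻¹ * ∫⁻ z, ‖v y - w z‖ₑ ∂π + (π univ)⁻¹ * ‖∫ z, w z ∂π‖ₑ := by
    intro y
    have h1 : π.real univ • v y = ∫ z, (v y - w z) ∂π + ∫ z, w z ∂π := by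
      rw [integral_sub (integrable_const _) hwi, integral_const]
      ring
    have h2 : π univ * ‖v y‖ₑ ≤ ∫⁻ z, ‖v y - w z‖ₑ ∂π + ‖∫ z, w z ∂π‖ₑ := by
      calc π univ * ‖v y‖ₑ = ‖π.real univ • v y‖ₑ := by
            rw [enorm_smul, Real.enorm_of_nonneg measureReal_nonneg, ofReal_measureReal hπt]
        _ ≤ _ := by
            rw [h1]
            refine (enorm_add_le _ _).trans ?_
            gcongr
            exact enorm_integral_le_lintegral_enorm _
    calc ‖v y‖ₑ = (π univ)⁻¹ * (π univ * ‖v y‖ₑ) := by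
          rw [← mul_assoc, ENNReal.inv_mul_cancel hπ hπt, one_mul]
      _ ≤ _ := by
          rw [← mul_add]
          gcongr
  have hpt : ∀ y, ‖v y‖ₑ ^ q ≤ 2 ^ (q - 1) *
      ((π univ)⁻¹ * ∫⁻ z, ‖v y - w z‖ₑ ^ q ∂π + ((π univ)⁻¹ * ‖∫ z, w z ∂π‖ₑ) ^ q) := by
    intro y
    refine ((ENNReal.rpow_le_rpow (hmean y) hq0).trans
      (ENNReal.rpow_add_le_mul_rpow_add_rpow _ _ hq)).trans ?_
    gcongr
    rw [ENNReal.mul_rpow_of_nonneg _ _ hq0]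
    calc (π univ)⁻¹ ^ q * (∫⁻ z, ‖v y - w z‖ₑ ∂π) ^ q
        ≤ (π univ)⁻¹ ^ q * ((∫⁻ z, ‖v y - w z‖ₑ ^ q ∂π) * π univ ^ (q - 1)) := by
          gcongr
          exact rpow_lintegral_le hq (measurable_const.sub hw).enorm.aemeasurable
      _ = _ := by
          have h3 : (π univ)⁻¹ ^ q * π univ ^ (q - 1) = (π univ)⁻¹ := by
            rw [ENNReal.inv_rpow, ← ENNReal.rpow_neg, ← ENNReal.rpow_add _ _ hπ hπt,
              ← ENNReal.rpow_neg_one]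
            congr 1
            ring
          rw [mul_comm (∫⁻ z, ‖v y - w z‖ₑ ^ q ∂π), ← mul_assoc, h3]
  calc ∫⁻ y, ‖v y‖ₑ ^ q ∂β ≤ ∫⁻ y, 2 ^ (q - 1) *
      ((π univ)⁻¹ * ∫⁻ z, ‖v y - w z‖ₑ ^ q ∂π + ((π univ)⁻¹ * ‖∫ z, w z ∂π‖ₑ) ^ q) ∂β :=
        lintegral_mono hpt
    _ = 2 ^ (q - 1) * ((π univ)⁻¹ * ∫⁻ y, ∫⁻ z, ‖v y - w z‖ₑ ^ q ∂π ∂β +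
          ((π univ)⁻¹ * ‖∫ z, w z ∂π‖ₑ) ^ q * β univ) := by
        rw [lintegral_const_mul' _ _ (ENNReal.rpow_ne_top_of_nonneg (by linarith) (by simp)),
          lintegral_add_right _ measurable_const, lintegral_const,
          lintegral_const_mul' _ _ (ENNReal.inv_ne_top.2 hπ)]
    _ ≤ _ := by gcongr

section Ehrling

universe u v

variable {m n : ℕ} {H K : Type*} [TopologicalSpace H] [TopologicalSpace K]
  {I : ModelWithCorners ℝ (EuclideanSpace ℝ (Fin m)) H}
  {J : ModelWithCorners ℝ (EuclideanSpace ℝ (Fin n)) K}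
  {M : Type u} {N : Type v} [TopologicalSpace M] [ChartedSpace H M] [IsManifold I ∞ M]
  [CompactSpace M] [MeasurableSpace M] [BorelSpace M]
  [TopologicalSpace N] [ChartedSpace K N] [IsManifold J ∞ N]
  [CompactSpace N] [MeasurableSpace N] [BorelSpace N]

theorem isFiniteMeasure_riemannianVolume (hI : IsBoundaryModel I)
    (g : Bundle.ContMDiffRiemannianMetric I ∞ (EuclideanSpace ℝ (Fin m))
      (fun x : M ↦ TangentSpace I x)) :
    IsFiniteMeasure (riemannianVolume g.toRiemannianMetric) := by
  obtain ⟨C, hC⟩ := exists_chartCells hI g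
  obtain ⟨ι, _, x, A, hA, -, hle⟩ := hC 1 one_ne_zero
  refine ⟨(hle univ).trans_lt ?_⟩
  rw [Measure.smul_apply, Measure.finsetSum_apply, smul_eq_mul]
  refine ENNReal.mul_lt_top ENNReal.coe_lt_top (ENNReal.sum_lt_top.2 fun i _ ↦ ?_)
  rw [cellMeasure_univ (hA i).subset_target]
  exact (hA i).volume_lt_top one_ne_zero

/-- The basic inequality. The first term on the right has a small factor if `k` is large, since
`m < q`; the second one depends on finitely many linear functionals of `u` only. -/
theorem exists_ae_lintegral_slice_le (hI : IsBoundaryModel I) (hJ : IsBoundaryModel J)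
    (g : Bundle.ContMDiffRiemannianMetric I ∞ (EuclideanSpace ℝ (Fin m))
      (fun x : M ↦ TangentSpace I x))
    (h : Bundle.ContMDiffRiemannianMetric J ∞ (EuclideanSpace ℝ (Fin n))
      (fun y : N ↦ TangentSpace J y)) {q : ℝ} (hq : 1 ≤ q) (hmq : (m : ℝ) < q) :
    ∃ Θ : ℝ≥0∞, Θ ≠ ⊤ ∧ ∀ k : ℕ, k ≠ 0 →
      ∃ (ι : Type (max u v)) (_ : Fintype ι) (π : ι → Measure (M × N)) (Θ' : ℝ≥0∞), Θ' ≠ ⊤ ∧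
        (∀ i, π i ≤ Θ' • ((riemannianVolume g.toRiemannianMetric).prod
          (riemannianVolume h.toRiemannianMetric))) ∧
        ∀ (u w : M × N → ℝ) (η : ∀ q : M × N, TangentSpace (I.prod J) q →L[ℝ] ℝ)
          (G : M × N → ℝ≥0∞), Measurable u →
          w =ᵐ[(riemannianVolume g.toRiemannianMetric).prod
            (riemannianVolume h.toRiemannianMetric)] u →
          HasWeakDifferential w η → Measurable G →
          (∀ᵐ q ∂((riemannianVolume g.toRiemannianMetric).prod
              (riemannianVolume h.toRiemannianMetric)),
            covectorNorm (prodMetric g.toRiemannianMetric h.toRiemannianMetric) q (η q) ≤ G q) →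
          ∫⁻ z, ‖u z‖ₑ ^ q ∂((riemannianVolume g.toRiemannianMetric).prod
            (riemannianVolume h.toRiemannianMetric)) < ⊤ →
          ∫⁻ z, G z ^ q ∂((riemannianVolume g.toRiemannianMetric).prod
            (riemannianVolume h.toRiemannianMetric)) < ⊤ →
          ∀ᵐ x ∂(riemannianVolume g.toRiemannianMetric),
            ∫⁻ y, ‖u (x, y)‖ₑ ^ q ∂(riemannianVolume h.toRiemannianMetric) ≤
              Θ * ((k : ℝ≥0∞) ^ m / (k : ℝ≥0∞) ^ q) *
                ∫⁻ z, G z ^ q ∂((riemannianVolume g.toRiemannianMetric).prod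
                  (riemannianVolume h.toRiemannianMetric)) +
              Θ' * ∑ i, ‖∫ z, u z ∂(π i)‖ₑ ^ q := by
  have hq0 : 0 ≤ q := by linarith
  have hfμ := isFiniteMeasure_riemannianVolume hI g
  have hfν := isFiniteMeasure_riemannianVolume hJ h
  obtain ⟨C₁, hC₁⟩ := exists_chartCells hI g
  obtain ⟨C₂, hC₂⟩ := exists_chartCells hJ h
  set μ := riemannianVolume g.toRiemannianMetric
  set ν := riemannianVolume h.toRiemannianMetric
  set C : NNReal := max C₁ C₂ + 1
  have hC0 : 0 < C := by positivity
  have hC₁C : C₁ ≤ C := (le_max_left _ _).trans le_self_add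
  have hC₂C : C₂ ≤ C := (le_max_right _ _).trans le_self_add
  -- the exponent `b` of the parametrization of segments: `b * m ≤ (b - 1) * q` since `m < q`
  obtain ⟨b, hb, hbq⟩ : ∃ b : ℕ, b ≠ 0 ∧ ((b * m : ℕ) : ℝ) ≤ ((b - 1 : ℕ) : ℝ) * q := by
    obtain ⟨b, hb⟩ := exists_nat_ge (q / (q - m))
    have h1 : 0 < q - m := by linarith
    rw [div_le_iff₀ h1] at hb
    have h2 : 0 < b := by
      rcases Nat.eq_zero_or_pos b with rfl | h3
      · simp at hb; linarith
      · exact h3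
    refine ⟨b, h2.ne', ?_⟩
    rw [Nat.cast_sub h2]
    push_cast
    linarith
  set T₀ : ℝ≥0∞ := (C : ℝ≥0∞) ^ q * ((b : ℝ≥0∞) ^ q * (2 ^ n * (((2 * C : NNReal) : ℝ≥0∞) ^ q * C)))
    with hT₀
  have hT₀t : T₀ ≠ ⊤ := by
    have h1 : ∀ c : NNReal, (c : ℝ≥0∞) ^ q ≠ ⊤ := fun c ↦
      ENNReal.rpow_ne_top_of_nonneg hq0 ENNReal.coe_ne_top
    have h2 : (b : ℝ≥0∞) ^ q ≠ ⊤ := ENNReal.rpow_ne_top_of_nonneg hq0 (ENNReal.natCast_ne_top b)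
    exact ENNReal.mul_ne_top (h1 _) (ENNReal.mul_ne_top h2 (ENNReal.mul_ne_top (by simp)
      (ENNReal.mul_ne_top (h1 _) ENNReal.coe_ne_top)))
  have h2t : (2 : ℝ≥0∞) ^ (q - 1) ≠ ⊤ := ENNReal.rpow_ne_top_of_nonneg (by linarith) (by simp)
  refine ⟨C * 2 ^ (q - 1) * T₀ * C * C, by finiteness, fun k hk ↦ ?_⟩
  obtain ⟨ι, hι, x₀, A, hA, hAle, hAge⟩ := hC₁ k hk
  obtain ⟨κ, hκ, y₀, B, hB, hBle, hBge⟩ := hC₂ k hk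
  have hA' := fun i ↦ (hA i).mono hC₁C
  have hB' := fun j ↦ (hB j).mono hC₂C
  set α : ι → Measure M := fun i ↦ cellMeasure I (x₀ i) (A i)
  set β : κ → Measure N := fun j ↦ cellMeasure J (y₀ j) (B j)
  replace hAle : ∑ i, α i ≤ (C : ℝ≥0∞) • μ := hAle.trans (by gcongr)
  replace hBle : ∑ j, β j ≤ (C : ℝ≥0∞) • ν := hBle.trans (by gcongr)
  replace hAge : μ ≤ (C : ℝ≥0∞) • ∑ i, α i := hAge.trans (by gcongr)
  replace hBge : ν ≤ (C : ℝ≥0∞) • ∑ j, β j := hBge.trans (by gcongr)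
  have hαle : ∀ i, α i ≤ (C : ℝ≥0∞) • μ := fun i ↦
    (Finset.single_le_sum (f := α) (fun _ _ ↦ bot_le) (Finset.mem_univ i)).trans hAle
  have hβle : ∀ j, β j ≤ (C : ℝ≥0∞) • ν := fun j ↦
    (Finset.single_le_sum (f := β) (fun _ _ ↦ bot_le) (Finset.mem_univ j)).trans hBle
  have hπle : ∀ i j, (α i).prod (β j) ≤ ((C * C : NNReal) : ℝ≥0∞) • μ.prod ν := fun i j ↦ by
    refine (Measure.prod_mono (hαle i) (hβle j)).trans_eq ?_
    rw [Measure.prod_smul_left, Measure.prod_smul_right, smul_smul, ENNReal.coe_mul]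
  have hαu : ∀ i, α i univ = volume (A i) := fun i ↦ cellMeasure_univ (hA i).subset_target
  have hβu : ∀ j, β j univ = volume (B j) := fun j ↦ cellMeasure_univ (hB j).subset_target
  have hinv : ∀ {d : ℕ} {s : ℝ≥0∞}, s < ⊤ → 1 ≤ C * (k : ℝ≥0∞) ^ d * s →
      s ≠ 0 ∧ s⁻¹ ≤ C * (k : ℝ≥0∞) ^ d := by
    intro d s hst hs
    have hs0 : s ≠ 0 := by rintro rfl; simp at hs
    refine ⟨hs0, ?_⟩
    calc s⁻¹ = 1 * s⁻¹ := (one_mul _).symm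
      _ ≤ C * (k : ℝ≥0∞) ^ d * s * s⁻¹ := by gcongr
      _ = _ := by rw [mul_assoc, ENNReal.mul_inv_cancel hs0 hst.ne, mul_one]
  have hAt := fun i ↦ (hA i).volume_lt_top hk
  have hBt := fun j ↦ (hB j).volume_lt_top hk
  have hAinv := fun i ↦ hinv (hAt i) (hA' i).one_le_volume
  have hBinv := fun j ↦ hinv (hBt j) (hB' j).one_le_volume
  set T : ℝ≥0∞ := (C * (k : ℝ≥0∞) ^ m * (C * (k : ℝ≥0∞) ^ n)) ^ q * (C * ν univ)
  have hTt : T ≠ ⊤ := by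
    have h1 : C * (k : ℝ≥0∞) ^ m * (C * (k : ℝ≥0∞) ^ n) ≠ ⊤ := by finiteness
    exact ENNReal.mul_ne_top (ENNReal.rpow_ne_top_of_nonneg hq0 h1) (by finiteness)
  refine ⟨ι × κ, inferInstance, fun r ↦ (α r.1).prod (β r.2),
    ((C * C : NNReal) : ℝ≥0∞) + C * 2 ^ (q - 1) * T, by finiteness, fun r ↦
      (hπle r.1 r.2).trans (by gcongr; exact le_self_add), ?_⟩
  intro u w η G hu hw hη hG hηG huq hGq
  set D := ∫⁻ z, G z ^ q ∂(μ.prod ν) with hD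
  set F : ι × κ → ℝ≥0∞ := fun r ↦ ‖∫ z, u z ∂((α r.1).prod (β r.2))‖ₑ ^ q
  have hGm : Measurable fun z ↦ G z ^ q := hG.pow_const q
  have hac : ∀ i j, (α i).prod (β j) ≪ μ.prod ν := fun i j ↦
    (Measure.absolutelyContinuous_of_le (hπle i j)).trans Measure.smul_absolutelyContinuous
  have hfin : ∀ i j {f : M × N → ℝ≥0∞}, ∫⁻ z, f z ∂(μ.prod ν) < ⊤ →
      ∫⁻ z, f z ∂((α i).prod (β j)) < ⊤ := fun i j f hf ↦ by
    refine (lintegral_mono' (hπle i j) le_rfl).trans_lt ?_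
    rw [lintegral_smul_measure, smul_eq_mul]
    exact ENNReal.mul_lt_top ENNReal.coe_lt_top hf
  -- the estimate on one product of cells
  have hcell : ∀ i, ∀ᵐ x ∂(α i), ∀ j, ∫⁻ y, ‖u (x, y)‖ₑ ^ q ∂(β j) ≤
      2 ^ (q - 1) * (T₀ * ((k : ℝ≥0∞) ^ m / (k : ℝ≥0∞) ^ q) *
        ∫⁻ z, G z ^ q ∂((α i).prod (β j)) + T * F (i, j)) := by
    intro i
    refine ae_all_iff.2 fun j ↦ ?_
    have hfα : IsFiniteMeasure (α i) := ⟨(hαu i).trans_lt (hAt i)⟩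
    have hfβ : IsFiniteMeasure (β j) := ⟨(hβu j).trans_lt (hBt j)⟩
    have hP : ((α i).prod (β j)) univ = volume (A i) * volume (B j) := by
      rw [← univ_prod_univ, Measure.prod_prod, hαu, hβu]
    filter_upwards [ae_lintegral_cell_sub_le hC0 hk (hA' i) (hB' j) hq hb hbq hu
      ((hac i j).ae_le hw) hη hG ((hac i j).ae_le hηG) (hfin i j huq) (hfin i j hGq)] with x hx
    have hui : Integrable u ((α i).prod (β j)) :=
      ⟨hu.aestronglyMeasurable, lintegral_lt_top_of_rpow hq hu.enorm.aemeasurable (hfin i j huq)⟩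
    refine (lintegral_rpow_enorm_le_of_lintegral_sub_le
      (by rw [hP]; exact mul_ne_zero (hAinv i).1 (hBinv j).1) hu hui hq hx).trans ?_
    have hPinv : (((α i).prod (β j)) univ)⁻¹ = (volume (A i))⁻¹ * (volume (B j))⁻¹ := by
      rw [hP, ENNReal.mul_inv (.inl (hAinv i).1) (.inl (hAt i).ne)]
    have hCk : (C / k : ℝ≥0∞) ^ q = (C : ℝ≥0∞) ^ q / (k : ℝ≥0∞) ^ q :=
      ENNReal.div_rpow_of_nonneg _ _ hq0
    rw [hPinv]
    refine mul_le_mul' le_rfl (add_le_add ?_ ?_)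
    · set D' := ∫⁻ z, G z ^ q ∂((α i).prod (β j))
      calc (volume (A i))⁻¹ * (volume (B j))⁻¹ * ((C / k : ℝ≥0∞) ^ q * ((b : ℝ≥0∞) ^ q *
            (2 ^ n * volume (B j) * ((2 * C : NNReal) ^ q * D'))))
          = (volume (A i))⁻¹ * ((volume (B j))⁻¹ * volume (B j)) * ((C / k : ℝ≥0∞) ^ q *
            ((b : ℝ≥0∞) ^ q * (2 ^ n * ((2 * C : NNReal) ^ q * D')))) := by ring
        _ ≤ (C * (k : ℝ≥0∞) ^ m) * 1 * ((C : ℝ≥0∞) ^ q / (k : ℝ≥0∞) ^ q *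
            ((b : ℝ≥0∞) ^ q * (2 ^ n * ((2 * C : NNReal) ^ q * D')))) := by
            rw [ENNReal.inv_mul_cancel (hBinv j).1 (hBt j).ne, hCk]
            gcongr
            exact (hAinv i).2
        _ = _ := by
            rw [hT₀]
            simp only [div_eq_mul_inv]
            ring
    · rw [ENNReal.mul_rpow_of_nonneg _ _ hq0, mul_right_comm]
      exact mul_le_mul' (mul_le_mul' (ENNReal.rpow_le_rpow (mul_le_mul' (hAinv i).2 (hBinv j).2)
        hq0) (hβle j univ)) le_rfl
  -- the cells have bounded overlap, so the integrals of `G ^ q` over all of them can be added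
  have hsumD : ∀ i, ∑ j, ∫⁻ z, G z ^ q ∂((α i).prod (β j)) ≤ C * (C * D) := by
    intro i
    have hfβ : ∀ j, IsFiniteMeasure (β j) := fun j ↦ ⟨(hβu j).trans_lt (hBt j)⟩
    calc ∑ j, ∫⁻ z, G z ^ q ∂((α i).prod (β j))
        = ∑ j, ∫⁻ x, ∫⁻ y, G (x, y) ^ q ∂(β j) ∂(α i) :=
          Finset.sum_congr rfl fun j _ ↦ lintegral_prod _ hGm.aemeasurable
      _ = ∫⁻ x, ∫⁻ y, G (x, y) ^ q ∂(∑ j, β j) ∂(α i) := by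
          rw [← lintegral_finsetSum _ fun j _ ↦ hGm.lintegral_prod_right']
          simp only [lintegral_finsetSum_measure]
      _ ≤ ∫⁻ x, ∫⁻ y, G (x, y) ^ q ∂((C : ℝ≥0∞) • ν) ∂((C : ℝ≥0∞) • μ) :=
          lintegral_mono' (hαle i) fun x ↦ lintegral_mono' hBle le_rfl
      _ = C * (C * D) := by
          simp only [lintegral_smul_measure, smul_eq_mul]
          rw [lintegral_const_mul' _ _ ENNReal.coe_ne_top, hD,
            lintegral_prod _ hGm.aemeasurable]
  have hall : ∀ i, ∀ᵐ x ∂(α i), ∫⁻ y, ‖u (x, y)‖ₑ ^ q ∂ν ≤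
      C * 2 ^ (q - 1) * T₀ * C * C * ((k : ℝ≥0∞) ^ m / (k : ℝ≥0∞) ^ q) * D +
        (((C * C : NNReal) : ℝ≥0∞) + C * 2 ^ (q - 1) * T) * ∑ r, F r := by
    intro i
    filter_upwards [hcell i] with x hx
    calc ∫⁻ y, ‖u (x, y)‖ₑ ^ q ∂ν
        ≤ ∫⁻ y, ‖u (x, y)‖ₑ ^ q ∂((C : ℝ≥0∞) • ∑ j, β j) := lintegral_mono' hBge le_rfl
      _ = C * ∑ j, ∫⁻ y, ‖u (x, y)‖ₑ ^ q ∂(β j) := by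
          rw [lintegral_smul_measure, lintegral_finsetSum_measure, smul_eq_mul]
      _ ≤ C * ∑ j, 2 ^ (q - 1) * (T₀ * ((k : ℝ≥0∞) ^ m / (k : ℝ≥0∞) ^ q) *
            ∫⁻ z, G z ^ q ∂((α i).prod (β j)) + T * F (i, j)) := by
          gcongr with j
          exact hx j
      _ = C * (2 ^ (q - 1) * (T₀ * ((k : ℝ≥0∞) ^ m / (k : ℝ≥0∞) ^ q) *
            ∑ j, ∫⁻ z, G z ^ q ∂((α i).prod (β j)) + T * ∑ j, F (i, j))) := by
          rw [← Finset.mul_sum, Finset.sum_add_distrib, ← Finset.mul_sum, ← Finset.mul_sum]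
      _ ≤ C * (2 ^ (q - 1) * (T₀ * ((k : ℝ≥0∞) ^ m / (k : ℝ≥0∞) ^ q) * (C * (C * D)) +
            T * ∑ r, F r)) := by
          gcongr
          · exact hsumD i
          · rw [Fintype.sum_prod_type]
            exact Finset.single_le_sum (f := fun i ↦ ∑ j, F (i, j)) (fun _ _ ↦ zero_le)
              (Finset.mem_univ i)
      _ = C * 2 ^ (q - 1) * T₀ * C * C * ((k : ℝ≥0∞) ^ m / (k : ℝ≥0∞) ^ q) * D +
            C * 2 ^ (q - 1) * T * ∑ r, F r := by ring
      _ ≤ _ := by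
          gcongr
          exact le_add_self
  have hμac : μ ≪ ∑ i, α i :=
    (Measure.absolutelyContinuous_of_le hAge).trans Measure.smul_absolutelyContinuous
  refine hμac.ae_le ?_
  rw [← Measure.sum_fintype]
  exact Measure.ae_sum_iff.2 hall

end Ehrling

/-! ### Functions with values in `L^p` and a criterion for compactness -/

theorem measurable_of_measurable_edist {Ω Y : Type*} [MeasurableSpace Ω] [PseudoEMetricSpace Y]
    [SecondCountableTopology Y] [MeasurableSpace Y] [BorelSpace Y] {f : Ω → Y}
    (hf : ∀ c, Measurable fun a ↦ edist (f a) c) : Measurable f := by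
  have hb : TopologicalSpace.IsTopologicalBasis
      {s : Set Y | ∃ c, ∃ r : ℝ≥0∞, s = Metric.eball c r} := by
    refine TopologicalSpace.isTopologicalBasis_of_isOpen_of_nhds ?_ fun c s hc hs ↦ ?_
    · rintro _ ⟨c, r, rfl⟩
      exact Metric.isOpen_eball
    · obtain ⟨r, hr, hrs⟩ := EMetric.isOpen_iff.1 hs c hc
      exact ⟨_, ⟨c, r, rfl⟩, Metric.mem_eball_self hr, hrs⟩
  borelize Y
  rw [hb.borel_eq_generateFrom]
  refine measurable_generateFrom ?_
  rintro _ ⟨c, r, rfl⟩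
  exact measurableSet_lt (hf c) measurable_const

section Slice

variable {Y Z : Type*} [MeasurableSpace Y] [MeasurableSpace Z] {μ : Measure Y} {ν : Measure Z}
  {p : ℝ≥0∞}

theorem measurable_eLpNorm_slice [SFinite ν] (hp : p ≠ ⊤) {f : Y × Z → ℝ} (hf : Measurable f) :
    Measurable fun x ↦ eLpNorm (fun y ↦ f (x, y)) p ν := by
  rcases eq_or_ne p 0 with rfl | h0
  · simp
  · simp only [eLpNorm_eq_lintegral_rpow_enorm_toReal h0 hp]
    exact (Measurable.lintegral_prod_right' (f := fun z ↦ ‖f z‖ₑ ^ p.toReal)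
      (hf.enorm.pow_const _)).pow_const _

/-- A measurable function on a product whose slices are in `L^p`, with uniformly bounded norms,
defines an essentially bounded function with values in `L^p`. -/
theorem exists_Lp_top_of_slice [IsFiniteMeasure μ] [SFinite ν] [IsSeparable ν] [Fact (1 ≤ p)]
    [Fact (p ≠ ⊤)] {f : Y × Z → ℝ} (hf : Measurable f) {C : ℝ} (hC : 0 ≤ C)
    (hfC : ∀ᵐ x ∂μ, eLpNorm (fun y ↦ f (x, y)) p ν ≤ ENNReal.ofReal C) :
    ∃ L : Lp (Lp ℝ p ν) ⊤ μ, (∀ᵐ x ∂μ, ∀ᵐ y ∂ν, L x y = f (x, y)) ∧ ‖L‖ ≤ C := by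
  classical
  have hsl : ∀ x, Measurable fun y ↦ f (x, y) := fun x ↦ hf.comp measurable_prodMk_left
  set S : Y → Lp ℝ p ν := fun x ↦
    if h : eLpNorm (fun y ↦ f (x, y)) p ν < ⊤ then
      MemLp.toLp (fun y ↦ f (x, y)) ⟨(hsl x).aestronglyMeasurable, h⟩ else 0 with hS
  let _ : MeasurableSpace (Lp ℝ p ν) := borel _
  have : BorelSpace (Lp ℝ p ν) := ⟨rfl⟩
  have hSm : Measurable S := by
    refine measurable_of_measurable_edist fun c ↦ ?_
    have h1 : (fun x ↦ edist (S x) c) = fun x ↦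
        if eLpNorm (fun y ↦ f (x, y)) p ν < ⊤ then eLpNorm (fun y ↦ f (x, y) - c y) p ν
        else edist 0 c := by
      funext x
      by_cases h : eLpNorm (fun y ↦ f (x, y)) p ν < ⊤
      · rw [if_pos h, hS]
        simp only [h, dite_true]
        rw [Lp.edist_def]
        exact eLpNorm_congr_ae ((MemLp.coeFn_toLp _).sub EventuallyEq.rfl)
      · rw [if_neg h, hS]
        simp only [h, dite_false]
    rw [h1]
    refine Measurable.ite (measurableSet_lt (measurable_eLpNorm_slice Fact.out hf)
      measurable_const) (measurable_eLpNorm_slice (f := fun z ↦ f z - c z.2) Fact.out ?_)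
      measurable_const
    exact hf.sub ((Lp.stronglyMeasurable c).measurable.comp measurable_snd)
  have hSC : ∀ᵐ x ∂μ, ‖S x‖ ≤ C ∧ ∀ᵐ y ∂ν, S x y = f (x, y) := by
    filter_upwards [hfC] with x hx
    have h : eLpNorm (fun y ↦ f (x, y)) p ν < ⊤ := hx.trans_lt ENNReal.ofReal_lt_top
    have h1 : S x = MemLp.toLp (fun y ↦ f (x, y)) ⟨(hsl x).aestronglyMeasurable, h⟩ := by
      simp only [hS, h, dite_true]
    rw [h1]
    refine ⟨?_, MemLp.coeFn_toLp _⟩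
    exact (Lp.norm_toLp _ _).trans_le (ENNReal.toReal_le_of_le_ofReal hC hx)
  have hmem : MemLp S ⊤ μ := memLp_top_of_bound hSm.aestronglyMeasurable C
    (hSC.mono fun x hx ↦ hx.1)
  refine ⟨hmem.toLp S, ?_, ?_⟩
  · filter_upwards [hSC, hmem.coeFn_toLp] with x hx h1
    rw [h1]
    exact hx.2
  · refine (Lp.norm_le_of_ae_bound hC (f := hmem.toLp S) ?_).trans ?_
    · filter_upwards [hSC, hmem.coeFn_toLp] with x hx h1
      rw [h1]
      exact hx.1
    · simp

theorem Lp_top_ext_slice [Fact (1 ≤ p)] {L L' : Lp (Lp ℝ p ν) ⊤ μ}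
    (h : ∀ᵐ x ∂μ, ∀ᵐ y ∂ν, L x y = L' x y) : L = L' :=
  Lp.ext (h.mono fun _ hx ↦ Lp.ext hx)

end Slice

/-- A bounded operator that is controlled, up to an arbitrarily small multiple of the norm, by
finitely many continuous linear functionals is compact. -/
theorem isCompactOperator_of_forall_norm_le {X Y : Type*} [NormedAddCommGroup X] [NormedSpace ℝ X]
    [NormedAddCommGroup Y] [NormedSpace ℝ Y] [CompleteSpace Y] (T : X →L[ℝ] Y)
    (hT : ∀ ε > (0 : ℝ), ∃ (κ : Type*) (_ : Fintype κ) (L : X →L[ℝ] κ → ℝ),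
      ∀ u, ‖T u‖ ≤ ε * ‖u‖ + ‖L u‖) : IsCompactOperator T := by
  refine (isCompactOperator_iff_isCompact_closure_image_ball (T : X →ₗ[ℝ] Y) one_pos).2 ?_
  refine TotallyBounded.isCompact_of_isClosed (TotallyBounded.closure
    (Metric.totallyBounded_iff.2 fun ε hε ↦ ?_)) isClosed_closure
  obtain ⟨κ, _, L, hL⟩ := hT (ε / 4) (by positivity)
  have hb : Bornology.IsBounded (L '' Metric.ball 0 1) :=
    L.lipschitz.isBounded_image Metric.isBounded_ball
  obtain ⟨t, ht, htf, hcov⟩ :=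
    totallyBounded_iff_subset.1 (hb.isCompact_closure.totallyBounded.subset subset_closure) _
      (Metric.dist_mem_uniformity (half_pos hε))
  set σ : (κ → ℝ) → X := Function.invFunOn L (Metric.ball 0 1)
  have hσ : ∀ a ∈ t, σ a ∈ Metric.ball 0 1 ∧ L (σ a) = a := fun a ha ↦
    ⟨Function.invFunOn_mem (ht ha), Function.invFunOn_eq (ht ha)⟩
  refine ⟨(fun a ↦ T (σ a)) '' t, htf.image _, ?_⟩
  rintro _ ⟨u, hu, rfl⟩
  obtain ⟨a, ha, hua⟩ := mem_iUnion₂.1 (hcov ⟨u, hu, rfl⟩)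
  refine mem_iUnion₂.2 ⟨_, mem_image_of_mem _ ha, ?_⟩
  obtain ⟨h1, h2⟩ := hσ a ha
  have h3 : ‖L (u - σ a)‖ < ε / 2 := by
    rw [map_sub, h2, ← dist_eq_norm]
    exact hua
  have h4 : ‖u - σ a‖ < 2 := by
    have := norm_sub_le u (σ a)
    rw [mem_ball_zero_iff] at hu h1
    linarith
  rw [Metric.mem_ball, dist_eq_norm]
  change ‖T u - T (σ a)‖ < ε
  rw [← map_sub]
  nlinarith [hL (u - σ a)]

/-! ### The inequality of Ehrling type -/

/-- The integral against a measure `π ≤ c • ρ` is a bounded linear functional on `L^p(ρ)`. -/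
theorem exists_clm_eq_integral {Z : Type*} [MeasurableSpace Z] {ρ π : Measure Z}
    [IsFiniteMeasure ρ] {c : ℝ≥0∞} (hc : c ≠ ⊤) (hπ : π ≤ c • ρ) (p : ℝ≥0∞) [Fact (1 ≤ p)] :
    ∃ L : Lp ℝ p ρ →L[ℝ] ℝ, ∀ f, L f = ∫ z, f z ∂π := by
  have hac : π ≪ ρ :=
    (Measure.absolutelyContinuous_of_le hπ).trans Measure.smul_absolutelyContinuous
  have hint : ∀ f : Lp ℝ p ρ, Integrable f π := fun f ↦
    (((Lp.memLp f).integrable Fact.out).smul_measure hc).mono_measure hπ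
  set d : ℝ≥0∞ := c * ρ univ ^ (1 - 1 / p.toReal) with hd
  have hp1 : 0 ≤ 1 - 1 / p.toReal := by
    rcases eq_or_ne p ⊤ with rfl | hp
    · simp
    · have h1 : 1 ≤ p.toReal := by
        simpa using (ENNReal.toReal_le_toReal (by simp) hp).2 (Fact.out : 1 ≤ p)
      rw [sub_nonneg, div_le_one (by linarith)]
      exact h1
  have hdt : d ≠ ⊤ :=
    ENNReal.mul_ne_top hc (ENNReal.rpow_ne_top_of_nonneg hp1 (measure_ne_top _ _))
  refine ⟨LinearMap.mkContinuous
    { toFun f := ∫ z, f z ∂π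
      map_add' f f' := by
        rw [← integral_add (hint f) (hint f')]
        exact integral_congr_ae (hac.ae_le (Lp.coeFn_add f f'))
      map_smul' a f := by
        rw [RingHom.id_apply, ← integral_smul]
        exact integral_congr_ae (hac.ae_le (Lp.coeFn_smul a f)) } d.toReal fun f ↦ ?_,
    fun f ↦ rfl⟩
  have h1 : ‖∫ z, f z ∂π‖ₑ ≤ d * ‖f‖ₑ := by
    calc ‖∫ z, f z ∂π‖ₑ ≤ ∫⁻ z, ‖f z‖ₑ ∂π := enorm_integral_le_lintegral_enorm _
      _ ≤ ∫⁻ z, ‖f z‖ₑ ∂(c • ρ) := lintegral_mono' hπ le_rfl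
      _ = c * eLpNorm f 1 ρ := by
          rw [lintegral_smul_measure, eLpNorm_one_eq_lintegral_enorm, smul_eq_mul]
      _ ≤ c * (eLpNorm f p ρ * ρ univ ^ (1 / (1 : ℝ≥0∞).toReal - 1 / p.toReal)) := by
          gcongr
          exact eLpNorm_le_eLpNorm_mul_rpow_measure_univ Fact.out
            (Lp.aestronglyMeasurable f)
      _ = d * ‖f‖ₑ := by
          rw [Lp.enorm_def, hd]
          simp only [ENNReal.toReal_one, div_one]
          ring
  have h2 := ENNReal.toReal_mono (ENNReal.mul_ne_top hdt enorm_ne_top) h1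
  simpa [ENNReal.toReal_mul] using h2

theorem lintegral_rpow_enorm_eq_eLpNorm_rpow {Z F : Type*} [MeasurableSpace Z] [TopologicalSpace F]
    [ContinuousENorm F] (ρ : Measure Z) (f : Z → F) {p : ℝ≥0∞} (hp0 : p ≠ 0) (hp : p ≠ ⊤) :
    ∫⁻ z, ‖f z‖ₑ ^ p.toReal ∂ρ = eLpNorm f p ρ ^ p.toReal := by
  rw [eLpNorm_eq_lintegral_rpow_enorm_toReal hp0 hp, ← ENNReal.rpow_mul,
    one_div_mul_cancel (ENNReal.toReal_pos hp0 hp).ne', ENNReal.rpow_one]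

theorem tendsto_const_mul_natCast_pow_div_rpow {Θ : ℝ≥0∞} (hΘ : Θ ≠ ⊤) {m : ℕ} {q : ℝ}
    (hmq : m < q) :
    Tendsto (fun k : ℕ ↦ Θ * ((k : ℝ≥0∞) ^ m / (k : ℝ≥0∞) ^ q)) atTop (𝓝 0) := by
  have h1 : Tendsto (fun k : ℕ ↦ (k : ℝ≥0∞) ^ (q - m)) atTop (𝓝 ⊤) := by
    have h2 := (ENNReal.continuous_rpow_const (y := q - m)).tendsto ⊤
    rw [ENNReal.top_rpow_of_pos (by linarith)] at h2
    exact h2.comp ENNReal.tendsto_nat_nhds_top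
  have h3 := ENNReal.Tendsto.const_mul (tendsto_inv_iff.2 h1) (.inr hΘ)
  rw [ENNReal.inv_top, mul_zero] at h3
  refine h3.congr' ?_
  filter_upwards [eventually_ne_atTop 0] with k hk
  have hk0 : (k : ℝ≥0∞) ≠ 0 := Nat.cast_ne_zero.2 hk
  rw [← ENNReal.rpow_neg, neg_sub, ENNReal.rpow_sub _ _ hk0 (ENNReal.natCast_ne_top k),
    ENNReal.rpow_natCast]

section Sobolev

variable {E : Type*} [NormedAddCommGroup E] [NormedSpace ℝ E] [MeasureSpace E]
  [OpensMeasurableSpace E] {H : Type*} [TopologicalSpace H] {I : ModelWithCorners ℝ E H}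
  {X : Type*} [TopologicalSpace X] [ChartedSpace H X] [MeasurableSpace X]
  {g : Bundle.RiemannianMetric (fun x : X ↦ TangentSpace I x)} {μ : Measure X} {p : ℝ≥0∞}
  [Fact (1 ≤ p)]

theorem SobolevSpace.enorm_def (u : SobolevSpace g μ p) :
    ‖u‖ₑ = ‖u.toLp‖ₑ + differentialNorm g μ p u.toLp := by
  have hu : differentialNorm g μ p u.toLp < ⊤ := u.2
  rw [← ofReal_norm, norm_def, ENNReal.ofReal_add (norm_nonneg _) ENNReal.toReal_nonneg,
    ofReal_norm, ENNReal.ofReal_toReal hu.ne]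

variable (g μ p) in
/-- The embedding of `W^{1,p}` in `L^p`. -/
noncomputable def SobolevSpace.toLpL : SobolevSpace g μ p →L[ℝ] Lp ℝ p μ :=
  LinearMap.mkContinuous
    { toFun := SobolevSpace.toLp
      map_add' := fun _ _ ↦ rfl
      map_smul' := fun _ _ ↦ rfl } 1 fun u ↦ by
      rw [one_mul, SobolevSpace.norm_def]
      exact le_add_of_nonneg_right ENNReal.toReal_nonneg

/-- If `u ≠ 0`, then the infima in the definition of `‖du‖_{L^p}` are attained up to an error of
`‖u‖_{L^p}`. -/
theorem SobolevSpace.exists_majorant {u : SobolevSpace g μ p} (hu : u ≠ 0) :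
    ∃ (w : X → ℝ) (η : ∀ x : X, TangentSpace I x →L[ℝ] ℝ) (G : X → ℝ≥0∞),
      w =ᵐ[μ] u.toLp ∧ HasWeakDifferential w η ∧ Measurable G ∧
      (∀ᵐ x ∂μ, covectorNorm g x (η x) ≤ G x) ∧ eLpNorm G p μ < ‖u‖ₑ := by
  have hu0 : u.toLp ≠ 0 := fun h ↦ hu (Subtype.ext h)
  have hut : differentialNorm g μ p u.toLp < ⊤ := u.2
  have h1 : differentialNorm g μ p u.toLp < ‖u‖ₑ := by
    rw [SobolevSpace.enorm_def, add_comm]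
    exact ENNReal.lt_add_right hut.ne (by simpa using hu0)
  unfold differentialNorm upperLpNorm at h1
  simp only [iInf_lt_iff] at h1
  obtain ⟨w, η, ⟨hw, hη⟩, G, ⟨hG, hηG⟩, hlt⟩ := h1
  exact ⟨w, η, G, hw, hη, hG, hηG, hlt⟩

end Sobolev

section Ehrling

universe u v

variable {m n : ℕ} {H K : Type*} [TopologicalSpace H] [TopologicalSpace K]
  {I : ModelWithCorners ℝ (EuclideanSpace ℝ (Fin m)) H}
  {J : ModelWithCorners ℝ (EuclideanSpace ℝ (Fin n)) K}
  {M : Type u} {N : Type v} [TopologicalSpace M] [ChartedSpace H M] [IsManifold I ∞ M]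
  [CompactSpace M] [MeasurableSpace M] [BorelSpace M]
  [TopologicalSpace N] [ChartedSpace K N] [IsManifold J ∞ N]
  [CompactSpace N] [MeasurableSpace N] [BorelSpace N]

/-- The slices of a Sobolev function are bounded in `L^p` by a small multiple of the Sobolev norm,
up to finitely many bounded linear functionals (the mean values over the products of cells). -/
theorem exists_forall_ae_eLpNorm_slice_le (hI : IsBoundaryModel I) (hJ : IsBoundaryModel J)
    (g : Bundle.ContMDiffRiemannianMetric I ∞ (EuclideanSpace ℝ (Fin m))
      (fun x : M ↦ TangentSpace I x))
    (h : Bundle.ContMDiffRiemannianMetric J ∞ (EuclideanSpace ℝ (Fin n))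
      (fun y : N ↦ TangentSpace J y)) (p : ℝ≥0∞) [Fact (1 ≤ p)] (hp : p ≠ ⊤)
    (hm : (m : ℝ≥0∞) < p) {ε : ℝ} (hε : 0 < ε) :
    ∃ (κ : Type (max u v)) (_ : Fintype κ)
      (L : SobolevSpace (prodMetric g.toRiemannianMetric h.toRiemannianMetric)
        ((riemannianVolume g.toRiemannianMetric).prod (riemannianVolume h.toRiemannianMetric)) p
          →L[ℝ] κ → ℝ),
      ∀ u, ∀ᵐ x ∂(riemannianVolume g.toRiemannianMetric),
        eLpNorm (fun y ↦ u.toLp (x, y)) p (riemannianVolume h.toRiemannianMetric) ≤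
          ENNReal.ofReal (ε * ‖u‖ + ‖L u‖) := by
  have hfμ := isFiniteMeasure_riemannianVolume hI g
  have hfν := isFiniteMeasure_riemannianVolume hJ h
  set μ := riemannianVolume g.toRiemannianMetric
  set ν := riemannianVolume h.toRiemannianMetric
  set q := p.toReal
  have hp1 : 1 ≤ p := Fact.out
  have hp0 : p ≠ 0 := (one_pos.trans_le hp1).ne'
  have hq1 : 1 ≤ q := by
    simpa using (ENNReal.toReal_le_toReal (by simp) hp).2 hp1
  have hq0 : 0 < q := by linarith
  have hmq : (m : ℝ) < q := by
    simpa using (ENNReal.toReal_lt_toReal (by simp) hp).2 hm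
  obtain ⟨Θ, hΘ, hall⟩ := exists_ae_lintegral_slice_le hI hJ g h hq1 hmq
  obtain ⟨k, hk, hkε⟩ : ∃ k : ℕ, k ≠ 0 ∧
      Θ * ((k : ℝ≥0∞) ^ m / (k : ℝ≥0∞) ^ q) ≤ ENNReal.ofReal ε ^ q := by
    have h1 : 0 < ENNReal.ofReal ε ^ q :=
      ENNReal.rpow_pos (ENNReal.ofReal_pos.2 hε) ENNReal.ofReal_ne_top
    obtain ⟨k, hk, hk0⟩ := (((tendsto_const_mul_natCast_pow_div_rpow hΘ hmq).eventually
      (gt_mem_nhds h1)).and (eventually_ne_atTop 0)).exists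
    exact ⟨k, hk0, hk.le⟩
  obtain ⟨κ, hκ, π, Θ', hΘ', hπ, hest⟩ := hall k hk
  choose ℓ hℓ using fun i ↦ exists_clm_eq_integral hΘ' (hπ i) p
  set c : ℝ≥0∞ := (Θ' * Fintype.card κ) ^ (1 / q) with hc
  have hct : c ≠ ⊤ := ENNReal.rpow_ne_top_of_nonneg (by positivity) (by finiteness)
  refine ⟨κ, hκ, c.toReal • ContinuousLinearMap.pi fun i ↦
    (ℓ i).comp (SobolevSpace.toLpL _ _ p), fun u ↦ ?_⟩
  rcases eq_or_ne u 0 with rfl | hu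
  · have h0 : (0 : SobolevSpace (prodMetric g.toRiemannianMetric h.toRiemannianMetric)
        (μ.prod ν) p).toLp =ᵐ[μ.prod ν] 0 := Lp.coeFn_zero ℝ p (μ.prod ν)
    filter_upwards [Measure.ae_ae_of_ae_prod h0] with x hx
    rw [eLpNorm_congr_ae (g := 0) hx, eLpNorm_zero]
    exact zero_le
  obtain ⟨w, η, G, hw, hη, hG, hηG, hlt⟩ := SobolevSpace.exists_majorant hu
  have hG' : ∫⁻ z, G z ^ q ∂(μ.prod ν) ≤ ‖u‖ₑ ^ q := by
    refine (lintegral_rpow_enorm_eq_eLpNorm_rpow (μ.prod ν) G hp0 hp).trans_le ?_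
    exact ENNReal.rpow_le_rpow hlt.le hq0.le
  have hut : ∫⁻ z, ‖u.toLp z‖ₑ ^ q ∂(μ.prod ν) < ⊤ := by
    rw [lintegral_rpow_enorm_eq_eLpNorm_rpow _ _ hp0 hp]
    exact ENNReal.rpow_lt_top_of_nonneg hq0.le (Lp.eLpNorm_ne_top _)
  set V : κ → ℝ := ContinuousLinearMap.pi (fun i ↦ (ℓ i).comp
    (SobolevSpace.toLpL (prodMetric g.toRiemannianMetric h.toRiemannianMetric) (μ.prod ν) p)) u
  filter_upwards [hest _ w η G (Lp.stronglyMeasurable u.toLp).measurable hw hη hG hηG hut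
    (hG'.trans_lt (ENNReal.rpow_lt_top_of_nonneg hq0.le enorm_ne_top))] with x hx
  have hsum : ∑ i, ‖∫ z, u.toLp z ∂(π i)‖ₑ ^ q ≤ Fintype.card κ * ‖V‖ₑ ^ q := by
    calc ∑ i, ‖∫ z, u.toLp z ∂(π i)‖ₑ ^ q ≤ ∑ _i : κ, ‖V‖ₑ ^ q := by
          refine Finset.sum_le_sum fun i _ ↦ ENNReal.rpow_le_rpow ?_ hq0.le
          rw [← hℓ i]
          exact enorm_le_iff_norm_le.2 (norm_le_pi_norm V i)
      _ = _ := by simp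
  have hcq : c ^ q = Θ' * Fintype.card κ := by
    rw [hc, ← ENNReal.rpow_mul, one_div_mul_cancel hq0.ne', ENNReal.rpow_one]
  have hR : ENNReal.ofReal (ε * ‖u‖ + ‖c.toReal • V‖) = ENNReal.ofReal ε * ‖u‖ₑ + c * ‖V‖ₑ := by
    rw [ENNReal.ofReal_add (by positivity) (norm_nonneg _), ENNReal.ofReal_mul hε.le, ofReal_norm,
      ofReal_norm, enorm_smul, Real.enorm_of_nonneg ENNReal.toReal_nonneg,
      ENNReal.ofReal_toReal hct]
  refine le_trans ?_ hR.ge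
  rw [← ENNReal.rpow_le_rpow_iff hq0, ← lintegral_rpow_enorm_eq_eLpNorm_rpow _ _ hp0 hp]
  refine (hx.trans ?_).trans (ENNReal.add_rpow_le_rpow_add _ _ hq1)
  rw [ENNReal.mul_rpow_of_nonneg _ _ hq0.le, ENNReal.mul_rpow_of_nonneg _ _ hq0.le, hcq,
    mul_assoc Θ']
  gcongr

end Ehrling

/-! ### The compact embedding -/

/-- If the slices of the functions `ℓ u` satisfy an estimate with an arbitrarily small multiple of
`‖u‖` and finitely many functionals, then `u ↦ (x ↦ ℓ u (x, ·))` is a compact operator. -/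
theorem exists_isCompactOperator_slice {Y Z : Type*} [MeasurableSpace Y] [MeasurableSpace Z]
    {μ : Measure Y} {ν : Measure Z} [IsFiniteMeasure μ] [SFinite ν] [IsSeparable ν] {p : ℝ≥0∞}
    [Fact (1 ≤ p)] [Fact (p ≠ ⊤)] {X : Type*} [NormedAddCommGroup X] [NormedSpace ℝ X]
    (ℓ : X →L[ℝ] Lp ℝ p (μ.prod ν)) (hℓ : Function.Injective ℓ)
    (hslice : ∀ ε > (0 : ℝ), ∃ (κ : Type*) (_ : Fintype κ) (Λ : X →L[ℝ] κ → ℝ),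
      ∀ u, ∀ᵐ x ∂μ, eLpNorm (fun y ↦ ℓ u (x, y)) p ν ≤ ENNReal.ofReal (ε * ‖u‖ + ‖Λ u‖)) :
    ∃ ι : X →L[ℝ] Lp (Lp ℝ p ν) ⊤ μ,
      (∀ u, ∀ᵐ x ∂μ, ∀ᵐ y ∂ν, ι u x y = ℓ u (x, y)) ∧
      Function.Injective ι ∧ IsCompactOperator ι := by
  -- the slices of a Sobolev function, and the bound that they inherit
  have hex : ∀ u : X, ∃ L : Lp (Lp ℝ p ν) ⊤ μ,
      (∀ᵐ x ∂μ, ∀ᵐ y ∂ν, L x y = ℓ u (x, y)) ∧ ∀ C : ℝ, 0 ≤ C →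
        (∀ᵐ x ∂μ, eLpNorm (fun y ↦ ℓ u (x, y)) p ν ≤ ENNReal.ofReal C) → ‖L‖ ≤ C := by
    intro u
    have hu := (Lp.stronglyMeasurable (ℓ u)).measurable
    obtain ⟨κ, _, Λ, hΛ⟩ := hslice 1 one_pos
    obtain ⟨L, hL, -⟩ := exists_Lp_top_of_slice hu (by positivity) (hΛ u)
    refine ⟨L, hL, fun C hC huC ↦ ?_⟩
    obtain ⟨L', hL', hn⟩ := exists_Lp_top_of_slice hu hC huC
    rwa [Lp_top_ext_slice (L := L) (L' := L')]
    filter_upwards [hL, hL'] with x hx hx'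
    filter_upwards [hx, hx'] with y hy hy'
    rw [hy, hy']
  choose T hT hTn using hex
  have hbound : ∀ {ε : ℝ}, 0 < ε → ∃ (κ : Type _) (_ : Fintype κ)
      (Λ : X →L[ℝ] κ → ℝ), ∀ u, ‖T u‖ ≤ ε * ‖u‖ + ‖Λ u‖ := by
    intro ε hε
    obtain ⟨κ, hκ, Λ, hΛ⟩ := hslice ε hε
    exact ⟨κ, hκ, Λ, fun u ↦ hTn u _ (by positivity) (hΛ u)⟩
  have hadd : ∀ u v, T (u + v) = T u + T v := by
    intro u v
    refine Lp_top_ext_slice ?_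
    filter_upwards [hT (u + v), hT u, hT v, Lp.coeFn_add (T u) (T v),
      Measure.ae_ae_of_ae_prod (Lp.coeFn_add (ℓ u) (ℓ v))] with x h1 h2 h3 h4 h5
    rw [h4, Pi.add_apply]
    filter_upwards [h1, h2, h3, h5, Lp.coeFn_add (T u x) (T v x)] with y k1 k2 k3 k5 k6
    rw [k1, k6, Pi.add_apply, k2, k3, map_add]
    exact k5
  have hsmul : ∀ (c : ℝ) u, T (c • u) = c • T u := by
    intro c u
    refine Lp_top_ext_slice ?_
    filter_upwards [hT (c • u), hT u, Lp.coeFn_smul c (T u),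
      Measure.ae_ae_of_ae_prod (Lp.coeFn_smul c (ℓ u))] with x h1 h2 h4 h5
    rw [h4, Pi.smul_apply]
    filter_upwards [h1, h2, h5, Lp.coeFn_smul c (T u x)] with y k1 k2 k5 k6
    rw [k1, k6, Pi.smul_apply, k2, map_smul]
    exact k5
  obtain ⟨κ, _, Λ, hΛ⟩ := hbound one_pos
  set ι : X →L[ℝ] Lp (Lp ℝ p ν) ⊤ μ := LinearMap.mkContinuous
    { toFun := T, map_add' := hadd, map_smul' := hsmul } (1 + ‖Λ‖) fun u ↦ by
      rw [add_mul]
      exact (hΛ u).trans (by gcongr; exact Λ.le_opNorm u)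
  refine ⟨ι, hT, ?_, isCompactOperator_of_forall_norm_le ι fun ε hε ↦ hbound hε⟩
  refine (injective_iff_map_eq_zero ι).2 fun u hu ↦ (injective_iff_map_eq_zero ℓ).1 hℓ u ?_
  refine Lp.ext (EventuallyEq.trans ?_ (Lp.coeFn_zero ℝ p (μ.prod ν)).symm)
  have hm0 : MeasurableSet {z : Y × Z | ℓ u z = (0 : Y × Z → ℝ) z} :=
    measurableSet_eq_fun (Lp.stronglyMeasurable (ℓ u)).measurable measurable_zero
  refine (Measure.ae_prod_iff_ae_ae hm0).2 ?_
  have hu' : T u = 0 := hu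
  have h0 : ∀ᵐ x ∂μ, T u x = 0 := by
    rw [hu']
    exact Lp.coeFn_zero (Lp ℝ p ν) ⊤ μ
  filter_upwards [hT u, h0] with x h1 h2
  filter_upwards [h1, Lp.coeFn_zero ℝ p ν] with y k1 k2
  rw [← k1, h2, k2]
  rfl

theorem mainTheorem5 {m n : ℕ} {H K : Type*} [TopologicalSpace H] [TopologicalSpace K]
    (I : ModelWithCorners ℝ (EuclideanSpace ℝ (Fin m)) H) (hI : IsBoundaryModel I)
    (J : ModelWithCorners ℝ (EuclideanSpace ℝ (Fin n)) K) (hJ : IsBoundaryModel J)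
    {M N : Type*}
    [TopologicalSpace M] [ChartedSpace H M] [IsManifold I ∞ M] [CompactSpace M] [T2Space M]
    [MeasurableSpace M] [BorelSpace M]
    [TopologicalSpace N] [ChartedSpace K N] [IsManifold J ∞ N] [CompactSpace N] [T2Space N]
    [MeasurableSpace N] [BorelSpace N]
    (g : Bundle.ContMDiffRiemannianMetric I ∞ (EuclideanSpace ℝ (Fin m))
      (fun x : M ↦ TangentSpace I x))
    (h : Bundle.ContMDiffRiemannianMetric J ∞ (EuclideanSpace ℝ (Fin n))
      (fun y : N ↦ TangentSpace J y))
    (p : ℝ≥0∞) [Fact (1 ≤ p)] (hp : p ≠ ⊤) (hm : (m : ℝ≥0∞) < p) (hn : (n : ℝ≥0∞) < p) :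
    ∃ ι : SobolevSpace (prodMetric g.toRiemannianMetric h.toRiemannianMetric)
          ((riemannianVolume g.toRiemannianMetric).prod (riemannianVolume h.toRiemannianMetric)) p
        →L[ℝ] Lp (Lp ℝ p (riemannianVolume h.toRiemannianMetric)) ⊤
          (riemannianVolume g.toRiemannianMetric),
      (∀ u, ∀ᵐ x ∂(riemannianVolume g.toRiemannianMetric),
        ∀ᵐ y ∂(riemannianVolume h.toRiemannianMetric), ι u x y = u.toLp (x, y)) ∧
      Function.Injective ι ∧ IsCompactOperator ι := by
  have hfμ := isFiniteMeasure_riemannianVolume hI g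
  have hfν := isFiniteMeasure_riemannianVolume hJ h
  have hK : SecondCountableTopology K := J.secondCountableTopology
  have hN : SecondCountableTopology N := ChartedSpace.secondCountable_of_sigmaCompact K N
  have hpt : Fact (p ≠ ⊤) := ⟨hp⟩
  exact exists_isCompactOperator_slice (SobolevSpace.toLpL _ _ p) Subtype.val_injective
    fun ε hε ↦ exists_forall_ae_eLpNorm_slice_le hI hJ g h p hp hm hε
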